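/- Let $d\ge 1$. Let $R\subset\mathbb R^d$ be a finite (possibly empty) root system normalized by $\langle v,v\rangle=2$ for all $v\in R$, that is, $\sigma_u R= R$ for all $u\in R$, where $\sigma_u x=x-\frac{2\langle x,u\rangle}{\|u\|^2}u$; let $R_+$ be a positive subsystem of $R$, let $\kappa:R\to[0,\infty)$ be a multiplicity function, i.e. $\kappa(\sigma_u v)=\kappa(v)$ for $u,v\in R$, and let $\mu\ge 0$. On the closed unit ball $\mathbb B^d$ consider the weight $$W(x)=W^B_{\kappa,\mu}(x)=\Big(\prod_{v\in R_+}|\langle x,v\rangle|^{2\kappa_v}\Big)(1-\|x\|^2)^{\mu-1/2},$$ put $|\kappa|=\sum_{v\in R_+}\kappa_v$, $\lambda=\frac{d-1}2+|\kappa|+\mu$, and let $$\Delta^B_{\kappa,\mu}=\sum_{i=1}^d\mathcal D_i^2-\langle x,\nabla\rangle^2-2\lambda\langle x,\nabla\rangle ,\qquad \mathcal D_if(x)=\partial_if(x)+\sum_{v\in R_+}\kappa_v\langle v,e_i\rangle\frac{f(x)-f(\sigma_vx)}{\langle x,v\rangle},$$ be the associated second order differential-difference operator, whose polynomial eigenfunctions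 have the eigenvalues $-n(n+2\lambda)$, $n=0,1,2,\dots$ For $f\in L^2(W)$, a function $g\in L^2(W)$ is called $\sqrt{-\Delta^B_{\kappa,\mu}}\,f$ if for every $n\ge0$ and every polynomial $p$ with $\Delta^B_{\kappa,\mu}p=-n(n+2\lambda)p$, $$\int_{\mathbb B^d} g\,p\,W\,dx=\sqrt{n(n+2\lambda)}\int_{\mathbb B^d} f\,p\,W\,dx .$$ Then there is a constant $C=C_{d,\kappa,\mu}>0$, depending only on $d$, on $\kappa$ (with the root system $R$ on which it is defined) and on $\mu$, such that for every (real- or complex-valued) $f\in C^1(\mathbb B^d)$ with $$\int_{\mathbb B^d} f(x)W(x)\,dx=0,\qquad \int_{\mathbb B^d}|f(x)|^2W(x)\,dx=1,$$ the function $\sqrt{-\Delta^B_{\kappa,\mu}}\,f\in L^2(W)$ exists, the minimum below is attained, and $$\Big[\min_{y\in\mathbb B^d}\int_{\mathbb B^d}(1-\langle x,y\rangle)|f(x)|^2W(x)\,dx\Big]\cdot\Big[\int_{\mathbb B^d}\big|\sqrt{-\Delta^B_{\kappa,\mu}}\,f(x)\big|^2W(x)\,dx\Big]\ge C .$$ 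-/

import Mathlib

open MeasureTheory

namespace WeightedBall

/-- The reflection `x ↦ x - (2⟨x, v⟩ / ‖v‖²) v` in the hyperplane orthogonal to `v`. -/
noncomputable def refl {d : ℕ} (v x : EuclideanSpace ℝ (Fin d)) : EuclideanSpace ℝ (Fin d) :=
  x - (2 * inner ℝ x v / ‖v‖ ^ 2) • v

/-- `R` is a (finite, reduced) root system in `ℝ^d`, normalized by `⟨v, v⟩ = 2`.  The associated
finite reflection group is the one generated by the reflections `refl v`, `v ∈ R`. -/
structure IsRootSystem {d : ℕ} (R : Finset (EuclideanSpace ℝ (Fin d))) : Prop where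
  inner_self : ∀ v ∈ R, inner ℝ v v = 2
  refl_mem : ∀ u ∈ R, ∀ v ∈ R, refl u v ∈ R

/-- `Rp` is a positive subsystem of `R`: the roots lying strictly on one side of a hyperplane
through the origin that contains no root.  As `R = -R`, this gives `R = Rp ∪ (-Rp)`. -/
def IsPositiveSubsystem {d : ℕ} (R Rp : Finset (EuclideanSpace ℝ (Fin d))) : Prop :=
  ∃ u : EuclideanSpace ℝ (Fin d),
    (∀ v ∈ R, inner ℝ u v ≠ 0) ∧ ∀ v, v ∈ Rp ↔ v ∈ R ∧ 0 < inner ℝ u v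

/-- `κ` is a nonnegative multiplicity function on `R`, i.e. it is invariant under the reflection
group (it suffices to say so for the generating reflections).  Only the values on `R` matter. -/
structure IsMultiplicity {d : ℕ} (R : Finset (EuclideanSpace ℝ (Fin d)))
    (κ : EuclideanSpace ℝ (Fin d) → ℝ) : Prop where
  nonneg : ∀ v ∈ R, 0 ≤ κ v
  invariant : ∀ u ∈ R, ∀ v ∈ R, κ (refl u v) = κ v

section

variable {d : ℕ} (Rp : Finset (EuclideanSpace ℝ (Fin d))) (κ : EuclideanSpace ℝ (Fin d) → ℝ)

/-- The weight `W(x) = (∏_{v ∈ Rp} |⟨x, v⟩|^{2 κ_v}) (1 - ‖x‖²)^{μ - 1/2}`. -/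
noncomputable def weight (μ : ℝ) (x : EuclideanSpace ℝ (Fin d)) : ℝ :=
  (∏ v ∈ Rp, |inner ℝ x v| ^ (2 * κ v)) * (1 - ‖x‖ ^ 2) ^ (μ - 1 / 2)

/-- The measure `W(x) dx` on the closed unit ball. -/
noncomputable def weightMeasure (μ : ℝ) : Measure (EuclideanSpace ℝ (Fin d)) :=
  (volume.restrict (Metric.closedBall 0 1)).withDensity
    (fun x => ENNReal.ofReal (weight Rp κ μ x))

/-- The Dunkl operator
`D_i f (x) = ∂_i f (x) + ∑_{v ∈ Rp} κ_v ⟨v, e_i⟩ (f(x) - f(σ_v x)) / ⟨x, v⟩`.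
The formula is used below only at points off the reflecting hyperplanes. -/
noncomputable def dunkl (i : Fin d) (f : EuclideanSpace ℝ (Fin d) → ℝ)
    (x : EuclideanSpace ℝ (Fin d)) : ℝ :=
  fderiv ℝ f x (EuclideanSpace.single i 1) +
    ∑ v ∈ Rp, κ v * v i * ((f x - f (refl v x)) / inner ℝ x v)

/-- The Dunkl Laplacian `∑_i D_i²`. -/
noncomputable def dunklLaplacian (f : EuclideanSpace ℝ (Fin d) → ℝ)
    (x : EuclideanSpace ℝ (Fin d)) : ℝ :=
  ∑ i, dunkl Rp κ i (dunkl Rp κ i f) x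

/-- The Euler operator `⟨x, ∇⟩`. -/
noncomputable def euler (f : EuclideanSpace ℝ (Fin d) → ℝ)
    (x : EuclideanSpace ℝ (Fin d)) : ℝ :=
  fderiv ℝ f x x

/-- The number `λ = (d - 1) / 2 + |κ| + μ`, where `|κ| = ∑_{v ∈ Rp} κ_v`. -/
noncomputable def lam (μ : ℝ) : ℝ :=
  ((d : ℝ) - 1) / 2 + ∑ v ∈ Rp, κ v + μ

/-- The second order differential-difference operator on the ball,
`Δ^B = Δ_κ - ⟨x, ∇⟩² - 2 λ ⟨x, ∇⟩`.  It is the Dunkl-Laplace-Beltrami operator of the sphere in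
`ℝ^{d+1}` for the weight `|x_{d+1}|^{2 μ} ∏ |⟨x, v⟩|^{2 κ_v}`, acting on functions that do not
depend on the sign of `x_{d+1}`, read in the coordinates `x ↦ (x, √(1 - ‖x‖²))`. -/
noncomputable def ballLaplacian (μ : ℝ) (f : EuclideanSpace ℝ (Fin d) → ℝ)
    (x : EuclideanSpace ℝ (Fin d)) : ℝ :=
  dunklLaplacian Rp κ f x - euler (euler f) x - 2 * lam Rp κ μ * euler f x

/-- The polynomial `p` as a function on `ℝ^d`. -/
noncomputable def polyFun (p : MvPolynomial (Fin d) ℝ) (x : EuclideanSpace ℝ (Fin d)) : ℝ :=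
  MvPolynomial.eval (fun i => x i) p

/-- `p` belongs to the `n`-th eigenspace of the ball operator: `Δ^B p = - n (n + 2 λ) p`.  The
equation is asked for in the open ball off the reflecting hyperplanes, where the quotients in the
Dunkl operators have nonzero denominators. -/
def IsEigenpoly (μ : ℝ) (n : ℕ) (p : MvPolynomial (Fin d) ℝ) : Prop :=
  ∀ x ∈ Metric.ball (0 : EuclideanSpace ℝ (Fin d)) 1, (∀ v ∈ Rp, inner ℝ x v ≠ 0) →
    ballLaplacian Rp κ μ (polyFun p) x = -((n : ℝ) * (n + 2 * lam Rp κ μ)) * polyFun p x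

/-- `g = √(-Δ^B) f`: the function `g` is in `L²(W)`, and for every `n` its component in the `n`-th
eigenspace of `Δ^B`, of eigenvalue `- n (n + 2 λ)`, is `√(n (n + 2 λ))` times that of `f`.  Testing
against real polynomials suffices, as the eigenspaces are closed under complex conjugation. -/
structure IsSqrtNegLaplacian (μ : ℝ) (f g : EuclideanSpace ℝ (Fin d) → ℂ) : Prop where
  memLp : MemLp g 2 (weightMeasure Rp κ μ)
  component : ∀ (n : ℕ) (p : MvPolynomial (Fin d) ℝ), IsEigenpoly Rp κ μ n p →
    ∫ x, g x * (polyFun p x : ℂ) ∂(weightMeasure Rp κ μ) =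
      (Real.sqrt ((n : ℝ) * (n + 2 * lam Rp κ μ)) : ℂ) *
        ∫ x, f x * (polyFun p x : ℂ) ∂(weightMeasure Rp κ μ)

end

end WeightedBall

/-! Write A(y) for the first factor, E for the second one (the energy), and say that |f|² W has
total mass 1. The eigenvalues n(n + 2λ) with n ≥ 1 are at least 1, so a function of mean zero has E
≥ 1, and only the case of small A(y) needs an argument. The minimum of A over the ball is attained
at a unit vector, because A is affine in y; so let ‖y‖ = 1 and A(y) ≤ a², which says that the mass
sits at distance about a from y.

Near y the field y - ⟨x,y⟩x, the gradient of ⟨·,y⟩ for the metric 1 - xxᵀ, points towards y and has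
weighted divergence at most -1/2. Cut it off to a cap of radius ρ and integrate the divergence of q²
times this field against W. Cauchy-Schwarz gives ½∫q² ≤ θ E(q) + (C/ρ² + 2/θ) A_q(y), where A_q is A
with q² in place of |f|² (`exists_local_uncertainty`). With ρ a multiple of a and θ a multiple of
1/E, this becomes a lower bound for a²E.

The obstacle is the weight. A root v contributes κ_v(⟨y,v⟩/⟨x,v⟩ - ⟨x,y⟩) to the divergence, up to
the cutoff. This is harmless if ⟨y,v⟩ = 0, and nearly cancels if |⟨y,v⟩| ≥ Kρ with K large
(`root_comparison`), but has no useful bound if the hyperplane passes near y without containing it.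
`exists_shift` removes that case: y can be moved by O(a) to a unit vector which, for each root, lies
on the hyperplane or far from it at the new scale. The move changes A only by O(a²).

The energy is reached through the identity ∫ (Γ(F,p) + F Δ^B p) W = 0 for polynomials p
(`integral_gammaForm_add_mul_ballLaplacian`), where Γ contains a gradient part and a difference
part. It rests on a closed form for the Dunkl Laplacian, in which the products of two difference
operators cancel over pairs of roots (`sum_pairs_difference_eq_zero`), and on integration by parts
with a regularized weight. It makes Δ^B symmetric on polynomials. As Δ^B is also triangular for the
degree, the polynomials of degree at most n orthogonal to those of lower degree are eigenpolynomials
for n (`isEigenpoly_of_orthogonal`). Polynomials being dense in L²(W), the spectral theory reduces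
to that of a filtration of a Hilbert space: Bessel's inequality for Γ produces √(-Δ^B) f, and E
bounds the energy of every polynomial projection of f. The local inequality is applied to these
projections and passed to the limit. Complex functions are handled through their real and imaginary
parts. -/

namespace WeightedBall

/-! ### Reflections and root systems -/

/-- The Euclidean space `ℝ^d`. -/
abbrev Euc (d : ℕ) := EuclideanSpace ℝ (Fin d)

section Reflections

variable {d : ℕ}

lemma refl_eq {v : Euc d} (hv : inner ℝ v v = (2 : ℝ)) (x : Euc d) :
    refl v x = x - inner ℝ x v • v := by
  have : ‖v‖ ^ 2 = 2 := by rw [← real_inner_self_eq_norm_sq, hv]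
  rw [refl, this]
  congr 2
  ring

lemma refl_neg_root (v x : Euc d) : refl (-v) x = refl v x := by
  simp only [refl, inner_neg_right, norm_neg, smul_neg, ← neg_smul]
  congr 2
  ring

lemma inner_refl_left {u : Euc d} (hu : inner ℝ u u = (2 : ℝ)) (x y : Euc d) :
    inner ℝ (refl u x) y = inner ℝ x (refl u y) := by
  simp only [refl_eq hu, inner_sub_left, inner_sub_right, inner_smul_left, inner_smul_right,
    real_inner_comm u y]
  simp
  ring

lemma refl_refl {u : Euc d} (hu : inner ℝ u u = (2 : ℝ)) (x : Euc d) :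
    refl u (refl u x) = x := by
  rw [refl_eq hu (refl u x), inner_refl_left hu, refl_eq hu u, refl_eq hu x, hu]
  rw [inner_sub_right, inner_smul_right]
  module

lemma refl_self {u : Euc d} (hu : inner ℝ u u = (2 : ℝ)) : refl u u = -u := by
  rw [refl_eq hu, hu]; module

lemma inner_refl_self {u : Euc d} (hu : inner ℝ u u = (2 : ℝ)) (x : Euc d) :
    inner ℝ (refl u x) u = -inner ℝ x u := by
  rw [inner_refl_left hu, refl_self hu, inner_neg_right]

lemma inner_refl_refl {u : Euc d} (hu : inner ℝ u u = (2 : ℝ)) (x y : Euc d) :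
    inner ℝ (refl u x) (refl u y) = inner ℝ x y := by
  rw [inner_refl_left hu, refl_refl hu]

lemma norm_refl {u : Euc d} (hu : inner ℝ u u = (2 : ℝ)) (x : Euc d) : ‖refl u x‖ = ‖x‖ := by
  rw [← sq_eq_sq₀ (norm_nonneg _) (norm_nonneg _), ← real_inner_self_eq_norm_sq,
    ← real_inner_self_eq_norm_sq, inner_refl_refl hu]

/-- The conjugation rule σ_{σ_u v} = σ_u σ_v σ_u, applied to σ_u x. It is the reason why passing
from (u, v) to (σ_u v, u) preserves the product σ_u σ_v. -/
lemma refl_refl_root {u v : Euc d} (hu : inner ℝ u u = (2 : ℝ)) (hv : inner ℝ v v = (2 : ℝ))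
    (x : Euc d) : refl (refl u v) (refl u x) = refl u (refl v x) := by
  have h : inner ℝ (refl u v) (refl u v) = (2 : ℝ) := by rw [inner_refl_refl hu, hv]
  rw [refl_eq h, inner_refl_refl hu, refl_eq hv]
  simp only [refl_eq hu, inner_sub_left, inner_smul_left]
  simp
  module

/-- The reflection `refl u` as a linear isometry. -/
noncomputable def reflIso (u : Euc d) (hu : inner ℝ u u = (2 : ℝ)) : Euc d ≃ₗᵢ[ℝ] Euc d where
  toFun := refl u
  invFun := refl u
  left_inv := refl_refl hu
  right_inv := refl_refl hu
  map_add' x y := by simp only [refl_eq hu, inner_add_left]; module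
  map_smul' c x := by
    simp only [refl_eq hu, inner_smul_left]
    simp
    module
  norm_map' := norm_refl hu

lemma IsRootSystem.neg_mem {R : Finset (Euc d)} (hR : IsRootSystem R) {v : Euc d} (hv : v ∈ R) :
    -v ∈ R := by
  rw [← refl_self (hR.inner_self v hv)]
  exact hR.refl_mem v hv v hv

lemma IsMultiplicity.neg {R : Finset (Euc d)} (hR : IsRootSystem R) {κ : Euc d → ℝ}
    (hκ : IsMultiplicity R κ) {v : Euc d} (hv : v ∈ R) : κ (-v) = κ v := by
  rw [← refl_self (hR.inner_self v hv)]
  exact hκ.invariant v hv v hv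

lemma IsRootSystem.norm_root {R : Finset (Euc d)} (hR : IsRootSystem R) {v : Euc d} (hv : v ∈ R) :
    ‖v‖ = √2 := by
  rw [← hR.inner_self v hv, real_inner_self_eq_norm_sq, Real.sqrt_sq (norm_nonneg _)]

lemma IsRootSystem.sum_refl {R : Finset (Euc d)} (hR : IsRootSystem R) {M : Type*}
    [AddCommMonoid M] {u : Euc d} (hu : u ∈ R) (h : Euc d → M) :
    ∑ v ∈ R, h (refl u v) = ∑ v ∈ R, h v :=
  Finset.sum_nbij' (refl u) (refl u) (fun v hv => hR.refl_mem u hu v hv)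
    (fun v hv => hR.refl_mem u hu v hv) (fun v _ => refl_refl (hR.inner_self u hu) v)
    (fun v _ => refl_refl (hR.inner_self u hu) v) (fun _ _ => rfl)

/-- As R = -R and no root is orthogonal to the vector defining the half space, R is the disjoint
union of `Rp` and `-Rp`. This replaces `Rp`, which the reflections do not preserve, by R, which they
permute. -/
lemma IsPositiveSubsystem.prod_eq {R Rp : Finset (Euc d)} (hR : IsRootSystem R)
    (hRp : IsPositiveSubsystem R Rp) {M : Type*} [CommMonoid M] (h : Euc d → M) :
    ∏ v ∈ R, h v = ∏ v ∈ Rp, (h v * h (-v)) := by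
  classical
  obtain ⟨w, hw, hmem⟩ := hRp
  have h1 : R = Rp ∪ Rp.image Neg.neg := by
    ext v
    simp only [Finset.mem_union, Finset.mem_image, hmem]
    constructor
    · intro hv
      rcases lt_or_gt_of_ne (hw v hv) with h | h
      · exact Or.inr ⟨-v, ⟨hR.neg_mem hv, by rw [inner_neg_right]; linarith⟩, neg_neg v⟩
      · exact Or.inl ⟨hv, h⟩
    · rintro (h | ⟨u, h, rfl⟩)
      · exact h.1
      · exact hR.neg_mem h.1
  have h2 : Disjoint Rp (Rp.image Neg.neg) := by
    rw [Finset.disjoint_left]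
    intro v hv hv'
    obtain ⟨u, hu, rfl⟩ := Finset.mem_image.1 hv'
    have a := ((hmem _).1 hv).2
    have b := ((hmem _).1 hu).2
    rw [inner_neg_right] at a
    linarith
  rw [h1, Finset.prod_union h2, Finset.prod_image (fun a _ b _ h => neg_injective h),
    Finset.prod_mul_distrib]

lemma IsPositiveSubsystem.sum_eq {R Rp : Finset (Euc d)} (hR : IsRootSystem R)
    (hRp : IsPositiveSubsystem R Rp) {M : Type*} [AddCommMonoid M] (h : Euc d → M) :
    ∑ v ∈ R, h v = ∑ v ∈ Rp, (h v + h (-v)) :=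
  hRp.prod_eq hR (M := Multiplicative M) h

lemma IsPositiveSubsystem.subset {R Rp : Finset (Euc d)} (hRp : IsPositiveSubsystem R Rp) :
    Rp ⊆ R := by
  obtain ⟨w, hw, hmem⟩ := hRp
  exact fun v hv => ((hmem v).1 hv).1

/-- A sum of an even function over the positive roots is half its sum over all roots. -/
lemma IsPositiveSubsystem.sum_even {R Rp : Finset (Euc d)} (hR : IsRootSystem R)
    (hRp : IsPositiveSubsystem R Rp) (h : Euc d → ℝ) (he : ∀ v ∈ R, h (-v) = h v) :
    2 * ∑ v ∈ Rp, h v = ∑ v ∈ R, h v := by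
  rw [hRp.sum_eq hR, Finset.mul_sum]
  refine Finset.sum_congr rfl fun v hv => ?_
  rw [he v (hRp.subset hv)]
  ring

/-- Complement of the reflecting hyperplanes. -/
def regularSet (R : Finset (Euc d)) : Set (Euc d) := {x | ∀ v ∈ R, inner ℝ x v ≠ 0}

lemma IsPositiveSubsystem.mem_regularSet {R Rp : Finset (Euc d)} (hR : IsRootSystem R)
    (hRp : IsPositiveSubsystem R Rp) {x : Euc d} :
    x ∈ regularSet R ↔ ∀ v ∈ Rp, inner ℝ x v ≠ 0 := by
  refine ⟨fun h v hv => h v (hRp.subset hv), fun h v hv => ?_⟩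
  obtain ⟨w, hw, hmem⟩ := hRp
  rcases lt_or_gt_of_ne (hw v hv) with h' | h'
  · have := h (-v) ((hmem _).2 ⟨hR.neg_mem hv, by rw [inner_neg_right]; linarith⟩)
    rw [inner_neg_right] at this
    simpa using this
  · exact h v ((hmem _).2 ⟨hv, h'⟩)

lemma isOpen_regularSet (R : Finset (Euc d)) : IsOpen (regularSet R) := by
  have : regularSet R = ⋂ v ∈ R, {x : Euc d | inner ℝ x v ≠ 0} := by
    ext x; simp [regularSet]
  rw [this]
  refine isOpen_biInter_finset fun v _ => ?_
  exact isOpen_ne_fun (by fun_prop) (by fun_prop)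

lemma IsRootSystem.refl_mem_regularSet {R : Finset (Euc d)} (hR : IsRootSystem R) {x u : Euc d}
    (hx : x ∈ regularSet R) (hu : u ∈ R) : refl u x ∈ regularSet R := by
  intro v hv
  rw [inner_refl_left (hR.inner_self u hu)]
  exact hx _ (hR.refl_mem u hu v hv)

end Reflections

/-! ### The cancellation identity for Dunkl operators -/

section Cancellation

variable {d : ℕ} {R : Finset (Euc d)} {κ : Euc d → ℝ}

/-- The sum telescopes along the orbits of τ(u, v) = (σ_u v, u) on pairs of roots. This permutation
preserves σ_u σ_v, κ_u κ_v and the quadratic expression Q = a² + b² - gab, where a = ⟨x,u⟩, b =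
⟨x,v⟩, g = ⟨u,v⟩. With φ(u, v) = ga/b one has φ - φ∘τ = gQ/(ab), so each summand is c(φ - φ∘τ) for a
τ-invariant c that carries a factor 1/Q. -/
lemma sum_pairs_rotation_eq_zero (hR : IsRootSystem R) (hκ : IsMultiplicity R κ)
    (F : Euc d → ℝ) {x : Euc d} (hx : x ∈ regularSet R) :
    ∑ u ∈ R, ∑ v ∈ R, κ u * κ v * inner ℝ u v / (inner ℝ x u * inner ℝ x v) *
      (F x - F (refl u (refl v x))) = 0 := by
  let τ : Euc d × Euc d → Euc d × Euc d := fun p => (refl p.1 p.2, p.1)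
  let τ' : Euc d × Euc d → Euc d × Euc d := fun p => (p.2, refl p.2 p.1)
  let Q : Euc d × Euc d → ℝ := fun p => inner ℝ x p.1 ^ 2 + inner ℝ x p.2 ^ 2 -
    inner ℝ p.1 p.2 * inner ℝ x p.1 * inner ℝ x p.2
  let c : Euc d × Euc d → ℝ := fun p => κ p.1 * κ p.2 * (F x - F (refl p.1 (refl p.2 x))) / Q p
  let φ : Euc d × Euc d → ℝ := fun p => inner ℝ p.1 p.2 * inner ℝ x p.1 / inner ℝ x p.2
  have hτmem : ∀ p ∈ R ×ˢ R, τ p ∈ R ×ˢ R := fun p hp => by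
    rw [Finset.mem_product] at hp ⊢
    exact ⟨hR.refl_mem _ hp.1 _ hp.2, hp.1⟩
  have hcτ : ∀ p ∈ R ×ˢ R, c (τ p) = c p := by
    rintro ⟨u, v⟩ hp
    rw [Finset.mem_product] at hp
    have hu := hR.inner_self u hp.1
    have hv := hR.inner_self v hp.2
    have hQ : Q (refl u v, u) = Q (u, v) := by
      simp only [Q, refl_eq hu, inner_sub_left, inner_sub_right, inner_smul_left,
        inner_smul_right, hu, real_inner_comm u v]
      simp
      ring
    simp only [c, τ]
    rw [hQ, hκ.invariant u hp.1 v hp.2, refl_refl_root hu hv]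
    ring
  have key : ∀ p ∈ R ×ˢ R, κ p.1 * κ p.2 * inner ℝ p.1 p.2 / (inner ℝ x p.1 * inner ℝ x p.2) *
      (F x - F (refl p.1 (refl p.2 x))) = c p * φ p - c (τ p) * φ (τ p) := by
    rintro ⟨u, v⟩ hp
    rw [hcτ _ hp]
    rw [Finset.mem_product] at hp
    have hu := hR.inner_self u hp.1
    have hv := hR.inner_self v hp.2
    have ha : inner ℝ x u ≠ 0 := hx u hp.1
    have hb : inner ℝ x v ≠ 0 := hx v hp.2
    -- Division by Q fails only for parallel roots: Q = (a - gb/2)² + (1 - g²/4)b² with b ≠ 0 and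
    -- |g| ≤ 2, so Q = 0 forces g² = 4. Then σ_u σ_v is the identity and the summand vanishes
    -- anyway.
    by_cases hQ : Q (u, v) = 0
    · have hg : |inner ℝ u v| ≤ 2 := by
        have := abs_real_inner_le_norm u v
        rwa [hR.norm_root hp.1, hR.norm_root hp.2, Real.mul_self_sqrt (by norm_num)] at this
      have hg2 : (inner ℝ u v : ℝ) ^ 2 = 4 := by
        rw [abs_le] at hg
        by_contra hne
        have h4 : (inner ℝ u v : ℝ) ^ 2 < 4 := lt_of_le_of_ne (by nlinarith) hne
        have : 0 < Q (u, v) := by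
          have : Q (u, v) = (inner ℝ x u - inner ℝ u v * inner ℝ x v / 2) ^ 2 +
              (1 - (inner ℝ u v) ^ 2 / 4) * inner ℝ x v ^ 2 := by simp only [Q]; ring
          rw [this]
          have := mul_pos (show (0:ℝ) < 1 - (inner ℝ u v) ^ 2 / 4 by linarith)
            (pow_pos (abs_pos.2 hb) 2)
          rw [sq_abs] at this
          nlinarith [sq_nonneg ((inner ℝ x u : ℝ) - inner ℝ u v * inner ℝ x v / 2)]
        exact this.ne' hQ
      have hs : (2 : ℝ) • u - (inner ℝ u v : ℝ) • v = 0 := by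
        rw [← inner_self_eq_zero (𝕜 := ℝ)]
        simp only [inner_sub_left, inner_sub_right, inner_smul_left, inner_smul_right, hu, hv,
          real_inner_comm u v]
        simp
        nlinarith
      have hrefl : refl u (refl v x) = x := by
        have hu' : u = ((inner ℝ u v : ℝ) / 2) • v := by
          rw [sub_eq_zero] at hs
          rw [div_eq_inv_mul, mul_smul, ← hs, smul_smul]
          norm_num
        have : refl u (refl v x) = refl v (refl v x) := by
          rw [refl_eq hu, refl_eq hv (refl v x)]
          congr 1
          conv_lhs => rw [hu']
          rw [inner_smul_right, smul_smul]
          congr 1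
          linear_combination (inner ℝ (refl v x) v / 4 : ℝ) * hg2
        rw [this, refl_refl hv]
      simp [c, hrefl]
    · simp only [c, φ, τ]
      have e1 : (inner ℝ (refl u v) u : ℝ) = -inner ℝ u v := by
        rw [inner_refl_self hu, real_inner_comm]
      have e2 : (inner ℝ x (refl u v) : ℝ) = inner ℝ x v - inner ℝ u v * inner ℝ x u := by
        rw [refl_eq hu, inner_sub_right, inner_smul_right, real_inner_comm u v]
      rw [e1, e2]
      have hQ' : Q (u, v) = inner ℝ x u ^ 2 + inner ℝ x v ^ 2 -
        inner ℝ u v * inner ℝ x u * inner ℝ x v := rfl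
      field_simp
      rw [hQ']
      ring
  rw [← Finset.sum_product (s := R) (t := R) (f := fun p : Euc d × Euc d =>
    κ p.1 * κ p.2 * inner ℝ p.1 p.2 / (inner ℝ x p.1 * inner ℝ x p.2) *
      (F x - F (refl p.1 (refl p.2 x)))), Finset.sum_congr rfl key, Finset.sum_sub_distrib,
    sub_eq_zero]
  refine (Finset.sum_nbij' τ τ' hτmem ?_ ?_ ?_ (fun _ _ => rfl)).symm
  · intro p hp
    rw [Finset.mem_product] at hp ⊢
    exact ⟨hp.2, hR.refl_mem _ hp.2 _ hp.1⟩
  · intro p hp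
    rw [Finset.mem_product] at hp
    simp only [τ, τ', refl_refl (hR.inner_self _ hp.1)]
  · intro p hp
    rw [Finset.mem_product] at hp
    simp only [τ, τ', refl_refl (hR.inner_self _ hp.2)]

/-- These are the products of two difference parts in ∑ D_i². Substituting v ↦ σ_u v in the second
quotient turns the numerators into (F(x) - F(σ_u σ_v x)) + (F(σ_u x) - F(σ_v x)). The first bracket
is the rotation sum, and the second is antisymmetric under exchanging u and v. -/
lemma sum_pairs_difference_eq_zero (hR : IsRootSystem R) (hκ : IsMultiplicity R κ)
    (F : Euc d → ℝ) {x : Euc d} (hx : x ∈ regularSet R) :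
    ∑ u ∈ R, ∑ v ∈ R, κ u * κ v * inner ℝ u v / inner ℝ x u *
      ((F x - F (refl v x)) / inner ℝ x v -
        (F (refl u x) - F (refl v (refl u x))) / inner ℝ (refl u x) v) = 0 := by
  have h1 : ∀ u ∈ R, ∑ v ∈ R, κ u * κ v * inner ℝ u v / inner ℝ x u *
      ((F (refl u x) - F (refl v (refl u x))) / inner ℝ (refl u x) v) =
      -∑ v ∈ R, κ u * κ v * inner ℝ u v / (inner ℝ x u * inner ℝ x v) *
        (F (refl u x) - F (refl u (refl v x))) := by
    intro u hu
    have hu2 := hR.inner_self u hu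
    rw [← hR.sum_refl hu, ← Finset.sum_neg_distrib]
    refine Finset.sum_congr rfl fun v hv => ?_
    rw [hκ.invariant u hu v hv, refl_refl_root hu2 (hR.inner_self v hv), inner_refl_refl hu2,
      ← inner_refl_left hu2, refl_self hu2, inner_neg_left]
    have ha : inner ℝ x u ≠ 0 := hx u hu
    have hb : inner ℝ x v ≠ 0 := hx v hv
    field_simp
  have h2 : ∑ u ∈ R, ∑ v ∈ R, κ u * κ v * inner ℝ u v / (inner ℝ x u * inner ℝ x v) *
      (F (refl u x) - F (refl v x)) = 0 := by
    have : ∑ u ∈ R, ∑ v ∈ R, κ u * κ v * inner ℝ u v / (inner ℝ x u * inner ℝ x v) *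
      (F (refl u x) - F (refl v x)) = -∑ u ∈ R, ∑ v ∈ R, κ u * κ v * inner ℝ u v /
        (inner ℝ x u * inner ℝ x v) * (F (refl u x) - F (refl v x)) := by
      conv_lhs => rw [Finset.sum_comm]
      simp only [← Finset.sum_neg_distrib]
      refine Finset.sum_congr rfl fun u _ => Finset.sum_congr rfl fun v _ => ?_
      rw [real_inner_comm u v]
      ring
    linarith
  have h3 := sum_pairs_rotation_eq_zero hR hκ F hx
  have h4 := congrArg₂ (· + ·) h3 h2
  simp only [add_zero] at h4
  rw [← h4, ← Finset.sum_add_distrib]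
  refine Finset.sum_congr rfl fun u hu => ?_
  have h5 : ∑ v ∈ R, κ u * κ v * inner ℝ u v / inner ℝ x u *
      ((F x - F (refl v x)) / inner ℝ x v -
        (F (refl u x) - F (refl v (refl u x))) / inner ℝ (refl u x) v) =
      ∑ v ∈ R, κ u * κ v * inner ℝ u v / inner ℝ x u * ((F x - F (refl v x)) / inner ℝ x v) -
      ∑ v ∈ R, κ u * κ v * inner ℝ u v / inner ℝ x u *
        ((F (refl u x) - F (refl v (refl u x))) / inner ℝ (refl u x) v) := by
    rw [← Finset.sum_sub_distrib]
    exact Finset.sum_congr rfl fun v _ => mul_sub _ _ _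
  rw [h5, h1 u hu, sub_neg_eq_add, ← Finset.sum_add_distrib, ← Finset.sum_add_distrib]
  refine Finset.sum_congr rfl fun v hv => ?_
  have ha : inner ℝ x u ≠ 0 := hx u hu
  have hb : inner ℝ x v ≠ 0 := hx v hv
  field_simp
  ring

end Cancellation

end WeightedBall

namespace WeightedBall

/-! ### Polynomial functions -/

section Polynomials

open MvPolynomial

variable {d : ℕ}

@[simp] lemma polyFun_add (p q : MvPolynomial (Fin d) ℝ) (x : Euc d) :
    polyFun (p + q) x = polyFun p x + polyFun q x := by simp [polyFun]

@[simp] lemma polyFun_sub (p q : MvPolynomial (Fin d) ℝ) (x : Euc d) :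
    polyFun (p - q) x = polyFun p x - polyFun q x := by simp [polyFun]

@[simp] lemma polyFun_mul (p q : MvPolynomial (Fin d) ℝ) (x : Euc d) :
    polyFun (p * q) x = polyFun p x * polyFun q x := by simp [polyFun]

@[simp] lemma polyFun_C (a : ℝ) (x : Euc d) : polyFun (C a) x = a := by simp [polyFun]

@[simp] lemma polyFun_X (i : Fin d) (x : Euc d) : polyFun (X i) x = x i := by simp [polyFun]

@[simp] lemma polyFun_one (x : Euc d) : polyFun (1 : MvPolynomial (Fin d) ℝ) x = 1 := by
  simp [polyFun]

@[simp] lemma polyFun_zero (x : Euc d) : polyFun (0 : MvPolynomial (Fin d) ℝ) x = 0 := by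
  simp [polyFun]

@[simp] lemma polyFun_smul (a : ℝ) (p : MvPolynomial (Fin d) ℝ) (x : Euc d) :
    polyFun (a • p) x = a * polyFun p x := by simp [polyFun, smul_eval]

@[simp] lemma polyFun_sum {ι : Type*} (s : Finset ι) (p : ι → MvPolynomial (Fin d) ℝ) (x : Euc d) :
    polyFun (∑ i ∈ s, p i) x = ∑ i ∈ s, polyFun (p i) x := by simp [polyFun]

/-- The directional derivative of a polynomial. -/
noncomputable def dirD (v : Euc d) (p : MvPolynomial (Fin d) ℝ) : MvPolynomial (Fin d) ℝ :=
  ∑ i, C (v i) * pderiv i p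

/-- The Euler operator on polynomials. -/
noncomputable def eulerP (p : MvPolynomial (Fin d) ℝ) : MvPolynomial (Fin d) ℝ :=
  ∑ i, X i * pderiv i p

/-- The Laplace operator on polynomials. -/
noncomputable def lapP (p : MvPolynomial (Fin d) ℝ) : MvPolynomial (Fin d) ℝ :=
  ∑ i, pderiv i (pderiv i p)

/-- The linear form `⟨·, v⟩` as a polynomial. -/
noncomputable def linP (v : Euc d) : MvPolynomial (Fin d) ℝ := ∑ i, C (v i) * X i

lemma inner_eq_sum (x y : Euc d) : inner ℝ x y = ∑ i, x i * y i := by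
  simp [PiLp.inner_apply, mul_comm]

@[simp] lemma polyFun_linP (v x : Euc d) : polyFun (linP v) x = inner ℝ x v := by
  simp [linP, inner_eq_sum, mul_comm]

lemma dirD_add (v : Euc d) (p q : MvPolynomial (Fin d) ℝ) :
    dirD v (p + q) = dirD v p + dirD v q := by
  simp [dirD, mul_add, Finset.sum_add_distrib]

lemma dirD_C_mul (v : Euc d) (a : ℝ) (p : MvPolynomial (Fin d) ℝ) :
    dirD v (C a * p) = C a * dirD v p := by
  simp only [dirD, pderiv_C_mul, Finset.mul_sum]
  exact Finset.sum_congr rfl fun i _ => by ring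

lemma dirD_X_mul (v : Euc d) (i : Fin d) (p : MvPolynomial (Fin d) ℝ) :
    dirD v (X i * p) = C (v i) * p + X i * dirD v p := by
  classical
  simp only [dirD, pderiv_mul, pderiv_X, mul_add, Finset.sum_add_distrib]
  congr 1
  · rw [Finset.sum_eq_single i] <;> simp +contextual [eq_comm]
  · rw [Finset.mul_sum]
    exact Finset.sum_congr rfl fun j _ => by ring

/-- The differential of a polynomial function. -/
lemma hasFDerivAt_polyFun (p : MvPolynomial (Fin d) ℝ) (x : Euc d) :
    HasFDerivAt (polyFun p)
      (∑ i, polyFun (pderiv i p) x • (EuclideanSpace.proj i : Euc d →L[ℝ] ℝ)) x := by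
  classical
  induction p using MvPolynomial.induction_on with
  | C a =>
    have : polyFun (C a : MvPolynomial (Fin d) ℝ) = fun _ => a := by ext; simp
    rw [this]
    simpa using hasFDerivAt_const a x
  | add p q hp hq =>
    have : polyFun (p + q) = fun x => polyFun p x + polyFun q x := by ext; simp
    rw [this]
    refine (hp.add hq).congr_fderiv ?_
    simp [add_smul, Finset.sum_add_distrib]
  | mul_X p i hp =>
    have : polyFun (p * X i) = fun x => polyFun p x * (EuclideanSpace.proj i : Euc d →L[ℝ] ℝ) x := by
      ext; simp
    rw [this]
    refine (hp.mul (EuclideanSpace.proj i : Euc d →L[ℝ] ℝ).hasFDerivAt).congr_fderiv ?_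
    ext w
    simp only [pderiv_mul, pderiv_X, polyFun_add, polyFun_mul, polyFun_X]
    simp [add_mul, Finset.sum_add_distrib, Pi.single_apply, apply_ite polyFun, Finset.mul_sum]
    rw [add_comm]
    congr 1
    · exact Finset.sum_congr rfl fun j _ => by ring
    · rw [Finset.sum_eq_single i] <;> simp +contextual [eq_comm, polyFun]

lemma fderiv_polyFun (p : MvPolynomial (Fin d) ℝ) (x w : Euc d) :
    fderiv ℝ (polyFun p) x w = polyFun (dirD w p) x := by
  rw [(hasFDerivAt_polyFun p x).fderiv]
  simp [dirD, mul_comm]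

lemma contDiff_polyFun (p : MvPolynomial (Fin d) ℝ) {n : WithTop ℕ∞} : ContDiff ℝ n (polyFun p) := by
  induction p using MvPolynomial.induction_on with
  | C a =>
    have : polyFun (C a : MvPolynomial (Fin d) ℝ) = fun _ => a := by ext; simp
    rw [this]; fun_prop
  | add p q hp hq =>
    have : polyFun (p + q) = fun x => polyFun p x + polyFun q x := by ext; simp
    rw [this]; fun_prop
  | mul_X p i hp =>
    have : polyFun (p * X i) = fun x => polyFun p x * (EuclideanSpace.proj i : Euc d →L[ℝ] ℝ) x := by
      ext; simp
    rw [this]; fun_prop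

@[fun_prop] lemma continuous_polyFun (p : MvPolynomial (Fin d) ℝ) : Continuous (polyFun p) :=
  (contDiff_polyFun p (n := 0)).continuous

@[fun_prop] lemma differentiable_polyFun (p : MvPolynomial (Fin d) ℝ) :
    Differentiable ℝ (polyFun p) :=
  fun x => (hasFDerivAt_polyFun p x).differentiableAt

lemma polyFun_dirD_eq_sum (w : Euc d) (p : MvPolynomial (Fin d) ℝ) (x : Euc d) :
    polyFun (dirD w p) x = ∑ i, w i * polyFun (pderiv i p) x := by simp [dirD]

lemma polyFun_eulerP (p : MvPolynomial (Fin d) ℝ) (x : Euc d) :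
    polyFun (eulerP p) x = polyFun (dirD x p) x := by simp [eulerP, dirD]

lemma euler_polyFun (p : MvPolynomial (Fin d) ℝ) : euler (polyFun p) = polyFun (eulerP p) := by
  ext x
  rw [euler, fderiv_polyFun, polyFun_eulerP]

/-! ### Degrees -/

/-- The polynomials of degree less than `n`. -/
noncomputable def degLT (d n : ℕ) : Submodule ℝ (MvPolynomial (Fin d) ℝ) :=
  restrictSupport ℝ {s : Fin d →₀ ℕ | s.degree < n}

lemma monomial_mem_degLT {n : ℕ} {s : Fin d →₀ ℕ} (h : s.degree < n) (a : ℝ) :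
    monomial s a ∈ degLT d n := (monomial_mem_restrictSupport ℝ).2 (Or.inl h)

lemma degLT_mono {m n : ℕ} (h : m ≤ n) : degLT d m ≤ degLT d n :=
  restrictSupport_mono _ fun _ hs => lt_of_lt_of_le hs h

/-- The strict inequality in `degLT` makes the filtration start at zero, so that its n-th layer
belongs to degree exactly n. -/
lemma degLT_zero : degLT d 0 = ⊥ := by
  rw [degLT, restrictSupport_eq_span]
  simp

lemma exists_mem_degLT (p : MvPolynomial (Fin d) ℝ) : ∃ n, p ∈ degLT d n := by
  refine ⟨p.support.sup Finsupp.degree + 1, ?_⟩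
  intro s hs
  exact Nat.lt_succ_of_le (Finset.le_sup (f := Finsupp.degree) hs)

instance finiteDimensional_degLT (d n : ℕ) : FiniteDimensional ℝ (degLT d n) := by
  have : {s : Fin d →₀ ℕ | s.degree < n}.Finite := by
    refine Set.Finite.subset (Set.finite_Iic (Finsupp.equivFunOnFinite.symm fun _ : Fin d => n)) ?_
    intro s hs i
    exact (Finsupp.le_degree i s).trans (le_of_lt hs)
  rw [degLT, restrictSupport_eq_span]
  exact FiniteDimensional.span_of_finite ℝ (this.image _)

lemma degLT_induction {n : ℕ} {P : MvPolynomial (Fin d) ℝ → Prop}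
    (hmon : ∀ s : Fin d →₀ ℕ, s.degree < n → P (monomial s 1)) (hz : P 0)
    (hadd : ∀ p q, P p → P q → P (p + q)) (hsmul : ∀ (a : ℝ) p, P p → P (C a * p))
    {p : MvPolynomial (Fin d) ℝ} (hp : p ∈ degLT d n) : P p := by
  rw [degLT, restrictSupport_eq_span] at hp
  induction hp using Submodule.span_induction with
  | mem x h =>
    obtain ⟨s, hs, rfl⟩ := h
    exact hmon s hs
  | zero => exact hz
  | add x y _ _ hx hy => exact hadd _ _ hx hy
  | smul a x _ hx => rw [← C_mul']; exact hsmul a _ hx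

lemma C_mul_mem {S : Submodule ℝ (MvPolynomial (Fin d) ℝ)} (a : ℝ)
    {p : MvPolynomial (Fin d) ℝ} (hp : p ∈ S) : C a * p ∈ S := by
  rw [C_mul']; exact S.smul_mem a hp

lemma X_mul_mem_degLT {n : ℕ} (i : Fin d) {p : MvPolynomial (Fin d) ℝ} (hp : p ∈ degLT d n) :
    X i * p ∈ degLT d (n + 1) := by
  refine degLT_induction (P := fun p => X i * p ∈ degLT d (n + 1)) ?_ ?_ ?_ ?_ hp
  · intro s hs
    rw [X, monomial_mul]
    apply monomial_mem_degLT
    rw [map_add]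
    simp
    omega
  · simp
  · intro p q hp hq
    rw [mul_add]
    exact Submodule.add_mem _ hp hq
  · intro a p hp
    rw [mul_left_comm]
    exact C_mul_mem a hp

lemma linP_mul_mem_degLT {n : ℕ} (v : Euc d) {p : MvPolynomial (Fin d) ℝ} (hp : p ∈ degLT d n) :
    linP v * p ∈ degLT d (n + 1) := by
  rw [linP, Finset.sum_mul]
  refine Submodule.sum_mem _ fun i _ => ?_
  rw [mul_assoc]
  exact C_mul_mem _ (X_mul_mem_degLT i hp)

lemma pderiv_mem_degLT {n : ℕ} (i : Fin d) {p : MvPolynomial (Fin d) ℝ} (hp : p ∈ degLT d (n + 1)) :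
    pderiv i p ∈ degLT d n := by
  refine degLT_induction (P := fun p => pderiv i p ∈ degLT d n) ?_ ?_ ?_ ?_ hp
  · intro s hs
    rw [pderiv_monomial]
    by_cases h : s i = 0
    · simp [h]
    · apply monomial_mem_degLT
      have h1 : s - Finsupp.single i 1 + Finsupp.single i 1 = s :=
        tsub_add_cancel_of_le (by simpa using Nat.one_le_iff_ne_zero.2 h)
      have := congrArg Finsupp.degree h1
      rw [map_add] at this
      simp at this
      omega
  · simp
  · intro p q hp hq
    rw [map_add]
    exact Submodule.add_mem _ hp hq
  · intro a p hp
    rw [pderiv_C_mul]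
    exact C_mul_mem a hp

lemma dirD_mem_degLT {n : ℕ} (v : Euc d) {p : MvPolynomial (Fin d) ℝ} (hp : p ∈ degLT d (n + 1)) :
    dirD v p ∈ degLT d n :=
  Submodule.sum_mem _ fun i _ => C_mul_mem _ (pderiv_mem_degLT i hp)

lemma lapP_mem_degLT {n : ℕ} {p : MvPolynomial (Fin d) ℝ} (hp : p ∈ degLT d (n + 1)) :
    lapP p ∈ degLT d n :=
  Submodule.sum_mem _ fun i _ =>
    pderiv_mem_degLT i (degLT_mono n.le_succ (pderiv_mem_degLT i hp))

lemma eulerP_add (p q : MvPolynomial (Fin d) ℝ) : eulerP (p + q) = eulerP p + eulerP q := by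
  simp [eulerP, mul_add, Finset.sum_add_distrib]

lemma eulerP_C_mul (a : ℝ) (p : MvPolynomial (Fin d) ℝ) : eulerP (C a * p) = C a * eulerP p := by
  simp only [eulerP, pderiv_C_mul, Finset.mul_sum]
  exact Finset.sum_congr rfl fun i _ => by ring

lemma eulerP_monomial (s : Fin d →₀ ℕ) (a : ℝ) :
    eulerP (monomial s a) = C (s.degree : ℝ) * monomial s a := by
  simp only [eulerP, X_mul_pderiv_monomial]
  rw [← Finset.sum_smul, Finsupp.degree_eq_sum, C_mul', Nat.cast_smul_eq_nsmul]

lemma eulerP_mem_degLT {n : ℕ} {p : MvPolynomial (Fin d) ℝ} (hp : p ∈ degLT d n) :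
    eulerP p ∈ degLT d n := by
  refine degLT_induction (P := fun p => eulerP p ∈ degLT d n) ?_ ?_ ?_ ?_ hp
  · intro s hs
    rw [eulerP_monomial]
    exact C_mul_mem _ (monomial_mem_degLT hs 1)
  · simp [eulerP]
  · intro p q hp hq
    rw [eulerP_add]
    exact Submodule.add_mem _ hp hq
  · intro a p hp
    rw [eulerP_C_mul]
    exact C_mul_mem a hp

/-- On monomials of degree n the Euler operator is multiplication by n, so the top degree part
cancels. -/
lemma eulerP_sub_mem_degLT {n : ℕ} {p : MvPolynomial (Fin d) ℝ} (hp : p ∈ degLT d (n + 1)) :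
    eulerP p - C (n : ℝ) * p ∈ degLT d n := by
  refine degLT_induction (P := fun p => eulerP p - C (n : ℝ) * p ∈ degLT d n) ?_ ?_ ?_ ?_ hp
  · intro s hs
    rw [eulerP_monomial]
    rcases Nat.lt_succ_iff_lt_or_eq.1 hs with h | h
    · exact Submodule.sub_mem _ (C_mul_mem _ (monomial_mem_degLT h 1))
        (C_mul_mem _ (monomial_mem_degLT h 1))
    · simp [h]
  · simp [eulerP]
  · intro p q hp hq
    have := Submodule.add_mem _ hp hq
    rw [eulerP_add]
    convert this using 1
    ring
  · intro a p hp
    have := C_mul_mem a hp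
    rw [eulerP_C_mul]
    convert this using 1
    ring

/-! ### Second order Taylor expansion along a root -/

lemma refl_apply {v : Euc d} (hv : inner ℝ v v = (2 : ℝ)) (x : Euc d) (i : Fin d) :
    refl v x i = x i - inner ℝ x v * v i := by
  rw [refl_eq hv]; simp

/-- The remainder of the first order expansion along v is divisible by ⟨x,v⟩² as a polynomial. The
degree of the quotient `r` is recorded because the triangularity of Δ^B depends on it. -/
lemma exists_taylor_monomial {v : Euc d} (hv : inner ℝ v v = (2 : ℝ)) (k : ℕ) :
    ∀ s : Fin d →₀ ℕ, s.degree = k → ∃ r ∈ degLT d k, ∀ x : Euc d,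
      polyFun (monomial s (1 : ℝ)) (refl v x) = polyFun (monomial s (1 : ℝ)) x -
        inner ℝ x v * polyFun (dirD v (monomial s 1)) x + inner ℝ x v ^ 2 * polyFun r x := by
  induction k with
  | zero =>
    intro s hs
    obtain rfl : s = 0 := (Finsupp.degree_eq_zero_iff s).1 hs
    refine ⟨0, Submodule.zero_mem _, fun x => ?_⟩
    have h1 : (monomial (0 : Fin d →₀ ℕ) (1 : ℝ)) = C 1 := rfl
    rw [h1]
    simp [dirD]
  | succ k ih =>
    intro s hs
    have : ∃ i, s i ≠ 0 := by
      by_contra h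
      push Not at h
      have : s = 0 := Finsupp.ext h
      simp [this] at hs
    obtain ⟨i, hi⟩ := this
    have h1 : Finsupp.single i 1 + (s - Finsupp.single i 1) = s :=
        add_tsub_cancel_of_le (by simpa using Nat.one_le_iff_ne_zero.2 hi)
    set s' := s - Finsupp.single i 1 with hs'
    have h2 : s'.degree = k := by
      have := congrArg Finsupp.degree h1
      rw [map_add] at this
      simp at this
      omega
    obtain ⟨r, hr, hr'⟩ := ih s' h2
    have h3 : monomial s (1 : ℝ) = X i * monomial s' 1 := by
      rw [← h1, X, monomial_mul, one_mul]
    -- With t = ⟨x,v⟩, this is the coefficient of t² in (x_i - t v_i)(p' - t ∂_v p' + t² r), where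
    -- p' is the monomial s'.
    refine ⟨X i * r + C (v i) * dirD v (monomial s' 1) - C (v i) * (linP v * r), ?_, fun x => ?_⟩
    · refine Submodule.sub_mem _ (Submodule.add_mem _ (X_mul_mem_degLT i hr) ?_)
        (C_mul_mem _ (linP_mul_mem_degLT v hr))
      refine C_mul_mem _ (dirD_mem_degLT v (monomial_mem_degLT (by omega) 1))
    · rw [h3, dirD_X_mul]
      simp only [polyFun_add, polyFun_sub, polyFun_mul, polyFun_C, polyFun_X, polyFun_linP, hr',
        refl_apply hv]
      ring

lemma exists_taylor {v : Euc d} (hv : inner ℝ v v = (2 : ℝ)) {n : ℕ}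
    {p : MvPolynomial (Fin d) ℝ} (hp : p ∈ degLT d (n + 1)) : ∃ r ∈ degLT d n, ∀ x : Euc d,
      polyFun p (refl v x) = polyFun p x - inner ℝ x v * polyFun (dirD v p) x +
        inner ℝ x v ^ 2 * polyFun r x := by
  refine degLT_induction (P := fun p => ∃ r ∈ degLT d n, ∀ x : Euc d,
      polyFun p (refl v x) = polyFun p x - inner ℝ x v * polyFun (dirD v p) x +
        inner ℝ x v ^ 2 * polyFun r x) ?_ ?_ ?_ ?_ hp
  · intro s hs
    obtain ⟨r, hr, h⟩ := exists_taylor_monomial hv s.degree s rfl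
    exact ⟨r, degLT_mono (by omega) hr, h⟩
  · exact ⟨0, Submodule.zero_mem _, fun x => by simp [dirD]⟩
  · rintro p q ⟨r, hr, h⟩ ⟨r', hr', h'⟩
    refine ⟨r + r', Submodule.add_mem _ hr hr', fun x => ?_⟩
    simp only [dirD_add, polyFun_add, h, h']
    ring
  · rintro a p ⟨r, hr, h⟩
    refine ⟨C a * r, C_mul_mem a hr, fun x => ?_⟩
    simp only [dirD_C_mul, polyFun_mul, polyFun_C, h]
    ring

end Polynomials

end WeightedBall

namespace WeightedBall

/-! ### The Dunkl Laplacian of a polynomial -/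

section DunklLaplacian

open MvPolynomial

variable {d : ℕ} {R Rp : Finset (Euc d)} {κ : Euc d → ℝ}

/-- The summand is even in v, so half its sum over all roots is its sum over the positive ones. -/
lemma dunkl_eq_sum_roots (hR : IsRootSystem R) (hRp : IsPositiveSubsystem R Rp)
    (hκ : IsMultiplicity R κ) (i : Fin d) (f : Euc d → ℝ) (x : Euc d) :
    dunkl Rp κ i f x = fderiv ℝ f x (EuclideanSpace.single i 1) +
      ∑ v ∈ R, κ v / 2 * v i * ((f x - f (refl v x)) / inner ℝ x v) := by
  rw [dunkl]
  congr 1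
  have := hRp.sum_even hR (fun v => κ v / 2 * v i * ((f x - f (refl v x)) / inner ℝ x v))
    (fun v hv => by
      rw [hκ.neg hR hv, refl_neg_root, inner_neg_right, div_neg]
      simp)
  rw [← this, Finset.mul_sum]
  exact Finset.sum_congr rfl fun v _ => by ring

lemma dirD_single (i : Fin d) (p : MvPolynomial (Fin d) ℝ) :
    dirD (EuclideanSpace.single i 1) p = pderiv i p := by
  classical
  rw [dirD, Finset.sum_eq_single i] <;> simp +contextual

lemma dirD_neg (v : Euc d) (p : MvPolynomial (Fin d) ℝ) : dirD (-v) p = -dirD v p := by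
  simp [dirD]

lemma polyFun_neg (p : MvPolynomial (Fin d) ℝ) (x : Euc d) : polyFun (-p) x = -polyFun p x := by
  simp [polyFun]

/-- Here ∂_v p - ⟨·,v⟩ r is the polynomial quotient q of p - p∘σ_v by ⟨·,v⟩. The formula comes from
differentiating p - p∘σ_v = ⟨·,v⟩ q in the direction v, using σ_v v = -v and ⟨v,v⟩ = 2. -/
lemma polyFun_dirD_taylor {v : Euc d} (hv : inner ℝ v v = (2 : ℝ)) {p r : MvPolynomial (Fin d) ℝ}
    (hr : ∀ x : Euc d, polyFun p (refl v x) = polyFun p x -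
      inner ℝ x v * polyFun (dirD v p) x + inner ℝ x v ^ 2 * polyFun r x) (x : Euc d) :
    2 * polyFun (dirD v p - linP v * r) x +
      inner ℝ x v * polyFun (dirD v (dirD v p - linP v * r)) x =
      polyFun (dirD v p) x + polyFun (dirD v p) (refl v x) := by
  have e : (fun x => polyFun p x - polyFun p (refl v x)) =
      fun x => inner ℝ x v * polyFun (dirD v p - linP v * r) x := by
    ext x
    rw [hr]
    simp only [polyFun_sub, polyFun_mul, polyFun_linP]
    ring
  have h1 : HasFDerivAt (fun x => polyFun p x - polyFun p (refl v x))
      (fderiv ℝ (polyFun p) x - (fderiv ℝ (polyFun p) (refl v x)).comp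
        ((reflIso v hv).toContinuousLinearEquiv : Euc d →L[ℝ] Euc d)) x := by
    refine (differentiable_polyFun p x).hasFDerivAt.sub ?_
    exact (differentiable_polyFun p (refl v x)).hasFDerivAt.comp x
      ((reflIso v hv).toContinuousLinearEquiv.hasFDerivAt)
  have h2 : HasFDerivAt (fun x => inner ℝ x v * polyFun (dirD v p - linP v * r) x)
      ((inner ℝ x v : ℝ) • fderiv ℝ (polyFun (dirD v p - linP v * r)) x +
        polyFun (dirD v p - linP v * r) x • innerSL ℝ v) x := by
    refine HasFDerivAt.mul ?_ (differentiable_polyFun _ x).hasFDerivAt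
    have : (fun x : Euc d => (inner ℝ x v : ℝ)) = innerSL ℝ v := by
      ext y; simp [real_inner_comm]
    rw [this]
    exact (innerSL ℝ v).hasFDerivAt
  rw [e] at h1
  have h3 := congrArg (fun L : Euc d →L[ℝ] ℝ => L v) (h1.unique h2)
  have h4 : (reflIso v hv) v = -v := refl_self hv
  have h5 : ‖v‖ ^ 2 = 2 := by rw [← real_inner_self_eq_norm_sq, hv]
  simp [fderiv_polyFun, h4, -map_sub, dirD_neg, polyFun_neg, h5] at h3
  simp only [polyFun_sub, polyFun_mul, polyFun_linP] at h3 ⊢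
  linarith

/-- The classical form of the Dunkl Laplacian, with the singular terms ∂_v p/⟨x,v⟩ - (p -
p∘σ_v)/⟨x,v⟩² collected into the Taylor remainder `r v`. It shows that the result is a polynomial
and bounds its degree. -/
lemma dunklLaplacian_polyFun (hR : IsRootSystem R) (hRp : IsPositiveSubsystem R Rp)
    (hκ : IsMultiplicity R κ) (p : MvPolynomial (Fin d) ℝ)
    (r : Euc d → MvPolynomial (Fin d) ℝ)
    (hr : ∀ v ∈ R, ∀ x : Euc d, polyFun p (refl v x) = polyFun p x -
      inner ℝ x v * polyFun (dirD v p) x + inner ℝ x v ^ 2 * polyFun (r v) x)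
    {x : Euc d} (hx : x ∈ regularSet R) :
    dunklLaplacian Rp κ (polyFun p) x =
      polyFun (lapP p) x + ∑ v ∈ R, κ v * polyFun (r v) x := by
  let q : Euc d → MvPolynomial (Fin d) ℝ := fun v => dirD v p - linP v * r v
  have hq : ∀ v ∈ R, ∀ y ∈ regularSet R,
      (polyFun p y - polyFun p (refl v y)) / inner ℝ y v = polyFun (q v) y := by
    intro v hv y hy
    have hy' : inner ℝ y v ≠ 0 := hy v hv
    rw [hr v hv y]
    simp only [q, polyFun_sub, polyFun_mul, polyFun_linP]
    field_simp
    ring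
  -- The polynomial that agrees with D_i p off the hyperplanes. The regular set is open and stable
  -- under the reflections, so `g i` may replace D_i p both under the derivative and in the second
  -- difference quotient.
  let g : Fin d → MvPolynomial (Fin d) ℝ := fun i =>
    pderiv i p + ∑ v ∈ R, C (κ v / 2 * v i) * q v
  have hG : ∀ i, ∀ y ∈ regularSet R, dunkl Rp κ i (polyFun p) y = polyFun (g i) y := by
    intro i y hy
    rw [dunkl_eq_sum_roots hR hRp hκ, fderiv_polyFun, dirD_single]
    simp only [g, polyFun_add, polyFun_sum, polyFun_mul, polyFun_C]
    congr 1
    exact Finset.sum_congr rfl fun v hv => by rw [hq v hv y hy]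
  have hG' : ∀ u, ∀ y ∈ regularSet R, ∑ i, u i * polyFun (g i) y =
      polyFun (dirD u p) y + ∑ v ∈ R, κ v / 2 * inner ℝ u v * polyFun (q v) y := by
    intro u y hy
    simp only [g, polyFun_add, polyFun_sum, polyFun_mul, polyFun_C, mul_add,
      Finset.sum_add_distrib, polyFun_dirD_eq_sum, Finset.mul_sum, inner_eq_sum, Finset.sum_mul]
    congr 1
    rw [Finset.sum_comm]
    exact Finset.sum_congr rfl fun v _ => Finset.sum_congr rfl fun i _ => by ring
  have hD : ∀ i, fderiv ℝ (dunkl Rp κ i (polyFun p)) x (EuclideanSpace.single i 1) =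
      polyFun (pderiv i (g i)) x := by
    intro i
    have : dunkl Rp κ i (polyFun p) =ᶠ[nhds x] polyFun (g i) := by
      filter_upwards [(isOpen_regularSet R).mem_nhds hx] with y hy using hG i y hy
    rw [this.fderiv_eq, fderiv_polyFun, dirD_single]
  rw [dunklLaplacian]
  have h1 : ∀ i, dunkl Rp κ i (dunkl Rp κ i (polyFun p)) x = polyFun (pderiv i (g i)) x +
      ∑ u ∈ R, κ u / 2 * u i * ((polyFun (g i) x - polyFun (g i) (refl u x)) / inner ℝ x u) := by
    intro i
    rw [dunkl_eq_sum_roots hR hRp hκ, hD]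
    congr 1
    refine Finset.sum_congr rfl fun u hu => ?_
    rw [hG i x hx, hG i _ (hR.refl_mem_regularSet hx hu)]
  simp only [h1, Finset.sum_add_distrib]
  have h2 : ∑ i, polyFun (pderiv i (g i)) x =
      polyFun (lapP p) x + ∑ v ∈ R, κ v / 2 * polyFun (dirD v (q v)) x := by
    simp only [g, map_add, map_sum, pderiv_C_mul, polyFun_add, polyFun_sum, polyFun_mul,
      polyFun_C, lapP, Finset.sum_add_distrib, polyFun_dirD_eq_sum, Finset.mul_sum]
    congr 1
    rw [Finset.sum_comm]
    exact Finset.sum_congr rfl fun v _ => Finset.sum_congr rfl fun i _ => by ring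
  -- Summing over i contracts u_i with D_i p. Only the derivative part ∂_u p survives, since the
  -- double sum over roots is zero by the cancellation identity.
  have h3 : ∑ i, ∑ u ∈ R, κ u / 2 * u i *
      ((polyFun (g i) x - polyFun (g i) (refl u x)) / inner ℝ x u) =
      ∑ u ∈ R, κ u / 2 * ((polyFun (dirD u p) x - polyFun (dirD u p) (refl u x)) / inner ℝ x u) := by
    have h4 : ∀ u ∈ R, ∑ i, κ u / 2 * u i *
        ((polyFun (g i) x - polyFun (g i) (refl u x)) / inner ℝ x u) =
        κ u / 2 * ((polyFun (dirD u p) x - polyFun (dirD u p) (refl u x)) / inner ℝ x u) +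
        1 / 4 * ∑ v ∈ R, κ u * κ v * inner ℝ u v / inner ℝ x u *
        ((polyFun p x - polyFun p (refl v x)) / inner ℝ x v -
          (polyFun p (refl u x) - polyFun p (refl v (refl u x))) / inner ℝ (refl u x) v) := by
      intro u hu
      have e1 : ∑ i, κ u / 2 * u i *
        ((polyFun (g i) x - polyFun (g i) (refl u x)) / inner ℝ x u) =
          κ u / 2 * ((∑ i, u i * polyFun (g i) x - ∑ i, u i * polyFun (g i) (refl u x)) /
            inner ℝ x u) := by
        rw [← Finset.sum_sub_distrib, Finset.sum_div, Finset.mul_sum]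
        exact Finset.sum_congr rfl fun i _ => by ring
      rw [e1, hG' u x hx, hG' u _ (hR.refl_mem_regularSet hx hu)]
      have e2 : ∑ v ∈ R, κ u * κ v * inner ℝ u v / inner ℝ x u *
        ((polyFun p x - polyFun p (refl v x)) / inner ℝ x v -
          (polyFun p (refl u x) - polyFun p (refl v (refl u x))) / inner ℝ (refl u x) v) =
          2 * κ u / inner ℝ x u * (∑ v ∈ R, κ v / 2 * inner ℝ u v * polyFun (q v) x -
            ∑ v ∈ R, κ v / 2 * inner ℝ u v * polyFun (q v) (refl u x)) := by
        rw [← Finset.sum_sub_distrib, Finset.mul_sum]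
        refine Finset.sum_congr rfl fun v hv => ?_
        rw [hq v hv x hx, hq v hv _ (hR.refl_mem_regularSet hx hu)]
        ring
      rw [e2]
      ring
    rw [Finset.sum_comm, Finset.sum_congr rfl h4, Finset.sum_add_distrib, ← Finset.mul_sum,
      sum_pairs_difference_eq_zero hR hκ (polyFun p) hx]
    ring
  rw [h2, h3, add_assoc, ← Finset.sum_add_distrib]
  congr 1
  refine Finset.sum_congr rfl fun v hv => ?_
  have hx' : inner ℝ x v ≠ 0 := hx v hv
  have h5 := polyFun_dirD_taylor (hR.inner_self v hv) (hr v hv) x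
  have h6 : polyFun (dirD v (q v)) x = (polyFun (dirD v p) x + polyFun (dirD v p) (refl v x) -
      2 * polyFun (q v) x) / inner ℝ x v := by
    rw [eq_div_iff hx']
    linarith
  have h7 : polyFun (q v) x = polyFun (dirD v p) x - inner ℝ x v * polyFun (r v) x := by
    simp [q]
  rw [h6, h7]
  field_simp
  ring

/-- `λ` in terms of all roots. -/
lemma lam_eq_sum_roots (hR : IsRootSystem R) (hRp : IsPositiveSubsystem R Rp)
    (hκ : IsMultiplicity R κ) (μ : ℝ) :
    2 * lam Rp κ μ = d - 1 + ∑ v ∈ R, κ v + 2 * μ := by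
  rw [lam, ← hRp.sum_even hR κ fun v hv => hκ.neg hR hv]
  ring

/-- The ball operator preserves polynomials. -/
lemma exists_ballLaplacian_polyFun (hR : IsRootSystem R) (hRp : IsPositiveSubsystem R Rp)
    (hκ : IsMultiplicity R κ) (μ : ℝ) {n : ℕ} {p : MvPolynomial (Fin d) ℝ}
    (hp : p ∈ degLT d (n + 1)) : ∃ q : MvPolynomial (Fin d) ℝ,
      q + C ((n : ℝ) * (n + 2 * lam Rp κ μ)) * p ∈ degLT d n ∧
      ∀ x ∈ regularSet R, ballLaplacian Rp κ μ (polyFun p) x = polyFun q x := by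
  have h : ∀ v : Euc d, ∃ r ∈ degLT d n, v ∈ R → ∀ x : Euc d,
      polyFun p (refl v x) = polyFun p x - inner ℝ x v * polyFun (dirD v p) x +
        inner ℝ x v ^ 2 * polyFun r x := by
    intro v
    by_cases hv : v ∈ R
    · obtain ⟨r, hr, h⟩ := exists_taylor (hR.inner_self v hv) hp
      exact ⟨r, hr, fun _ => h⟩
    · exact ⟨0, Submodule.zero_mem _, fun h => absurd h hv⟩
  choose r hr hr' using h
  refine ⟨lapP p + ∑ v ∈ R, C (κ v) * r v - eulerP (eulerP p) - C (2 * lam Rp κ μ) * eulerP p,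
    ?_, fun x hx => ?_⟩
  -- With E the Euler operator, E² + 2λE - n(n + 2λ) = E(E - n) + (n + 2λ)(E - n), and E - n lowers
  -- the degree. The Laplacian and the Taylor remainders lower it as well.
  · have h1 := eulerP_sub_mem_degLT hp
    have h2 := eulerP_mem_degLT h1
    have e2 : eulerP (eulerP p - C (n : ℝ) * p) = eulerP (eulerP p) - C (n : ℝ) * eulerP p := by
      rw [sub_eq_add_neg, ← neg_mul, ← C_neg, eulerP_add, eulerP_C_mul, C_neg]
      ring
    rw [e2] at h2
    have h3 := lapP_mem_degLT hp
    have h4 : ∑ v ∈ R, C (κ v) * r v ∈ degLT d n :=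
      Submodule.sum_mem _ fun v _ => C_mul_mem _ (hr v)
    have h5 := Submodule.sub_mem _ (Submodule.sub_mem _ (Submodule.add_mem _ h3 h4) h2)
      (C_mul_mem ((n : ℝ) + 2 * lam Rp κ μ) h1)
    convert h5 using 1
    simp only [C_mul, C_add]
    ring
  · rw [ballLaplacian, dunklLaplacian_polyFun hR hRp hκ p r (fun v hv => hr' v hv) hx,
      euler_polyFun, euler_polyFun]
    simp

end DunklLaplacian

end WeightedBall

namespace WeightedBall

/-! ### The weighted measure -/

section WeightMeasure

open Metric Set Filter

variable {d : ℕ} {R Rp : Finset (Euc d)} {κ : Euc d → ℝ} {μ : ℝ}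

/-- The reflection invariant factor of the weight, as a product over all roots. -/
noncomputable def rootWeight (R : Finset (Euc d)) (κ : Euc d → ℝ) (x : Euc d) : ℝ :=
  ∏ v ∈ R, |inner ℝ x v| ^ κ v

lemma weight_eq (hR : IsRootSystem R) (hRp : IsPositiveSubsystem R Rp)
    (hκ : IsMultiplicity R κ) (μ : ℝ) (x : Euc d) :
    weight Rp κ μ x = rootWeight R κ x * (1 - ‖x‖ ^ 2) ^ (μ - 1 / 2) := by
  rw [weight, rootWeight, hRp.prod_eq hR]
  congr 1
  refine Finset.prod_congr rfl fun v hv => ?_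
  have hv' := hRp.subset hv
  rw [hκ.neg hR hv', inner_neg_right, abs_neg, two_mul,
    Real.rpow_add_of_nonneg (abs_nonneg _) (hκ.nonneg v hv') (hκ.nonneg v hv')]

lemma IsRootSystem.abs_inner_le (hR : IsRootSystem R) {x v : Euc d} (hx : x ∈ ball (0 : Euc d) 1)
    (hv : v ∈ R) : |inner ℝ x v| ≤ 2 := by
  have h1 := abs_real_inner_le_norm x v
  rw [hR.norm_root hv] at h1
  have h2 : ‖x‖ < 1 := by simpa using hx
  have h3 : √2 ≤ 2 := by
    rw [Real.sqrt_le_left (by norm_num)]; norm_num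
  nlinarith [norm_nonneg x, Real.sqrt_nonneg 2]

lemma rootWeight_nonneg (x : Euc d) : 0 ≤ rootWeight R κ x :=
  Finset.prod_nonneg fun _ _ => Real.rpow_nonneg (abs_nonneg _) _

lemma rootWeight_pos {x : Euc d} (hx : x ∈ regularSet R) : 0 < rootWeight R κ x :=
  Finset.prod_pos fun v hv => Real.rpow_pos_of_pos (abs_pos.2 (hx v hv)) _

lemma rootWeight_le (hR : IsRootSystem R) (hκ : IsMultiplicity R κ) {x : Euc d}
    (hx : x ∈ ball (0 : Euc d) 1) : rootWeight R κ x ≤ ∏ v ∈ R, (2 : ℝ) ^ κ v :=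
  Finset.prod_le_prod (fun _ _ => Real.rpow_nonneg (abs_nonneg _) _) fun v hv =>
    Real.rpow_le_rpow (abs_nonneg _) (hR.abs_inner_le hx hv) (hκ.nonneg v hv)

lemma one_sub_sq_pos {x : Euc d} (hx : x ∈ ball (0 : Euc d) 1) : 0 < 1 - ‖x‖ ^ 2 := by
  have h : ‖x‖ < 1 := by simpa using hx
  nlinarith [norm_nonneg x]

lemma integrableOn_one_sub_rpow : IntegrableOn (fun y : ℝ => (1 - y) ^ (-(1 / 2) : ℝ)) (Ioo 0 1) := by
  have h : IntervalIntegrable (fun y : ℝ => y ^ (-(1 / 2) : ℝ)) volume 0 1 :=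
    intervalIntegral.intervalIntegrable_rpow' (by norm_num)
  have h2 := h.comp_sub_left 1
  simp only [sub_zero, sub_self] at h2
  exact ((intervalIntegrable_iff_integrableOn_Ioo_of_le zero_le_one).1 h2.symm)

/-- In polar coordinates only the endpoint y = 1 matters, and there μ ≥ 0 bounds the integrand by (1
- y)^(-1/2). -/
lemma integrableOn_one_sub_norm_sq_rpow (hd : 1 ≤ d) (hμ : 0 ≤ μ) :
    IntegrableOn (fun x : Euc d => (1 - ‖x‖ ^ 2) ^ (μ - 1 / 2)) (ball 0 1) := by
  have : Nontrivial (Euc d) := by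
    have : Nonempty (Fin d) := ⟨⟨0, hd⟩⟩
    exact inferInstance
  rw [integrableOn_fun_norm_addHaar (μ := (volume : Measure (Euc d))) (f := fun y : ℝ => (1 - y ^ 2) ^ (μ - 1 / 2))]
  refine Integrable.mono' integrableOn_one_sub_rpow (by fun_prop) ?_
  refine (ae_restrict_iff' measurableSet_Ioo).2 (ae_of_all _ fun y hy => ?_)
  have h1 : 0 < 1 - y := by linarith [hy.2]
  have h2 : 1 - y ≤ 1 - y ^ 2 := by nlinarith [hy.1, hy.2]
  have h3 : 1 - y ^ 2 ≤ 1 := by nlinarith [hy.1, hy.2]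
  rw [norm_smul, Real.norm_of_nonneg (pow_nonneg hy.1.le _),
    Real.norm_of_nonneg (Real.rpow_nonneg (by linarith) _)]
  have h4 : y ^ (Module.finrank ℝ (Euc d) - 1) ≤ 1 := pow_le_one₀ hy.1.le hy.2.le
  have h5 : (1 - y ^ 2) ^ (μ - 1 / 2) ≤ (1 - y ^ 2) ^ (-(1 / 2) : ℝ) :=
    Real.rpow_le_rpow_of_exponent_ge (by linarith) h3 (by linarith)
  have h6 : (1 - y ^ 2) ^ (-(1 / 2) : ℝ) ≤ (1 - y) ^ (-(1 / 2) : ℝ) :=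
    Real.rpow_le_rpow_of_nonpos h1 h2 (by norm_num)
  calc _ ≤ 1 * (1 - y) ^ (-(1 / 2) : ℝ) :=
        mul_le_mul h4 (h5.trans h6) (Real.rpow_nonneg (by linarith) _) zero_le_one
    _ = _ := one_mul _

lemma measurable_weight : Measurable (weight Rp κ μ) := by
  unfold weight
  fun_prop

lemma weightMeasure_eq : weightMeasure Rp κ μ =
    (volume.restrict (ball (0 : Euc d) 1)).withDensity
      (fun x => ENNReal.ofReal (weight Rp κ μ x)) := by
  rw [weightMeasure]
  congr 1
  refine Measure.restrict_congr_set ?_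
  have h : volume (sphere (0 : Euc d) 1) = 0 := Measure.addHaar_sphere_of_ne_zero _ _ one_ne_zero
  rw [← ball_union_sphere]
  exact union_ae_eq_left_of_ae_eq_empty (ae_eq_empty.2 h)

lemma weightMeasure_absolutelyContinuous :
    weightMeasure Rp κ μ ≪ volume.restrict (ball (0 : Euc d) 1) := by
  rw [weightMeasure_eq]
  exact withDensity_absolutelyContinuous _ _

lemma ae_mem_regularSet (hR : IsRootSystem R) : ∀ᵐ x : Euc d, x ∈ regularSet R := by
  have h : ∀ v ∈ R, ∀ᵐ x : Euc d, inner ℝ x v ≠ 0 := by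
    intro v hv
    let K : Submodule ℝ (Euc d) := LinearMap.ker (innerSL ℝ v : Euc d →ₗ[ℝ] ℝ)
    have hK : K ≠ ⊤ := by
      intro h
      have h1 : v ∈ K := by rw [h]; trivial
      have h2 : inner ℝ v v = (0 : ℝ) := by simpa [K] using h1
      rw [hR.inner_self v hv] at h2
      norm_num at h2
    have h0 := Measure.addHaar_submodule (volume : Measure (Euc d)) K hK
    filter_upwards [measure_eq_zero_iff_ae_notMem.1 h0] with x hx hx'
    apply hx
    simpa [K, real_inner_comm] using hx'
  exact (ae_ball_iff (p := fun x v _ => inner ℝ x v ≠ 0) R.countable_toSet).2 h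

lemma ae_ball_regular (hR : IsRootSystem R) :
    ∀ᵐ x : Euc d ∂volume.restrict (ball 0 1), x ∈ ball (0 : Euc d) 1 ∧ x ∈ regularSet R := by
  filter_upwards [ae_restrict_mem measurableSet_ball, ae_restrict_of_ae (ae_mem_regularSet hR)]
    with x h1 h2 using ⟨h1, h2⟩

lemma ae_weightMeasure (hR : IsRootSystem R) :
    ∀ᵐ x ∂weightMeasure Rp κ μ, x ∈ ball (0 : Euc d) 1 ∧ x ∈ regularSet R :=
  weightMeasure_absolutelyContinuous.ae_le (ae_ball_regular hR)

lemma weight_nonneg (hR : IsRootSystem R) (hRp : IsPositiveSubsystem R Rp)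
    (hκ : IsMultiplicity R κ) {x : Euc d} (hx : x ∈ ball (0 : Euc d) 1) :
    0 ≤ weight Rp κ μ x := by
  rw [weight_eq hR hRp hκ]
  exact mul_nonneg (rootWeight_nonneg x) (Real.rpow_nonneg (one_sub_sq_pos hx).le _)

lemma integrableOn_weight (hd : 1 ≤ d) (hμ : 0 ≤ μ) (hR : IsRootSystem R)
    (hRp : IsPositiveSubsystem R Rp) (hκ : IsMultiplicity R κ) :
    IntegrableOn (weight Rp κ μ) (ball (0 : Euc d) 1) := by
  refine Integrable.mono' ((integrableOn_one_sub_norm_sq_rpow hd hμ).const_mul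
    (∏ v ∈ R, (2 : ℝ) ^ κ v)) measurable_weight.aestronglyMeasurable ?_
  filter_upwards [ae_restrict_mem measurableSet_ball] with x hx
  rw [Real.norm_of_nonneg (weight_nonneg hR hRp hκ hx), weight_eq hR hRp hκ]
  exact mul_le_mul_of_nonneg_right (rootWeight_le hR hκ hx)
    (Real.rpow_nonneg (one_sub_sq_pos hx).le _)

lemma isFiniteMeasure_weightMeasure (hd : 1 ≤ d) (hμ : 0 ≤ μ) (hR : IsRootSystem R)
    (hRp : IsPositiveSubsystem R Rp) (hκ : IsMultiplicity R κ) :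
    IsFiniteMeasure (weightMeasure Rp κ μ) := by
  rw [weightMeasure_eq]
  exact isFiniteMeasure_withDensity_ofReal (integrableOn_weight hd hμ hR hRp hκ).2

lemma integral_weightMeasure (hR : IsRootSystem R) (hRp : IsPositiveSubsystem R Rp)
    (hκ : IsMultiplicity R κ) (h : Euc d → ℝ) :
    ∫ x, h x ∂weightMeasure Rp κ μ =
      ∫ x in ball 0 1, rootWeight R κ x * (1 - ‖x‖ ^ 2) ^ (μ - 1 / 2) * h x := by
  rw [weightMeasure_eq, integral_withDensity_eq_integral_toReal_smul
    (f := fun x => ENNReal.ofReal (weight Rp κ μ x))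
    (ENNReal.measurable_ofReal.comp measurable_weight) (ae_of_all _ fun _ => ENNReal.ofReal_lt_top)]
  refine setIntegral_congr_fun measurableSet_ball fun x hx => ?_
  simp only [smul_eq_mul]
  rw [ENNReal.toReal_ofReal (weight_nonneg hR hRp hκ hx), weight_eq hR hRp hκ]

lemma integrable_of_bound [IsFiniteMeasure (weightMeasure Rp κ μ)] {E : Type*}
    [NormedAddCommGroup E] {h : Euc d → E} {C : ℝ}
    (hm : AEStronglyMeasurable h (volume.restrict (ball 0 1)))
    (hb : ∀ x ∈ ball (0 : Euc d) 1, ‖h x‖ ≤ C) : Integrable h (weightMeasure Rp κ μ) := by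
  refine Integrable.of_bound (hm.mono_ac weightMeasure_absolutelyContinuous) C ?_
  exact weightMeasure_absolutelyContinuous.ae_le
    ((ae_restrict_mem measurableSet_ball).mono fun x hx => hb x hx)

end WeightMeasure

end WeightedBall

namespace WeightedBall

/-! ### Regularized weights -/

section Regularization

open Metric Set Filter Topology

variable {d : ℕ} {R Rp : Finset (Euc d)} {κ : Euc d → ℝ} {μ : ℝ}

/-- A smooth positive approximation of `rootWeight`. -/
noncomputable def regWeight (R : Finset (Euc d)) (κ : Euc d → ℝ) (ε : ℝ) (x : Euc d) : ℝ :=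
  Real.exp (∑ v ∈ R, κ v / 2 * Real.log (inner ℝ x v ^ 2 + ε))

lemma regWeight_eq_prod {ε : ℝ} (hε : 0 < ε) (x : Euc d) :
    regWeight R κ ε x = ∏ v ∈ R, (inner ℝ x v ^ 2 + ε) ^ (κ v / 2) := by
  rw [regWeight, Real.exp_sum]
  refine Finset.prod_congr rfl fun v _ => ?_
  rw [Real.rpow_def_of_pos (by positivity), mul_comm]

lemma regWeight_pos (ε : ℝ) (x : Euc d) : 0 < regWeight R κ ε x := Real.exp_pos _

lemma regWeight_le (hR : IsRootSystem R) (hκ : IsMultiplicity R κ) {ε : ℝ} (hε : 0 < ε)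
    (hε' : ε ≤ 1) {x : Euc d} (hx : x ∈ ball (0 : Euc d) 1) :
    regWeight R κ ε x ≤ ∏ v ∈ R, (5 : ℝ) ^ (κ v / 2) := by
  rw [regWeight_eq_prod hε]
  refine Finset.prod_le_prod (fun _ _ => Real.rpow_nonneg (by positivity) _) fun v hv => ?_
  refine Real.rpow_le_rpow (by positivity) ?_ (by linarith [hκ.nonneg v hv])
  have := hR.abs_inner_le hx hv
  rw [abs_le] at this
  nlinarith

lemma regWeight_refl (hR : IsRootSystem R) (hκ : IsMultiplicity R κ) (ε : ℝ) {u : Euc d}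
    (hu : u ∈ R) (x : Euc d) : regWeight R κ ε (refl u x) = regWeight R κ ε x := by
  rw [regWeight, regWeight]
  congr 1
  rw [← hR.sum_refl hu]
  refine Finset.sum_congr rfl fun v hv => ?_
  rw [hκ.invariant u hu v hv, inner_refl_refl (hR.inner_self u hu)]

lemma hasFDerivAt_regWeight {ε : ℝ} (hε : 0 < ε) (x : Euc d) :
    HasFDerivAt (regWeight R κ ε)
      (regWeight R κ ε x • ∑ v ∈ R, (κ v * inner ℝ x v / (inner ℝ x v ^ 2 + ε)) • innerSL ℝ v) x := by
  refine HasFDerivAt.exp ?_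
  refine HasFDerivAt.fun_sum fun v _ => ?_
  have h1 : HasFDerivAt (fun x : Euc d => (inner ℝ x v : ℝ)) (innerSL ℝ v) x := by
    have : (fun x : Euc d => (inner ℝ x v : ℝ)) = innerSL ℝ v := by
      ext y; simp [real_inner_comm]
    rw [this]
    exact (innerSL ℝ v).hasFDerivAt
  have h2 := (((h1.pow 2).add_const ε).log (by positivity)).const_mul (κ v / 2)
  refine h2.congr_fderiv ?_
  ext w
  simp
  field_simp

lemma contDiff_regWeight {ε : ℝ} (hε : 0 < ε) : ContDiff ℝ 1 (regWeight R κ ε) := by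
  refine ContDiff.exp (ContDiff.sum fun v _ => contDiff_const.mul (ContDiff.log ?_ ?_))
  · exact ((contDiff_id.inner ℝ contDiff_const).pow 2).add contDiff_const
  · intro x
    positivity

lemma tendsto_regWeight {ε : ℕ → ℝ} (hε : ∀ n, 0 < ε n) (hε0 : Tendsto ε atTop (𝓝 0)) {x : Euc d}
    (hx : x ∈ regularSet R) :
    Tendsto (fun n => regWeight R κ (ε n) x) atTop (𝓝 (rootWeight R κ x)) := by
  simp only [regWeight_eq_prod (hε _), rootWeight]
  refine tendsto_finsetProd _ fun v hv => ?_
  have h1 : |(inner ℝ x v : ℝ)| ^ κ v = (inner ℝ x v ^ 2 + 0) ^ (κ v / 2) := by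
    rw [add_zero, ← sq_abs, ← Real.rpow_natCast, ← Real.rpow_mul (abs_nonneg _)]
    congr 1
    push_cast
    ring
  rw [h1]
  refine (tendsto_const_nhds.add hε0).rpow_const (Or.inl ?_)
  have := hx v hv
  positivity

/-- A smooth cutoff, vanishing below `1` and equal to `1` above `2`. -/
noncomputable def cutoff (τ : ℝ) : ℝ := Real.smoothTransition (τ - 1)

lemma contDiff_cutoff : ContDiff ℝ 1 cutoff :=
  Real.smoothTransition.contDiff.comp (by fun_prop)

lemma cutoff_nonneg (τ : ℝ) : 0 ≤ cutoff τ := Real.smoothTransition.nonneg _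

lemma cutoff_le_one (τ : ℝ) : cutoff τ ≤ 1 := Real.smoothTransition.le_one _

lemma cutoff_eq_zero {τ : ℝ} (h : τ ≤ 1) : cutoff τ = 0 :=
  Real.smoothTransition.zero_of_nonpos (by linarith)

lemma cutoff_eq_one {τ : ℝ} (h : 2 ≤ τ) : cutoff τ = 1 :=
  Real.smoothTransition.one_of_one_le (by linarith)

lemma deriv_cutoff_eq_zero_of_gt {τ : ℝ} (h : 2 < τ) : deriv cutoff τ = 0 := by
  have : cutoff =ᶠ[𝓝 τ] fun _ => 1 := by
    filter_upwards [Ioi_mem_nhds h] with y hy using cutoff_eq_one (le_of_lt hy)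
  rw [this.deriv_eq]
  simp

lemma deriv_cutoff_eq_zero_of_lt {τ : ℝ} (h : τ < 1) : deriv cutoff τ = 0 := by
  have : cutoff =ᶠ[𝓝 τ] fun _ => 0 := by
    filter_upwards [Iio_mem_nhds h] with y hy using cutoff_eq_zero (le_of_lt hy)
  rw [this.deriv_eq]
  simp

lemma exists_deriv_cutoff_bound : ∃ C : ℝ, 0 ≤ C ∧ ∀ τ, |deriv cutoff τ| ≤ C := by
  obtain ⟨C, hC⟩ := (isCompact_Icc (a := (1 : ℝ)) (b := 2)).exists_bound_of_continuousOn
    (contDiff_cutoff.continuous_deriv le_rfl).continuousOn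
  refine ⟨max C 0, le_max_right _ _, fun τ => ?_⟩
  rcases lt_or_ge τ 1 with h | h
  · rw [deriv_cutoff_eq_zero_of_lt h]; simp
  · rcases lt_or_ge 2 τ with h' | h'
    · rw [deriv_cutoff_eq_zero_of_gt h']; simp
    · exact (hC τ ⟨h, h'⟩).trans (le_max_left _ _)

/-- Differentiating the boundary cutoff along a field tangent to the sphere produces exactly τ ·
cutoff'(τ) with τ = (1 - ‖x‖²)/ε. The bound is uniform in ε, hence fit for dominated convergence. -/
lemma exists_mul_deriv_cutoff_bound : ∃ C : ℝ, 0 ≤ C ∧ ∀ τ, 0 ≤ τ → |τ * deriv cutoff τ| ≤ C := by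
  obtain ⟨C, hC0, hC⟩ := exists_deriv_cutoff_bound
  refine ⟨2 * C, by positivity, fun τ hτ => ?_⟩
  rcases lt_or_ge 2 τ with h' | h'
  · rw [deriv_cutoff_eq_zero_of_gt h']
    simpa using hC0
  · rw [abs_mul, abs_of_nonneg hτ]
    exact mul_le_mul h' (hC τ) (abs_nonneg _) (by norm_num)

/-- The power `s ^ a` cut off near `s = 0`. -/
noncomputable def cutPow (a ε s : ℝ) : ℝ := cutoff (s / ε) * s ^ a

lemma cutPow_eq_zero {a ε s : ℝ} (hε : 0 < ε) (h : s ≤ ε) : cutPow a ε s = 0 := by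
  rw [cutPow, cutoff_eq_zero ((div_le_one hε).2 h), zero_mul]

lemma contDiff_cutPow (a : ℝ) {ε : ℝ} (hε : 0 < ε) : ContDiff ℝ 1 (cutPow a ε) := by
  rw [contDiff_iff_contDiffAt]
  intro s
  rcases lt_or_ge s ε with h | h
  · have : cutPow a ε =ᶠ[𝓝 s] fun _ => 0 := by
      filter_upwards [Iio_mem_nhds h] with y hy using cutPow_eq_zero hε (le_of_lt hy)
    exact contDiffAt_const.congr_of_eventuallyEq this
  · refine ContDiffAt.mul ?_ (contDiffAt_id.rpow_const_of_ne (by simp; linarith))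
    exact contDiff_cutoff.contDiffAt.comp s (by fun_prop)

lemma hasDerivAt_cutPow (a : ℝ) {ε s : ℝ} (hs : 0 < s) :
    HasDerivAt (cutPow a ε) (deriv cutoff (s / ε) * (1 / ε) * s ^ a +
      cutoff (s / ε) * (a * s ^ (a - 1))) s := by
  have h1 : HasDerivAt (fun s : ℝ => cutoff (s / ε)) (deriv cutoff (s / ε) * (1 / ε)) s :=
    HasDerivAt.comp (h₂ := cutoff) s
      ((contDiff_cutoff.differentiable (by norm_num)) _).hasDerivAt
      ((hasDerivAt_id s).div_const ε)
  exact h1.mul (Real.hasDerivAt_rpow_const (Or.inl hs.ne'))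

/-- Regularized weight, supported in the interior of the ball. -/
noncomputable def cutWeight (R : Finset (Euc d)) (κ : Euc d → ℝ) (a ε : ℝ) (x : Euc d) : ℝ :=
  regWeight R κ ε x * cutPow a ε (1 - ‖x‖ ^ 2)

lemma contDiff_cutWeight (a : ℝ) {ε : ℝ} (hε : 0 < ε) : ContDiff ℝ 1 (cutWeight R κ a ε) :=
  (contDiff_regWeight hε).mul ((contDiff_cutPow a hε).comp
    (contDiff_const.sub (contDiff_norm_sq ℝ)))

lemma tsupport_cutWeight_mul_subset (a : ℝ) {ε : ℝ} (hε : 0 < ε) (f : Euc d → ℝ) :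
    tsupport (fun x => cutWeight R κ a ε x * f x) ⊆ ball 0 1 := by
  have h : tsupport (fun x => cutWeight R κ a ε x * f x) ⊆ {x : Euc d | ε ≤ 1 - ‖x‖ ^ 2} := by
    refine closure_minimal (fun x hx => ?_) (isClosed_le continuous_const (by fun_prop))
    by_contra h
    apply hx
    simp only [mem_ofPred_eq, not_le] at h
    simp [cutWeight, cutPow_eq_zero hε h.le]
  intro x hx
  have : ε ≤ 1 - ‖x‖ ^ 2 := h hx
  rw [mem_ball_zero_iff]
  nlinarith [norm_nonneg x]

lemma fderiv_cutWeight (a : ℝ) {ε : ℝ} (hε : 0 < ε) {x : Euc d} (hx : x ∈ ball (0 : Euc d) 1)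
    (w : Euc d) :
    fderiv ℝ (cutWeight R κ a ε) x w = regWeight R κ ε x *
      (cutPow a ε (1 - ‖x‖ ^ 2) *
        (∑ v ∈ R, κ v * inner ℝ x v * inner ℝ v w / (inner ℝ x v ^ 2 + ε)) -
      2 * inner ℝ x w * (deriv cutoff ((1 - ‖x‖ ^ 2) / ε) * (1 / ε) * (1 - ‖x‖ ^ 2) ^ a +
      cutoff ((1 - ‖x‖ ^ 2) / ε) * (a * (1 - ‖x‖ ^ 2) ^ (a - 1)))) := by
  have h1 : HasFDerivAt (fun x : Euc d => 1 - ‖x‖ ^ 2) (-(2 • innerSL ℝ x)) x := by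
    simpa using (hasStrictFDerivAt_norm_sq x).hasFDerivAt.const_sub 1
  have h2 := (hasDerivAt_cutPow a (ε := ε) (one_sub_sq_pos hx)).comp_hasFDerivAt x h1
  have h3 : HasFDerivAt (cutWeight R κ a ε) _ x := (hasFDerivAt_regWeight hε x).mul h2
  rw [h3.fderiv]
  have h4 : ∑ v ∈ R, κ v * inner ℝ x v * inner ℝ v w / (inner ℝ x v ^ 2 + ε) =
      ∑ v ∈ R, κ v * inner ℝ x v / (inner ℝ x v ^ 2 + ε) * inner ℝ v w :=
    Finset.sum_congr rfl fun v _ => by ring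
  rw [h4]
  simp
  ring

end Regularization

/-! ### Integration by parts -/

section IntegrationByParts

open Metric Set Filter Topology

variable {d : ℕ} {R Rp : Finset (Euc d)} {κ : Euc d → ℝ} {μ : ℝ}

/-- Functions on the closed unit ball that are Lipschitz, and differentiable in the open ball. -/
structure IsTame (f : Euc d → ℝ) : Prop where
  lipschitz : ∃ L, LipschitzOnWith L f (closedBall 0 1)
  diff : DifferentiableOn ℝ f (ball 0 1)

lemma IsTame.exists_bound {f : Euc d → ℝ} (hf : IsTame f) : ∃ L : ℝ, 0 ≤ L ∧
    (∀ x ∈ ball (0 : Euc d) 1, |f x| ≤ L) ∧ (∀ x ∈ ball (0 : Euc d) 1, ‖fderiv ℝ f x‖ ≤ L) ∧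
    (∀ x ∈ ball (0 : Euc d) 1, ∀ y ∈ ball (0 : Euc d) 1, |f x - f y| ≤ L * ‖x - y‖) := by
  obtain ⟨L, hL⟩ := hf.lipschitz
  obtain ⟨C, hC⟩ := (isCompact_closedBall (0 : Euc d) 1).exists_bound_of_continuousOn hL.continuousOn
  refine ⟨max L C, le_max_of_le_left L.2, fun x hx => ?_, fun x hx => ?_, fun x hx y hy => ?_⟩
  · exact (hC x (ball_subset_closedBall hx)).trans (le_max_right _ _)
  · refine (norm_fderiv_le_of_lipschitzOn ℝ ?_ hL).trans (le_max_left _ _)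
    exact mem_of_superset (isOpen_ball.mem_nhds hx) ball_subset_closedBall
  · have := hL.dist_le_mul x (ball_subset_closedBall hx) y (ball_subset_closedBall hy)
    rw [Real.dist_eq, dist_eq_norm] at this
    exact this.trans (mul_le_mul_of_nonneg_right (le_max_left _ _) (norm_nonneg _))

lemma IsTame.continuousOn {f : Euc d → ℝ} (hf : IsTame f) : ContinuousOn f (closedBall 0 1) := by
  obtain ⟨L, hL⟩ := hf.lipschitz
  exact hL.continuousOn

lemma IsTame.aestronglyMeasurable {f : Euc d → ℝ} (hf : IsTame f) :
    AEStronglyMeasurable f (volume.restrict (ball 0 1)) :=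
  (hf.continuousOn.mono ball_subset_closedBall).aestronglyMeasurable measurableSet_ball

lemma IsTame.differentiableAt {f : Euc d → ℝ} (hf : IsTame f) {x : Euc d}
    (hx : x ∈ ball (0 : Euc d) 1) : DifferentiableAt ℝ f x :=
  hf.diff.differentiableAt (isOpen_ball.mem_nhds hx)

lemma isTame_of_contDiffOn {f : Euc d → ℝ} (hf : ContDiffOn ℝ 1 f (closedBall 0 1)) : IsTame f := by
  refine ⟨?_, (hf.differentiableOn (by norm_num)).mono ball_subset_closedBall⟩
  exact hf.locallyLipschitzOn (convex_closedBall 0 1) |>.exists_lipschitzOnWith_of_compact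
    (isCompact_closedBall 0 1)

lemma isTame_polyFun (p : MvPolynomial (Fin d) ℝ) : IsTame (polyFun p) :=
  isTame_of_contDiffOn (contDiff_polyFun p).contDiffOn

/-- The support of `g` is compact in the open ball, so there is no boundary term and `F` is
differentiated only where it is known to be differentiable. -/
lemma integral_ball_mul_fderiv {F g : Euc d → ℝ} (hF : IsTame F) (hg : ContDiff ℝ 1 g)
    (hsupp : tsupport g ⊆ ball 0 1) (w : Euc d) :
    IntegrableOn (fun x => F x * fderiv ℝ g x w + fderiv ℝ F x w * g x) (ball 0 1) ∧
    ∫ x in ball 0 1, (F x * fderiv ℝ g x w + fderiv ℝ F x w * g x) = 0 := by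
  obtain ⟨L, hL0, hL1, hL2, -⟩ := hF.exists_bound
  have hg' : Continuous (fun x => fderiv ℝ g x w) :=
    (hg.continuous_fderiv one_ne_zero).clm_apply continuous_const
  have hcomp : HasCompactSupport g :=
    HasCompactSupport.of_support_subset_isCompact (isCompact_closedBall 0 1)
      ((subset_tsupport g).trans (hsupp.trans ball_subset_closedBall))
  have hg0 : ∀ x ∉ ball (0 : Euc d) 1, g x = 0 := fun x hx =>
    image_eq_zero_of_notMem_tsupport fun h => hx (hsupp h)
  have hg0' : ∀ x ∉ ball (0 : Euc d) 1, fderiv ℝ g x w = 0 := fun x hx => by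
    rw [fderiv_of_notMem_tsupport ℝ fun h => hx (hsupp h)]; rfl
  obtain ⟨G, hG⟩ := (isCompact_closedBall (0 : Euc d) 1).exists_bound_of_continuousOn
    hg.continuous.continuousOn
  obtain ⟨G', hG'⟩ := (isCompact_closedBall (0 : Euc d) 1).exists_bound_of_continuousOn
    hg'.continuousOn
  have : IsFiniteMeasure (volume.restrict (ball (0 : Euc d) 1)) :=
    ⟨by simpa using measure_ball_lt_top⟩
  have i1 : IntegrableOn (fun x => F x * fderiv ℝ g x w) (ball 0 1) := by
    refine Integrable.of_bound (hF.aestronglyMeasurable.mul hg'.aestronglyMeasurable) (L * G') ?_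
    filter_upwards [ae_restrict_mem measurableSet_ball] with x hx
    rw [norm_mul]
    exact mul_le_mul (hL1 x hx) (hG' x (ball_subset_closedBall hx)) (norm_nonneg _) hL0
  have i2 : IntegrableOn (fun x => fderiv ℝ F x w * g x) (ball 0 1) := by
    refine Integrable.of_bound ((measurable_fderiv_apply_const ℝ F w).aestronglyMeasurable.mul
      hg.continuous.aestronglyMeasurable) (L * ‖w‖ * G) ?_
    filter_upwards [ae_restrict_mem measurableSet_ball] with x hx
    rw [norm_mul]
    refine mul_le_mul ?_ (hG x (ball_subset_closedBall hx)) (norm_nonneg _) (by positivity)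
    exact (ContinuousLinearMap.le_opNorm _ _).trans
      (mul_le_mul_of_nonneg_right (hL2 x hx) (norm_nonneg _))
  have i3 : IntegrableOn (fun x => F x * g x) (ball 0 1) := by
    refine Integrable.of_bound (hF.aestronglyMeasurable.mul hg.continuous.aestronglyMeasurable)
      (L * G) ?_
    filter_upwards [ae_restrict_mem measurableSet_ball] with x hx
    rw [norm_mul]
    exact mul_le_mul (hL1 x hx) (hG x (ball_subset_closedBall hx)) (norm_nonneg _) hL0
  have e1 : ∀ x ∉ ball (0 : Euc d) 1, F x * fderiv ℝ g x w = 0 := fun x hx => by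
    rw [hg0' x hx, mul_zero]
  have e2 : ∀ x ∉ ball (0 : Euc d) 1, fderiv ℝ F x w * g x = 0 := fun x hx => by
    rw [hg0 x hx, mul_zero]
  have e3 : ∀ x ∉ ball (0 : Euc d) 1, F x * g x = 0 := fun x hx => by
    rw [hg0 x hx, mul_zero]
  have key := integral_mul_fderiv_eq_neg_fderiv_mul_of_integrable (μ := volume) (f := F) (g := g)
    (v := w) (i2.integrable_of_forall_notMem_eq_zero e2) (i1.integrable_of_forall_notMem_eq_zero e1)
    (i3.integrable_of_forall_notMem_eq_zero e3) (fun x hx => hF.differentiableAt (hsupp hx))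
    (fun x _ => hg.differentiable one_ne_zero x)
  refine ⟨i1.add i2, ?_⟩
  rw [integral_add i1 i2, setIntegral_eq_integral_of_forall_compl_eq_zero e1,
    setIntegral_eq_integral_of_forall_compl_eq_zero e2, key]
  ring

end IntegrationByParts

end WeightedBall

namespace WeightedBall

/-! ### The divergence theorem for the regularized weight -/

section WeightedDivergence

open Metric Set Filter Topology

variable {d : ℕ} {R Rp : Finset (Euc d)} {κ : Euc d → ℝ} {μ : ℝ}

lemma clm_apply_eq_sum (L : Euc d →L[ℝ] ℝ) (w : Euc d) :
    L w = ∑ i, w i * L (EuclideanSpace.single i 1) := by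
  conv_lhs => rw [← (EuclideanSpace.basisFun (Fin d) ℝ).sum_repr w]
  simp

/-- A vector field given by its components. -/
noncomputable def vf (Z : Fin d → Euc d → ℝ) (x : Euc d) : Euc d := WithLp.toLp 2 fun i => Z i x

@[simp] lemma vf_apply (Z : Fin d → Euc d → ℝ) (x : Euc d) (i : Fin d) : vf Z x i = Z i x := rfl

/-- The image of the vector field `Z` under the matrix `1 - x xᵀ`. -/
noncomputable def tvf (Z : Fin d → Euc d → ℝ) (x : Euc d) : Euc d :=
  vf Z x - (inner ℝ x (vf Z x) : ℝ) • x

/-- The part of the weighted divergence of `tvf Z` that does not involve the roots. -/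
noncomputable def bdiv (μ : ℝ) (Z : Fin d → Euc d → ℝ) (x : Euc d) : ℝ :=
  ∑ i, fderiv ℝ (Z i) x (EuclideanSpace.single i 1) - (d + 2 * μ) * inner ℝ x (vf Z x) -
    ∑ i, x i * fderiv ℝ (Z i) x x

lemma contDiff_inner_vf {Z : Fin d → Euc d → ℝ} (hZ : ∀ i, ContDiff ℝ 1 (Z i)) :
    ContDiff ℝ 1 (fun x => inner ℝ x (vf Z x) : Euc d → ℝ) := by
  simp only [inner_eq_sum, vf_apply]
  refine ContDiff.sum fun i _ => ContDiff.mul ?_ (hZ i)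
  exact (EuclideanSpace.proj i : Euc d →L[ℝ] ℝ).contDiff

lemma hasFDerivAt_proj (i : Fin d) (x : Euc d) :
    HasFDerivAt (fun x : Euc d => x i) (EuclideanSpace.proj i : Euc d →L[ℝ] ℝ) x :=
  (EuclideanSpace.proj i : Euc d →L[ℝ] ℝ).hasFDerivAt

lemma fderiv_inner_vf_self {Z : Fin d → Euc d → ℝ} (hZ : ∀ i, ContDiff ℝ 1 (Z i)) (x : Euc d) :
    fderiv ℝ (fun x => inner ℝ x (vf Z x) : Euc d → ℝ) x x =
      inner ℝ x (vf Z x) + ∑ i, x i * fderiv ℝ (Z i) x x := by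
  simp only [inner_eq_sum, vf_apply]
  have h : HasFDerivAt (fun x : Euc d => ∑ i, x i * Z i x) _ x :=
    HasFDerivAt.fun_sum fun i _ => (hasFDerivAt_proj i x).mul
      ((hZ i).differentiable one_ne_zero x).hasFDerivAt
  rw [h.fderiv]
  simp [Finset.sum_add_distrib]
  rw [add_comm]
  congr 1
  exact Finset.sum_congr rfl fun i _ => mul_comm _ _

/-- The matrix 1 - xxᵀ serves to make the field tangent to the sphere in the limit. Its radial
component has a factor 1 - ‖x‖², which compensates the loss of one power when (1 - ‖x‖²)^(μ - 1/2)
is differentiated. This leaves a bounded term even for μ < 1/2, and explains the coefficient d + 2μ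
in `bdiv`. -/
lemma div_cutWeight_tvf {ε : ℝ} (hε : 0 < ε) {Z : Fin d → Euc d → ℝ}
    (hZ : ∀ i, ContDiff ℝ 1 (Z i)) {x : Euc d} (hx : x ∈ ball (0 : Euc d) 1) :
    ∑ i, fderiv ℝ (fun x => cutWeight R κ (μ - 1 / 2) ε x * tvf Z x i) x
      (EuclideanSpace.single i 1) =
    regWeight R κ ε x * (1 - ‖x‖ ^ 2) ^ (μ - 1 / 2) *
      (cutoff ((1 - ‖x‖ ^ 2) / ε) * (bdiv μ Z x + ∑ v ∈ R, κ v * inner ℝ x v *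
        (inner ℝ v (vf Z x) - inner ℝ x v * inner ℝ x (vf Z x)) / (inner ℝ x v ^ 2 + ε)) -
      2 * inner ℝ x (vf Z x) *
        ((1 - ‖x‖ ^ 2) / ε * deriv cutoff ((1 - ‖x‖ ^ 2) / ε))) := by
  set s := 1 - ‖x‖ ^ 2 with hs
  have hs0 : 0 < s := one_sub_sq_pos hx
  have he := contDiff_inner_vf hZ
  have h1 : ∀ i, fderiv ℝ (fun x => cutWeight R κ (μ - 1 / 2) ε x * tvf Z x i) x
      (EuclideanSpace.single i 1) =
      tvf Z x i * fderiv ℝ (cutWeight R κ (μ - 1 / 2) ε) x (EuclideanSpace.single i 1) +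
      cutWeight R κ (μ - 1 / 2) ε x * (fderiv ℝ (Z i) x (EuclideanSpace.single i 1) -
        inner ℝ x (vf Z x) - x i * fderiv ℝ (fun x => inner ℝ x (vf Z x) : Euc d → ℝ) x
          (EuclideanSpace.single i 1)) := by
    intro i
    have a1 := ((contDiff_cutWeight (R := R) (κ := κ) (μ - 1 / 2) hε).differentiable
      one_ne_zero x).hasFDerivAt
    have a2 := ((hZ i).differentiable one_ne_zero x).hasFDerivAt
    have a3 := (he.differentiable one_ne_zero x).hasFDerivAt
    have a4 : HasFDerivAt (fun x => tvf Z x i) _ x := a2.sub (a3.mul (hasFDerivAt_proj i x))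
    have a5 : HasFDerivAt (fun x => cutWeight R κ (μ - 1 / 2) ε x * tvf Z x i) _ x := a1.mul a4
    rw [a5.fderiv]
    simp
    ring
  simp only [h1, Finset.sum_add_distrib, ← Finset.mul_sum, Finset.sum_sub_distrib]
  rw [← clm_apply_eq_sum, ← clm_apply_eq_sum, fderiv_inner_vf_self hZ, fderiv_cutWeight _ hε hx]
  have h2 : (inner ℝ x (tvf Z x) : ℝ) = inner ℝ x (vf Z x) * s := by
    rw [tvf, inner_sub_right, inner_smul_right, real_inner_self_eq_norm_sq, hs]
    ring
  have h3 : ∀ v : Euc d, (inner ℝ v (tvf Z x) : ℝ) =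
      inner ℝ v (vf Z x) - inner ℝ x v * inner ℝ x (vf Z x) := fun v => by
    rw [tvf, inner_sub_right, inner_smul_right, real_inner_comm v x]
    ring
  rw [h2, ← hs]
  simp only [h3]
  have h4 : s ^ (μ - 1 / 2 - 1) = s ^ (μ - 1 / 2) / s := by rw [Real.rpow_sub_one hs0.ne']
  rw [h4, cutWeight, ← hs, cutPow, bdiv]
  simp only [Finset.sum_const, Finset.card_univ, Fintype.card_fin, nsmul_eq_mul]
  generalize (∑ v ∈ R, κ v * inner ℝ x v * (inner ℝ v (vf Z x) - inner ℝ x v * inner ℝ x (vf Z x)) /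
    (inner ℝ x v ^ 2 + ε) : ℝ) = S
  field_simp
  ring

lemma integral_cutWeight_divergence {ε : ℝ} (hε : 0 < ε)
    {Z : Fin d → Euc d → ℝ} (hZ : ∀ i, ContDiff ℝ 1 (Z i)) {F : Euc d → ℝ} (hF : IsTame F) :
    ∫ x in ball 0 1, regWeight R κ ε x * (1 - ‖x‖ ^ 2) ^ (μ - 1 / 2) *
      (cutoff ((1 - ‖x‖ ^ 2) / ε) * (fderiv ℝ F x (tvf Z x) +
        F x * (bdiv μ Z x + ∑ v ∈ R, κ v * inner ℝ x v *
        (inner ℝ v (vf Z x) - inner ℝ x v * inner ℝ x (vf Z x)) / (inner ℝ x v ^ 2 + ε))) -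
      2 * F x * inner ℝ x (vf Z x) *
        ((1 - ‖x‖ ^ 2) / ε * deriv cutoff ((1 - ‖x‖ ^ 2) / ε))) = 0 := by
  have he := contDiff_inner_vf hZ
  have hg : ∀ i, ContDiff ℝ 1 (fun x => cutWeight R κ (μ - 1 / 2) ε x * tvf Z x i) := fun i =>
    (contDiff_cutWeight _ hε).mul ((hZ i).sub (he.mul
      (EuclideanSpace.proj i : Euc d →L[ℝ] ℝ).contDiff))
  have h := fun i => integral_ball_mul_fderiv hF (hg i)
    (tsupport_cutWeight_mul_subset _ hε _) (EuclideanSpace.single i 1)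
  have h0 := Finset.sum_eq_zero fun i (_ : i ∈ Finset.univ) => (h i).2
  rw [← integral_finsetSum _ fun i _ => (h i).1] at h0
  rw [← h0]
  refine setIntegral_congr_fun measurableSet_ball fun x hx => ?_
  simp only [Finset.sum_add_distrib, ← Finset.mul_sum]
  rw [div_cutWeight_tvf hε hZ hx, clm_apply_eq_sum (fderiv ℝ F x) (tvf Z x)]
  simp only [cutWeight, cutPow]
  have : ∑ i, fderiv ℝ F x (EuclideanSpace.single i 1) * (regWeight R κ ε x *
      (cutoff ((1 - ‖x‖ ^ 2) / ε) * (1 - ‖x‖ ^ 2) ^ (μ - 1 / 2)) * tvf Z x i) =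
      regWeight R κ ε x * (cutoff ((1 - ‖x‖ ^ 2) / ε) * (1 - ‖x‖ ^ 2) ^ (μ - 1 / 2)) *
      ∑ i, tvf Z x i * fderiv ℝ F x (EuclideanSpace.single i 1) := by
    rw [Finset.mul_sum]
    exact Finset.sum_congr rfl fun i _ => by ring
  rw [this]
  ring

/-- The regularization parameters. -/
noncomputable def epsSeq (n : ℕ) : ℝ := 1 / ((n : ℝ) + 1)

lemma epsSeq_pos (n : ℕ) : 0 < epsSeq n := Nat.one_div_pos_of_nat

lemma epsSeq_le_one (n : ℕ) : epsSeq n ≤ 1 := by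
  rw [epsSeq, div_le_one (by positivity)]
  linarith [n.cast_nonneg (α := ℝ)]

lemma tendsto_epsSeq : Tendsto epsSeq atTop (𝓝 0) := tendsto_one_div_add_atTop_nhds_zero_nat

lemma eventually_cutoff_eq {s : ℝ} (hs : 0 < s) :
    ∀ᶠ n in atTop, cutoff (s / epsSeq n) = 1 ∧ deriv cutoff (s / epsSeq n) = 0 := by
  filter_upwards [tendsto_epsSeq.eventually (gt_mem_nhds (show 0 < s / 3 by positivity))] with n hn
  have h : 2 < s / epsSeq n := by
    rw [lt_div_iff₀ (epsSeq_pos n)]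
    linarith
  exact ⟨cutoff_eq_one h.le, deriv_cutoff_eq_zero_of_gt h⟩

/-- Dominated convergence for the regularized weights. -/
lemma tendsto_integral_regWeight (hd : 1 ≤ d) (hμ : 0 ≤ μ) (hR : IsRootSystem R)
    (hRp : IsPositiveSubsystem R Rp) (hκ : IsMultiplicity R κ) {h : ℕ → Euc d → ℝ}
    {h' : Euc d → ℝ} {C : ℝ}
    (hm : ∀ n, AEStronglyMeasurable (h n) (volume.restrict (ball 0 1)))
    (hC : ∀ n, ∀ x ∈ ball (0 : Euc d) 1, |h n x| ≤ C)
    (hlim : ∀ x ∈ ball (0 : Euc d) 1, x ∈ regularSet R →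
      Tendsto (fun n => h n x) atTop (𝓝 (h' x))) :
    Tendsto (fun n => ∫ x in ball 0 1, regWeight R κ (epsSeq n) x *
      (1 - ‖x‖ ^ 2) ^ (μ - 1 / 2) * h n x) atTop (𝓝 (∫ x, h' x ∂weightMeasure Rp κ μ)) := by
  rw [integral_weightMeasure hR hRp hκ]
  refine tendsto_integral_of_dominated_convergence
    (fun x => (∏ v ∈ R, (5 : ℝ) ^ (κ v / 2)) * (1 - ‖x‖ ^ 2) ^ (μ - 1 / 2) * C) ?_ ?_ ?_ ?_
  · intro n
    refine AEStronglyMeasurable.mul (AEStronglyMeasurable.mul ?_ ?_) (hm n)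
    · exact (contDiff_regWeight (epsSeq_pos n)).continuous.aestronglyMeasurable
    · exact Measurable.aestronglyMeasurable (by fun_prop)
  · exact ((integrableOn_one_sub_norm_sq_rpow hd hμ).const_mul _).mul_const _
  · intro n
    filter_upwards [ae_restrict_mem measurableSet_ball] with x hx
    have hs := Real.rpow_nonneg (one_sub_sq_pos hx).le (μ - 1 / 2)
    rw [norm_mul, norm_mul, Real.norm_of_nonneg (regWeight_pos _ _).le, Real.norm_of_nonneg hs]
    have h1 := regWeight_le hR hκ (epsSeq_pos n) (epsSeq_le_one n) hx
    have h2 := (regWeight_pos (R := R) (κ := κ) (epsSeq n) x).le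
    exact mul_le_mul (mul_le_mul_of_nonneg_right h1 hs) (hC n x hx) (norm_nonneg _)
      (mul_nonneg (h2.trans h1) hs)
  · filter_upwards [ae_ball_regular hR] with x hx
    exact ((tendsto_regWeight epsSeq_pos tendsto_epsSeq hx.2).mul tendsto_const_nhds).mul
      (hlim x hx.1 hx.2)

end WeightedDivergence

end WeightedBall

namespace WeightedBall

/-! ### The Dirichlet form of the ball operator -/

section DirichletForm

open Metric Set Filter Topology

variable {d : ℕ} {R Rp : Finset (Euc d)} {κ : Euc d → ℝ} {μ : ℝ}

lemma exists_bound_ball {f : Euc d → ℝ} (hf : Continuous f) :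
    ∃ C : ℝ, 0 ≤ C ∧ ∀ x ∈ ball (0 : Euc d) 1, |f x| ≤ C := by
  obtain ⟨C, hC⟩ := (isCompact_closedBall (0 : Euc d) 1).exists_bound_of_continuousOn hf.continuousOn
  exact ⟨max C 0, le_max_right _ _,
    fun x hx => (hC x (ball_subset_closedBall hx)).trans (le_max_left _ _)⟩

lemma refl_mem_ball {u : Euc d} (hu : inner ℝ u u = (2 : ℝ)) {x : Euc d}
    (hx : x ∈ ball (0 : Euc d) 1) : refl u x ∈ ball (0 : Euc d) 1 := by
  rw [mem_ball_zero_iff] at hx ⊢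
  rwa [norm_refl hu]

lemma continuous_refl {u : Euc d} (hu : inner ℝ u u = (2 : ℝ)) : Continuous (refl u) :=
  (reflIso u hu).continuous

lemma IsTame.comp_refl {f : Euc d → ℝ} (hf : IsTame f) {u : Euc d} (hu : inner ℝ u u = (2 : ℝ)) :
    AEStronglyMeasurable (fun x => f (refl u x)) (volume.restrict (ball 0 1)) := by
  have : ContinuousOn (fun x => f (refl u x)) (ball 0 1) :=
    hf.continuousOn.comp (continuous_refl hu).continuousOn
      fun x hx => ball_subset_closedBall (refl_mem_ball hu hx)
  exact this.aestronglyMeasurable measurableSet_ball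

lemma setIntegral_ball_of_odd {u : Euc d} (hu : inner ℝ u u = (2 : ℝ)) {k : Euc d → ℝ}
    (hk : ∀ x, k (refl u x) = -k x) : ∫ x in ball 0 1, k x = 0 := by
  have h1 : MeasurePreserving (reflIso u hu) volume volume := (reflIso u hu).measurePreserving
  have h2 := h1.setIntegral_preimage_emb
    (reflIso u hu).toHomeomorph.measurableEmbedding k (ball 0 1)
  have h3 : (reflIso u hu) ⁻¹' (ball 0 1) = ball 0 1 := by
    ext x
    simp
  rw [h3] at h2
  have h4 : ∀ x, k ((reflIso u hu) x) = -k x := hk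
  simp only [h4, integral_neg] at h2
  linarith

lemma integrableOn_regWeight_mul (hd : 1 ≤ d) (hμ : 0 ≤ μ) (hR : IsRootSystem R)
    (hκ : IsMultiplicity R κ) (n : ℕ) {h : Euc d → ℝ}
    {C : ℝ} (hm : AEStronglyMeasurable h (volume.restrict (ball 0 1)))
    (hC : ∀ x ∈ ball (0 : Euc d) 1, |h x| ≤ C) :
    IntegrableOn (fun x => regWeight R κ (epsSeq n) x * (1 - ‖x‖ ^ 2) ^ (μ - 1 / 2) * h x)
      (ball 0 1) := by
  refine Integrable.mono' (g := fun x => (∏ v ∈ R, (5 : ℝ) ^ (κ v / 2)) *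
    (1 - ‖x‖ ^ 2) ^ (μ - 1 / 2) * C) ?_ ?_ ?_
  · exact ((integrableOn_one_sub_norm_sq_rpow hd hμ).const_mul _).mul_const _
  · refine AEStronglyMeasurable.mul (AEStronglyMeasurable.mul ?_ ?_) hm
    · exact (contDiff_regWeight (epsSeq_pos n)).continuous.aestronglyMeasurable
    · exact Measurable.aestronglyMeasurable (by fun_prop)
  · filter_upwards [ae_restrict_mem measurableSet_ball] with x hx
    have hs := Real.rpow_nonneg (one_sub_sq_pos hx).le (μ - 1 / 2)
    rw [norm_mul, norm_mul, Real.norm_of_nonneg (regWeight_pos _ _).le, Real.norm_of_nonneg hs]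
    have h1 := regWeight_le hR hκ (epsSeq_pos n) (epsSeq_le_one n) hx
    have h2 := (regWeight_pos (R := R) (κ := κ) (epsSeq n) x).le
    exact mul_le_mul (mul_le_mul_of_nonneg_right h1 hs) (hC x hx) (norm_nonneg _)
      (mul_nonneg (h2.trans h1) hs)

lemma continuous_vf {Z : Fin d → Euc d → ℝ} (hZ : ∀ i, ContDiff ℝ 1 (Z i)) : Continuous (vf Z) :=
  (PiLp.continuous_toLp 2 _).comp (continuous_pi fun i => (hZ i).continuous)

lemma continuous_tvf {Z : Fin d → Euc d → ℝ} (hZ : ∀ i, ContDiff ℝ 1 (Z i)) :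
    Continuous (tvf Z) := by
  have := continuous_vf hZ
  unfold tvf
  fun_prop

lemma continuous_bdiv {Z : Fin d → Euc d → ℝ} (hZ : ∀ i, ContDiff ℝ 1 (Z i)) :
    Continuous (bdiv μ Z) := by
  have h1 := continuous_vf hZ
  have h2 : ∀ i, Continuous (fderiv ℝ (Z i)) := fun i => (hZ i).continuous_fderiv one_ne_zero
  unfold bdiv
  refine ((continuous_finsetSum _ fun i _ => (h2 i).clm_apply continuous_const).sub
    (continuous_const.mul (by fun_prop))).sub (continuous_finsetSum _ fun i _ => ?_)
  exact (by fun_prop : Continuous fun x : Euc d => x i).mul ((h2 i).clm_apply continuous_id)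

lemma exists_bound_fderiv_tvf {F : Euc d → ℝ} (hF : IsTame F) {Z : Fin d → Euc d → ℝ}
    (hZ : ∀ i, ContDiff ℝ 1 (Z i)) :
    ∃ C : ℝ, 0 ≤ C ∧ ∀ x ∈ ball (0 : Euc d) 1, |fderiv ℝ F x (tvf Z x)| ≤ C := by
  obtain ⟨L, hL0, -, hL, -⟩ := hF.exists_bound
  obtain ⟨G, hG0, hG⟩ := exists_bound_ball (continuous_tvf hZ).norm
  refine ⟨L * G, by positivity, fun x hx => ?_⟩
  rw [← Real.norm_eq_abs]
  refine (ContinuousLinearMap.le_opNorm _ _).trans (mul_le_mul (hL x hx) ?_ (norm_nonneg _) hL0)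
  simpa using hG x hx

lemma measurable_fderiv_tvf (F : Euc d → ℝ) {Z : Fin d → Euc d → ℝ}
    (hZ : ∀ i, ContDiff ℝ 1 (Z i)) : Measurable fun x => fderiv ℝ F x (tvf Z x) := by
  have h : ∀ x, fderiv ℝ F x (tvf Z x) =
      ∑ i, tvf Z x i * fderiv ℝ F x (EuclideanSpace.single i 1) := fun x => clm_apply_eq_sum _ _
  simp only [h]
  have := (continuous_tvf hZ).measurable
  refine Finset.measurable_sum _ fun i _ => Measurable.mul ?_ (measurable_fderiv_apply_const ℝ F _)
  fun_prop

/-- The bound does not depend on ε: a numerator vanishing to second order on the hyperplane b = 0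
gives quotients that are dominated uniformly. -/
lemma abs_div_add_le {a b ε C : ℝ} (hε : 0 < ε) (hC : 0 ≤ C) (h : |a| ≤ C * b ^ 2) :
    |a / (b ^ 2 + ε)| ≤ C := by
  rw [abs_div, abs_of_pos (by positivity : 0 < b ^ 2 + ε), div_le_iff₀ (by positivity)]
  nlinarith

/-- Integration by parts for a vector field whose normal components vanish on the reflecting
hyperplanes. -/
lemma integral_divergence (hd : 1 ≤ d) (hμ : 0 ≤ μ) (hR : IsRootSystem R)
    (hRp : IsPositiveSubsystem R Rp) (hκ : IsMultiplicity R κ) {Z : Fin d → Euc d → ℝ}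
    (hZ : ∀ i, ContDiff ℝ 1 (Z i)) {C : ℝ} (hC0 : 0 ≤ C)
    (hC : ∀ v ∈ R, ∀ x ∈ ball (0 : Euc d) 1, |inner ℝ v (vf Z x)| ≤ C * |inner ℝ x v|)
    {F : Euc d → ℝ} (hF : IsTame F) :
    Integrable (fun x => fderiv ℝ F x (tvf Z x) + F x * (bdiv μ Z x +
      ∑ v ∈ R, κ v * (inner ℝ v (vf Z x) / inner ℝ x v - inner ℝ x (vf Z x))))
      (weightMeasure Rp κ μ) ∧
    ∫ x, (fderiv ℝ F x (tvf Z x) + F x * (bdiv μ Z x +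
      ∑ v ∈ R, κ v * (inner ℝ v (vf Z x) / inner ℝ x v - inner ℝ x (vf Z x))))
      ∂weightMeasure Rp κ μ = 0 := by
  have := isFiniteMeasure_weightMeasure hd hμ hR hRp hκ
  obtain ⟨K₁, hK₁0, hK₁⟩ := exists_bound_fderiv_tvf hF hZ
  obtain ⟨K₂, hK₂0, hK₂⟩ := exists_bound_ball (continuous_bdiv (μ := μ) hZ)
  obtain ⟨K₃, hK₃0, hK₃⟩ := exists_bound_ball (contDiff_inner_vf hZ).continuous
  obtain ⟨L, hL0, hL, -, -⟩ := hF.exists_bound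
  obtain ⟨K₄, hK₄0, hK₄⟩ := exists_mul_deriv_cutoff_bound
  have hvf := continuous_vf hZ
  have hcd := contDiff_cutoff.continuous_deriv le_rfl
  have hc := contDiff_cutoff.continuous
  constructor
  · refine integrable_of_bound (C := K₁ + L * (K₂ + ∑ v ∈ R, κ v * (C + K₃)))
      (AEStronglyMeasurable.add (measurable_fderiv_tvf F hZ).aestronglyMeasurable
      (hF.aestronglyMeasurable.mul ?_)) fun x hx => ?_
    · have := hvf.measurable
      refine ((continuous_bdiv hZ).measurable.add (Finset.measurable_sum _ fun v _ =>
        Measurable.const_mul (Measurable.sub (Measurable.div ?_ ?_) ?_) _)).aestronglyMeasurable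
      all_goals fun_prop
    · refine (abs_add_le _ _).trans (add_le_add (hK₁ x hx) ?_)
      rw [abs_mul]
      refine mul_le_mul (hL x hx) ?_ (abs_nonneg _) hL0
      refine (abs_add_le _ _).trans (add_le_add (hK₂ x hx) ?_)
      refine (Finset.abs_sum_le_sum_abs _ _).trans (Finset.sum_le_sum fun v hv => ?_)
      rw [abs_mul, abs_of_nonneg (hκ.nonneg v hv)]
      refine mul_le_mul_of_nonneg_left ((abs_sub _ _).trans (add_le_add ?_ (hK₃ x hx)))
        (hκ.nonneg v hv)
      rw [abs_div]
      exact div_le_of_le_mul₀ (abs_nonneg _) hC0 (hC v hv x hx)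
  -- The regularized integrals are all zero, so their limit is too. The term with the derivative of
  -- the cutoff is bounded and, at each point of the open ball, vanishes for large n.
  have h := tendsto_integral_regWeight hd hμ hR hRp hκ
    (h := fun n x => cutoff ((1 - ‖x‖ ^ 2) / epsSeq n) * (fderiv ℝ F x (tvf Z x) +
        F x * (bdiv μ Z x + ∑ v ∈ R, κ v * inner ℝ x v *
        (inner ℝ v (vf Z x) - inner ℝ x v * inner ℝ x (vf Z x)) / (inner ℝ x v ^ 2 + epsSeq n))) -
      2 * F x * inner ℝ x (vf Z x) *
        ((1 - ‖x‖ ^ 2) / epsSeq n * deriv cutoff ((1 - ‖x‖ ^ 2) / epsSeq n)))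
    (h' := fun x => fderiv ℝ F x (tvf Z x) + F x * (bdiv μ Z x +
      ∑ v ∈ R, κ v * (inner ℝ v (vf Z x) / inner ℝ x v - inner ℝ x (vf Z x))))
    (C := 1 * (K₁ + L * (K₂ + ∑ v ∈ R, κ v * (C + K₃))) + 2 * L * K₃ * K₄) ?_ ?_ ?_
  · simp only [integral_cutWeight_divergence (epsSeq_pos _) hZ hF] at h
    exact (tendsto_nhds_unique h tendsto_const_nhds)
  · intro n
    refine AEStronglyMeasurable.sub (AEStronglyMeasurable.mul ?_ (AEStronglyMeasurable.add ?_
      (hF.aestronglyMeasurable.mul ?_))) (AEStronglyMeasurable.mul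
        ((hF.aestronglyMeasurable.const_mul _).mul ?_) ?_)
    · exact (hc.comp (by fun_prop)).aestronglyMeasurable
    · exact (measurable_fderiv_tvf F hZ).aestronglyMeasurable
    · refine Continuous.aestronglyMeasurable ((continuous_bdiv hZ).add
        (continuous_finsetSum _ fun v _ => ?_))
      refine Continuous.div (by fun_prop) (by fun_prop) fun x => ?_
      have := epsSeq_pos n
      positivity
    · exact (contDiff_inner_vf hZ).continuous.aestronglyMeasurable
    · exact (Continuous.mul (by fun_prop) (hcd.comp (by fun_prop))).aestronglyMeasurable
  · intro n x hx
    have hs := one_sub_sq_pos hx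
    have hε := epsSeq_pos n
    refine (abs_sub _ _).trans (add_le_add ?_ ?_)
    · rw [abs_mul, abs_of_nonneg (cutoff_nonneg _)]
      refine mul_le_mul (cutoff_le_one _) ?_ (abs_nonneg _) zero_le_one
      refine (abs_add_le _ _).trans (add_le_add (hK₁ x hx) ?_)
      rw [abs_mul]
      refine mul_le_mul (hL x hx) ?_ (abs_nonneg _) hL0
      refine (abs_add_le _ _).trans (add_le_add (hK₂ x hx) ?_)
      refine (Finset.abs_sum_le_sum_abs _ _).trans (Finset.sum_le_sum fun v hv => ?_)
      rw [mul_assoc, mul_div_assoc, abs_mul, abs_of_nonneg (hκ.nonneg v hv)]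
      refine mul_le_mul_of_nonneg_left ?_ (hκ.nonneg v hv)
      refine abs_div_add_le hε (by positivity) ?_
      rw [abs_mul, ← sq_abs (inner ℝ x v)]
      have a1 := hC v hv x hx
      have a2 := hK₃ x hx
      have a3 : |inner ℝ v (vf Z x) - inner ℝ x v * inner ℝ x (vf Z x)| ≤
          C * |inner ℝ x v| + |inner ℝ x v| * K₃ := by
        refine (abs_sub _ _).trans (add_le_add a1 ?_)
        rw [abs_mul]
        exact mul_le_mul_of_nonneg_left a2 (abs_nonneg _)
      nlinarith [abs_nonneg (inner ℝ x v : ℝ)]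
    · rw [abs_mul, abs_mul, abs_mul, abs_two]
      refine mul_le_mul (mul_le_mul (mul_le_mul_of_nonneg_left (hL x hx) zero_le_two) (hK₃ x hx)
        (abs_nonneg _) (by positivity)) (hK₄ _ (by positivity)) (abs_nonneg _) (by positivity)
  · intro x hx hx'
    have hlim : Tendsto (fun n => fderiv ℝ F x (tvf Z x) +
        F x * (bdiv μ Z x + ∑ v ∈ R, κ v * inner ℝ x v *
        (inner ℝ v (vf Z x) - inner ℝ x v * inner ℝ x (vf Z x)) / (inner ℝ x v ^ 2 + epsSeq n)))
        atTop (𝓝 (fderiv ℝ F x (tvf Z x) + F x * (bdiv μ Z x +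
        ∑ v ∈ R, κ v * inner ℝ x v *
        (inner ℝ v (vf Z x) - inner ℝ x v * inner ℝ x (vf Z x)) / (inner ℝ x v ^ 2 + 0)))) := by
      refine tendsto_const_nhds.add (tendsto_const_nhds.mul (tendsto_const_nhds.add
        (tendsto_finsetSum _ fun v hv => ?_)))
      refine tendsto_const_nhds.div (tendsto_const_nhds.add tendsto_epsSeq) ?_
      have := hx' v hv
      positivity
    have e : ∑ v ∈ R, κ v * inner ℝ x v *
        (inner ℝ v (vf Z x) - inner ℝ x v * inner ℝ x (vf Z x)) / (inner ℝ x v ^ 2 + 0) =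
        ∑ v ∈ R, κ v * (inner ℝ v (vf Z x) / inner ℝ x v - inner ℝ x (vf Z x)) := by
      refine Finset.sum_congr rfl fun v hv => ?_
      have := hx' v hv
      field_simp
      ring
    rw [e] at hlim
    refine hlim.congr' ?_
    filter_upwards [eventually_cutoff_eq (one_sub_sq_pos hx)] with n hn
    rw [hn.1, hn.2]
    ring

/-- The bilinear carré du champ of the ball operator. -/
noncomputable def gammaForm (R : Finset (Euc d)) (κ : Euc d → ℝ) (f h : Euc d → ℝ) (x : Euc d) : ℝ :=
  ∑ i, fderiv ℝ f x (EuclideanSpace.single i 1) * fderiv ℝ h x (EuclideanSpace.single i 1) -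
    fderiv ℝ f x x * fderiv ℝ h x x +
    ∑ v ∈ R, κ v / 2 * ((f x - f (refl v x)) * (h x - h (refl v x)) / inner ℝ x v ^ 2)

/-- Since ‖x - σ_v x‖ = √2 |⟨x,v⟩|, a Lipschitz bound controls the difference quotients up to the
hyperplanes. -/
lemma exists_bound_difference (hR : IsRootSystem R) {f : Euc d → ℝ} (hf : IsTame f) :
    ∃ L : ℝ, 0 ≤ L ∧ ∀ v ∈ R, ∀ x ∈ ball (0 : Euc d) 1, |f x - f (refl v x)| ≤ L * |inner ℝ x v| := by
  obtain ⟨L, hL0, -, -, hL⟩ := hf.exists_bound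
  refine ⟨L * √2, by positivity, fun v hv x hx => ?_⟩
  have hv2 := hR.inner_self v hv
  refine (hL x hx _ (refl_mem_ball hv2 hx)).trans (le_of_eq ?_)
  rw [refl_eq hv2, sub_sub_cancel, norm_smul, hR.norm_root hv, Real.norm_eq_abs]
  ring

/-- The divergence theorem is applied to F times the gradient of p. The normal component ∂_v p need
not vanish on the hyperplanes, so `integral_divergence` does not cover this case. The Taylor formula
splits ⟨x,v⟩ ∂_v p into ⟨x,v⟩² r, which is harmless, and p - p∘σ_v, which after division by ⟨x,v⟩² +
ε is singular as ε tends to 0. In the latter term F is replaced by its σ_v-odd half, because the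
even half gives an odd integrand against a reflection invariant weight. The product of two
differences that remains is the nonlocal part of Γ. The symmetrization has to precede the limit ε →
0, as only then are all the integrals known to converge. -/
lemma integral_gammaForm_add_mul_ballLaplacian (hd : 1 ≤ d) (hμ : 0 ≤ μ) (hR : IsRootSystem R)
    (hRp : IsPositiveSubsystem R Rp) (hκ : IsMultiplicity R κ) {F : Euc d → ℝ} (hF : IsTame F)
    (p : MvPolynomial (Fin d) ℝ) :
    ∫ x, (gammaForm R κ F (polyFun p) x + F x * ballLaplacian Rp κ μ (polyFun p) x)
      ∂weightMeasure Rp κ μ = 0 := by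
  obtain ⟨m, hm⟩ := exists_mem_degLT p
  have hp := degLT_mono m.le_succ hm
  have hr0 : ∀ v : Euc d, ∃ r : MvPolynomial (Fin d) ℝ, v ∈ R → ∀ x : Euc d,
      polyFun p (refl v x) = polyFun p x - inner ℝ x v * polyFun (dirD v p) x +
        inner ℝ x v ^ 2 * polyFun r x := by
    intro v
    by_cases hv : v ∈ R
    · obtain ⟨r, -, h⟩ := exists_taylor (hR.inner_self v hv) hp
      exact ⟨r, fun _ => h⟩
    · exact ⟨0, fun h => absurd h hv⟩
  choose r hr using hr0
  let Z : Fin d → Euc d → ℝ := fun i => polyFun (MvPolynomial.pderiv i p)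
  have hZ : ∀ i, ContDiff ℝ 1 (Z i) := fun i => contDiff_polyFun _
  have hvZ : ∀ v x : Euc d, (inner ℝ v (vf Z x) : ℝ) = polyFun (dirD v p) x := fun v x => by
    rw [inner_eq_sum, polyFun_dirD_eq_sum]
    rfl
  have hxZ : ∀ x : Euc d, (inner ℝ x (vf Z x) : ℝ) = polyFun (eulerP p) x := fun x => by
    rw [hvZ, polyFun_eulerP]
  obtain ⟨K₁, hK₁0, hK₁⟩ := exists_bound_fderiv_tvf hF hZ
  obtain ⟨K₂, hK₂0, hK₂⟩ := exists_bound_ball (continuous_bdiv (μ := μ) hZ)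
  obtain ⟨K₃, hK₃0, hK₃⟩ := exists_bound_ball (contDiff_inner_vf hZ).continuous
  obtain ⟨L, hL0, hL, -, -⟩ := hF.exists_bound
  obtain ⟨K₄, hK₄0, hK₄⟩ := exists_mul_deriv_cutoff_bound
  obtain ⟨K₅, hK₅0, hK₅⟩ := exists_bound_difference hR hF
  obtain ⟨K₆, hK₆0, hK₆⟩ := exists_bound_difference hR (isTame_polyFun p)
  have hK₇ : ∀ v, ∃ C : ℝ, 0 ≤ C ∧ ∀ x ∈ ball (0 : Euc d) 1,
      |polyFun (r v) x - inner ℝ x (vf Z x)| ≤ C := fun v => exists_bound_ball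
        ((continuous_polyFun (r v)).sub (contDiff_inner_vf hZ).continuous)
  choose K₇ hK₇0 hK₇ using hK₇
  have hcd := contDiff_cutoff.continuous_deriv le_rfl
  have hc := contDiff_cutoff.continuous
  -- The part containing F + F∘σ_v. Its bound blows up as ε tends to 0, but it is integrable for
  -- each ε, and its integral is zero.
  let odd : ℕ → Euc d → Euc d → ℝ := fun n v x => cutoff ((1 - ‖x‖ ^ 2) / epsSeq n) *
    ((F x + F (refl v x)) * (polyFun p x - polyFun p (refl v x)) / (inner ℝ x v ^ 2 + epsSeq n))
  -- The integrand of `integral_cutWeight_divergence` without its odd parts; unlike that integrand,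
  -- it is bounded uniformly in n.
  let h : ℕ → Euc d → ℝ := fun n x =>
    cutoff ((1 - ‖x‖ ^ 2) / epsSeq n) * (fderiv ℝ F x (tvf Z x) +
      ∑ v ∈ R, κ v / 2 * ((F x - F (refl v x)) * (polyFun p x - polyFun p (refl v x)) /
        (inner ℝ x v ^ 2 + epsSeq n)) +
      F x * (bdiv μ Z x + ∑ v ∈ R, κ v * (inner ℝ x v ^ 2 *
        (polyFun (r v) x - inner ℝ x (vf Z x)) / (inner ℝ x v ^ 2 + epsSeq n)))) -
    2 * F x * inner ℝ x (vf Z x) *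
      ((1 - ‖x‖ ^ 2) / epsSeq n * deriv cutoff ((1 - ‖x‖ ^ 2) / epsSeq n))
  have hpσ : ∀ v ∈ R, Continuous fun x => polyFun p (refl v x) := fun v hv =>
    (continuous_polyFun p).comp (continuous_refl (hR.inner_self v hv))
  have hinv : ∀ (n : ℕ) (v : Euc d), Continuous fun x : Euc d => (inner ℝ x v ^ 2 + epsSeq n)⁻¹ := by
    intro n v
    refine Continuous.inv₀ (by fun_prop) fun x => ?_
    have := epsSeq_pos n
    positivity
  have hmeas : ∀ n, AEStronglyMeasurable (h n) (volume.restrict (ball 0 1)) := by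
    intro n
    refine AEStronglyMeasurable.sub (AEStronglyMeasurable.mul ?_ (AEStronglyMeasurable.add
      (AEStronglyMeasurable.add ?_ ?_)
      (hF.aestronglyMeasurable.mul ?_))) (AEStronglyMeasurable.mul
        ((hF.aestronglyMeasurable.const_mul _).mul ?_) ?_)
    · exact (hc.comp (by fun_prop)).aestronglyMeasurable
    · exact (measurable_fderiv_tvf F hZ).aestronglyMeasurable
    · refine Finset.aestronglyMeasurable_fun_sum _ fun v hv => AEStronglyMeasurable.const_mul ?_ _
      simp only [div_eq_mul_inv]
      exact ((hF.aestronglyMeasurable.sub (hF.comp_refl (hR.inner_self v hv))).mul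
        ((continuous_polyFun p).sub (hpσ v hv)).aestronglyMeasurable).mul
        (hinv n v).aestronglyMeasurable
    · refine Continuous.aestronglyMeasurable ((continuous_bdiv hZ).add
        (continuous_finsetSum _ fun v _ => continuous_const.mul ?_))
      have := (contDiff_inner_vf hZ).continuous
      simp only [div_eq_mul_inv]
      exact Continuous.mul (by fun_prop) (hinv n v)
    · exact (contDiff_inner_vf hZ).continuous.aestronglyMeasurable
    · exact (Continuous.mul (by fun_prop) (hcd.comp (by fun_prop))).aestronglyMeasurable
  have hbound : ∀ n, ∀ x ∈ ball (0 : Euc d) 1, |h n x| ≤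
      1 * (K₁ + ∑ v ∈ R, κ v / 2 * (K₅ * K₆) + L * (K₂ + ∑ v ∈ R, κ v * K₇ v)) +
        2 * L * K₃ * K₄ := by
    intro n x hx
    have hs := one_sub_sq_pos hx
    have hε := epsSeq_pos n
    refine (abs_sub _ _).trans (add_le_add ?_ ?_)
    · rw [abs_mul, abs_of_nonneg (cutoff_nonneg _)]
      refine mul_le_mul (cutoff_le_one _) ?_ (abs_nonneg _) zero_le_one
      refine (abs_add_le _ _).trans (add_le_add ((abs_add_le _ _).trans
        (add_le_add (hK₁ x hx) ?_)) ?_)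
      · refine (Finset.abs_sum_le_sum_abs _ _).trans (Finset.sum_le_sum fun v hv => ?_)
        have hκv : 0 ≤ κ v / 2 := by linarith [hκ.nonneg v hv]
        rw [abs_mul, abs_of_nonneg hκv]
        refine mul_le_mul_of_nonneg_left (abs_div_add_le hε (by positivity) ?_) hκv
        rw [abs_mul, ← sq_abs (inner ℝ x v)]
        refine (mul_le_mul (hK₅ v hv x hx) (hK₆ v hv x hx) (abs_nonneg _) (by positivity)).trans
          (le_of_eq (by ring))
      · rw [abs_mul]
        refine mul_le_mul (hL x hx) ?_ (abs_nonneg _) hL0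
        refine (abs_add_le _ _).trans (add_le_add (hK₂ x hx) ?_)
        refine (Finset.abs_sum_le_sum_abs _ _).trans (Finset.sum_le_sum fun v hv => ?_)
        rw [abs_mul, abs_of_nonneg (hκ.nonneg v hv)]
        refine mul_le_mul_of_nonneg_left (abs_div_add_le hε (hK₇0 v) ?_) (hκ.nonneg v hv)
        rw [abs_mul, abs_of_nonneg (sq_nonneg _), mul_comm]
        exact mul_le_mul_of_nonneg_right (hK₇ v x hx) (sq_nonneg _)
    · rw [abs_mul, abs_mul, abs_mul, abs_two]
      refine mul_le_mul (mul_le_mul (mul_le_mul_of_nonneg_left (hL x hx) zero_le_two) (hK₃ x hx)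
        (abs_nonneg _) (by positivity)) (hK₄ _ (by positivity)) (abs_nonneg _) (by positivity)
  have hoddm : ∀ n, ∀ v ∈ R, AEStronglyMeasurable (odd n v) (volume.restrict (ball 0 1)) := by
    intro n v hv
    refine AEStronglyMeasurable.mul ?_ ?_
    · exact (hc.comp (by fun_prop)).aestronglyMeasurable
    · simp only [div_eq_mul_inv]
      exact ((hF.aestronglyMeasurable.add (hF.comp_refl (hR.inner_self v hv))).mul
        ((continuous_polyFun p).sub (hpσ v hv)).aestronglyMeasurable).mul
        (hinv n v).aestronglyMeasurable
  have hoddb : ∀ n, ∀ v ∈ R, ∀ x ∈ ball (0 : Euc d) 1,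
      |odd n v x| ≤ 1 * ((L + L) * (K₆ * 2) * (epsSeq n)⁻¹) := by
    intro n v hv x hx
    have hε := epsSeq_pos n
    simp only [odd]
    rw [abs_mul, abs_of_nonneg (cutoff_nonneg _), abs_div, abs_mul, div_eq_mul_inv]
    refine mul_le_mul (cutoff_le_one _) ?_ (by positivity) zero_le_one
    refine mul_le_mul (mul_le_mul ?_ ?_ (abs_nonneg _) (by positivity)) ?_ (by positivity)
      (by positivity)
    · exact (abs_add_le _ _).trans (add_le_add (hL x hx)
        (hL _ (refl_mem_ball (hR.inner_self v hv) hx)))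
    · exact (hK₆ v hv x hx).trans (mul_le_mul_of_nonneg_left (hR.abs_inner_le hx hv) hK₆0)
    · rw [abs_of_pos (by positivity)]
      exact inv_anti₀ hε (by nlinarith [sq_nonneg (inner ℝ x v : ℝ)])
  have hodd0 : ∀ n, ∀ v ∈ R, ∫ x in ball 0 1, regWeight R κ (epsSeq n) x *
      (1 - ‖x‖ ^ 2) ^ (μ - 1 / 2) * odd n v x = 0 := by
    intro n v hv
    have hv2 := hR.inner_self v hv
    refine setIntegral_ball_of_odd hv2 fun x => ?_
    simp only [odd, regWeight_refl hR hκ _ hv, norm_refl hv2, refl_refl hv2, inner_refl_self hv2]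
    ring
  have hzero : ∀ n, ∫ x in ball 0 1, regWeight R κ (epsSeq n) x *
      (1 - ‖x‖ ^ 2) ^ (μ - 1 / 2) * h n x = 0 := by
    intro n
    have i1 := integrableOn_regWeight_mul hd hμ hR hκ n (hmeas n) (hbound n)
    have i2 := fun v (hv : v ∈ R) => (integrableOn_regWeight_mul hd hμ hR hκ n (hoddm n v hv)
      (hoddb n v hv)).const_mul (κ v / 2)
    have e := integral_cutWeight_divergence (R := R) (κ := κ) (μ := μ) (epsSeq_pos n) hZ hF
    -- Adding the odd parts back recovers the full divergence, because F = (F - F∘σ_v)/2 + (F +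
    -- F∘σ_v)/2.
    have e2 : ∫ x in ball 0 1, (regWeight R κ (epsSeq n) x *
      (1 - ‖x‖ ^ 2) ^ (μ - 1 / 2) * h n x + ∑ v ∈ R, κ v / 2 * (regWeight R κ (epsSeq n) x *
      (1 - ‖x‖ ^ 2) ^ (μ - 1 / 2) * odd n v x)) = 0 := by
      rw [← e]
      refine setIntegral_congr_fun measurableSet_ball fun x hx => ?_
      simp only [h, odd]
      have e3 : ∑ v ∈ R, κ v * inner ℝ x v *
        (inner ℝ v (vf Z x) - inner ℝ x v * inner ℝ x (vf Z x)) / (inner ℝ x v ^ 2 + epsSeq n) =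
        ∑ v ∈ R, κ v * (inner ℝ x v ^ 2 *
        (polyFun (r v) x - inner ℝ x (vf Z x)) / (inner ℝ x v ^ 2 + epsSeq n)) +
        ∑ v ∈ R, κ v * ((polyFun p x - polyFun p (refl v x)) / (inner ℝ x v ^ 2 + epsSeq n)) := by
        rw [← Finset.sum_add_distrib]
        refine Finset.sum_congr rfl fun v hv => ?_
        rw [hr v hv x, hvZ]
        ring
      rw [e3]
      have e4 : ∑ v ∈ R, κ v / 2 * (regWeight R κ (epsSeq n) x * (1 - ‖x‖ ^ 2) ^ (μ - 1 / 2) *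
          (cutoff ((1 - ‖x‖ ^ 2) / epsSeq n) * ((F x + F (refl v x)) *
          (polyFun p x - polyFun p (refl v x)) / (inner ℝ x v ^ 2 + epsSeq n)))) =
          regWeight R κ (epsSeq n) x * (1 - ‖x‖ ^ 2) ^ (μ - 1 / 2) *
          (cutoff ((1 - ‖x‖ ^ 2) / epsSeq n) * (F x * ∑ v ∈ R, κ v *
            ((polyFun p x - polyFun p (refl v x)) / (inner ℝ x v ^ 2 + epsSeq n)) -
          ∑ v ∈ R, κ v / 2 * ((F x - F (refl v x)) * (polyFun p x - polyFun p (refl v x)) /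
            (inner ℝ x v ^ 2 + epsSeq n)))) := by
        rw [Finset.mul_sum, ← Finset.sum_sub_distrib, Finset.mul_sum, Finset.mul_sum]
        exact Finset.sum_congr rfl fun v _ => by ring
      rw [e4]
      ring
    rw [integral_add i1 (integrable_finsetSum _ i2), integral_finsetSum _ i2] at e2
    rw [Finset.sum_eq_zero fun v hv => by rw [integral_const_mul, hodd0 n v hv, mul_zero],
      add_zero] at e2
    exact e2
  have hlim := tendsto_integral_regWeight hd hμ hR hRp hκ (h := h)
    (h' := fun x => fderiv ℝ F x (tvf Z x) +
      ∑ v ∈ R, κ v / 2 * ((F x - F (refl v x)) * (polyFun p x - polyFun p (refl v x)) /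
        inner ℝ x v ^ 2) +
      F x * (bdiv μ Z x + ∑ v ∈ R, κ v * (polyFun (r v) x - inner ℝ x (vf Z x))))
    hmeas hbound ?_
  · simp only [hzero] at hlim
    rw [← tendsto_nhds_unique hlim tendsto_const_nhds]
    refine integral_congr_ae ((ae_weightMeasure hR).mono fun x hx => ?_)
    simp only
    rw [ballLaplacian, dunklLaplacian_polyFun hR hRp hκ p r hr hx.2, euler_polyFun, euler_polyFun,
      lam_eq_sum_roots hR hRp hκ, gammaForm]
    have e1 : fderiv ℝ F x (tvf Z x) = ∑ i, fderiv ℝ F x (EuclideanSpace.single i 1) *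
        fderiv ℝ (polyFun p) x (EuclideanSpace.single i 1) -
        fderiv ℝ F x x * fderiv ℝ (polyFun p) x x := by
      rw [tvf, map_sub, map_smul, hxZ, polyFun_eulerP, fderiv_polyFun p x x, smul_eq_mul,
        clm_apply_eq_sum _ (vf Z x), mul_comm]
      congr 1
      refine Finset.sum_congr rfl fun i _ => ?_
      rw [fderiv_polyFun, dirD_single, mul_comm]
      rfl
    have e2 : bdiv μ Z x = polyFun (lapP p) x - (d + 2 * μ) * polyFun (eulerP p) x -
        (polyFun (eulerP (eulerP p)) x - polyFun (eulerP p) x) := by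
      have a1 := fderiv_inner_vf_self hZ x
      simp only [hxZ] at a1
      rw [fderiv_polyFun, ← polyFun_eulerP] at a1
      rw [bdiv, hxZ, a1]
      simp only [Z, fderiv_polyFun, dirD_single]
      simp [lapP]
    rw [e1, e2, hxZ]
    simp only [mul_sub, Finset.sum_sub_distrib, ← Finset.sum_mul]
    ring
  · intro x hx hx'
    have hl : Tendsto (fun n => fderiv ℝ F x (tvf Z x) +
      ∑ v ∈ R, κ v / 2 * ((F x - F (refl v x)) * (polyFun p x - polyFun p (refl v x)) /
        (inner ℝ x v ^ 2 + epsSeq n)) +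
      F x * (bdiv μ Z x + ∑ v ∈ R, κ v * (inner ℝ x v ^ 2 *
        (polyFun (r v) x - inner ℝ x (vf Z x)) / (inner ℝ x v ^ 2 + epsSeq n)))) atTop
      (𝓝 (fderiv ℝ F x (tvf Z x) +
      ∑ v ∈ R, κ v / 2 * ((F x - F (refl v x)) * (polyFun p x - polyFun p (refl v x)) /
        (inner ℝ x v ^ 2 + 0)) +
      F x * (bdiv μ Z x + ∑ v ∈ R, κ v * (inner ℝ x v ^ 2 *
        (polyFun (r v) x - inner ℝ x (vf Z x)) / (inner ℝ x v ^ 2 + 0))))) := by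
      refine (tendsto_const_nhds.add (tendsto_finsetSum _ fun v hv => tendsto_const_nhds.mul
        (tendsto_const_nhds.div (tendsto_const_nhds.add tendsto_epsSeq) ?_))).add
        (tendsto_const_nhds.mul (tendsto_const_nhds.add
        (tendsto_finsetSum _ fun v hv => tendsto_const_nhds.mul
        (tendsto_const_nhds.div (tendsto_const_nhds.add tendsto_epsSeq) ?_))))
      all_goals
        have := hx' v hv
        positivity
    have e : ∑ v ∈ R, κ v * (inner ℝ x v ^ 2 *
        (polyFun (r v) x - inner ℝ x (vf Z x)) / (inner ℝ x v ^ 2 + 0)) =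
        ∑ v ∈ R, κ v * (polyFun (r v) x - inner ℝ x (vf Z x)) := by
      refine Finset.sum_congr rfl fun v hv => ?_
      have := hx' v hv
      field_simp
      ring
    rw [e] at hl
    simp only [add_zero] at hl
    refine hl.congr' ?_
    filter_upwards [eventually_cutoff_eq (one_sub_sq_pos hx)] with n hn
    simp only [h]
    rw [hn.1, hn.2]
    ring

end DirichletForm

end WeightedBall

namespace WeightedBall

/-! ### Integrability, positivity and symmetry of the energy -/

section EnergyIdentities

open Metric Set Filter Topology

variable {d : ℕ} {R Rp : Finset (Euc d)} {κ : Euc d → ℝ} {μ : ℝ}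

lemma aestronglyMeasurable_gammaForm (hR : IsRootSystem R) {f h : Euc d → ℝ} (hf : IsTame f)
    (hh : IsTame h) :
    AEStronglyMeasurable (gammaForm R κ f h) (volume.restrict (ball 0 1)) := by
  have e : ∀ f : Euc d → ℝ, Measurable fun x => fderiv ℝ f x x := fun f => by
    rw [funext fun x => clm_apply_eq_sum (fderiv ℝ f x) x]
    exact Finset.measurable_sum _ fun i _ => Measurable.mul (by fun_prop)
      (measurable_fderiv_apply_const ℝ f _)
  refine AEStronglyMeasurable.add (AEStronglyMeasurable.sub ?_ ?_) ?_
  · exact (Finset.measurable_sum _ fun i _ => (measurable_fderiv_apply_const ℝ f _).mul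
      (measurable_fderiv_apply_const ℝ h _)).aestronglyMeasurable
  · exact ((e f).mul (e h)).aestronglyMeasurable
  · refine Finset.aestronglyMeasurable_fun_sum _ fun v hv => AEStronglyMeasurable.const_mul ?_ _
    simp only [div_eq_mul_inv]
    refine ((hf.aestronglyMeasurable.sub (hf.comp_refl (hR.inner_self v hv))).mul
        (hh.aestronglyMeasurable.sub (hh.comp_refl (hR.inner_self v hv)))).mul ?_
    exact Measurable.aestronglyMeasurable (by fun_prop)

lemma integrable_gammaForm [IsFiniteMeasure (weightMeasure Rp κ μ)] (hR : IsRootSystem R)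
    (hκ : IsMultiplicity R κ) {f h : Euc d → ℝ} (hf : IsTame f) (hh : IsTame h) :
    Integrable (gammaForm R κ f h) (weightMeasure Rp κ μ) := by
  obtain ⟨L, hL0, -, hL, -⟩ := hf.exists_bound
  obtain ⟨L', hL0', -, hL', -⟩ := hh.exists_bound
  obtain ⟨K, hK0, hK⟩ := exists_bound_difference hR hf
  obtain ⟨K', hK0', hK'⟩ := exists_bound_difference hR hh
  refine integrable_of_bound (C := ∑ _i : Fin d, L * L' + L * L' + ∑ v ∈ R, κ v / 2 * (K * K'))
    (aestronglyMeasurable_gammaForm hR hf hh) fun x hx => ?_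
  have hx1 : ‖x‖ ≤ 1 := by
    rw [mem_ball_zero_iff] at hx
    exact hx.le
  have b : ∀ w : Euc d, ‖w‖ ≤ 1 → |fderiv ℝ f x w| ≤ L := fun w hw => by
    rw [← Real.norm_eq_abs]
    exact (ContinuousLinearMap.le_opNorm _ _).trans
      ((mul_le_mul (hL x hx) hw (norm_nonneg _) hL0).trans (mul_one _).le)
  have b' : ∀ w : Euc d, ‖w‖ ≤ 1 → |fderiv ℝ h x w| ≤ L' := fun w hw => by
    rw [← Real.norm_eq_abs]
    exact (ContinuousLinearMap.le_opNorm _ _).trans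
      ((mul_le_mul (hL' x hx) hw (norm_nonneg _) hL0').trans (mul_one _).le)
  rw [Real.norm_eq_abs, gammaForm]
  refine (abs_add_le _ _).trans (add_le_add ((abs_sub _ _).trans (add_le_add ?_ ?_)) ?_)
  · refine (Finset.abs_sum_le_sum_abs _ _).trans (Finset.sum_le_sum fun i _ => ?_)
    rw [abs_mul]
    exact mul_le_mul (b _ (by simp)) (b' _ (by simp)) (abs_nonneg _) hL0
  · rw [abs_mul]
    exact mul_le_mul (b _ hx1) (b' _ hx1) (abs_nonneg _) hL0
  · refine (Finset.abs_sum_le_sum_abs _ _).trans (Finset.sum_le_sum fun v hv => ?_)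
    have hκv : 0 ≤ κ v / 2 := by linarith [hκ.nonneg v hv]
    rw [abs_mul, abs_of_nonneg hκv]
    refine mul_le_mul_of_nonneg_left ?_ hκv
    rw [abs_div, abs_mul, abs_of_nonneg (sq_nonneg (inner ℝ x v)), ← sq_abs (inner ℝ x v)]
    refine div_le_of_le_mul₀ (sq_nonneg _) (by positivity) ?_
    exact (mul_le_mul (hK v hv x hx) (hK' v hv x hx) (abs_nonneg _) (by positivity)).trans
      (le_of_eq (by ring))

lemma sq_inner_le_of_mem_ball {x : Euc d} (hx : x ∈ ball (0 : Euc d) 1) (w : Euc d) :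
    (inner ℝ w x : ℝ) ^ 2 ≤ ∑ i, w i ^ 2 := by
  have h1 := abs_real_inner_le_norm w x
  have h2 : ‖x‖ ≤ 1 := by
    rw [mem_ball_zero_iff] at hx
    exact hx.le
  have h3 : ‖w‖ ^ 2 = ∑ i, w i ^ 2 := by
    rw [EuclideanSpace.norm_sq_eq]; simp
  rw [← h3, ← sq_abs]
  have h4 : |(inner ℝ w x : ℝ)| ≤ ‖w‖ := h1.trans (by nlinarith [norm_nonneg w])
  exact pow_le_pow_left₀ (abs_nonneg _) h4 2

lemma difference_part_nonneg (hκ : IsMultiplicity R κ) (f : Euc d → ℝ) (x : Euc d) :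
    0 ≤ ∑ v ∈ R, κ v / 2 * ((f x - f (refl v x)) * (f x - f (refl v x)) / inner ℝ x v ^ 2) :=
  Finset.sum_nonneg fun v hv => mul_nonneg (by linarith [hκ.nonneg v hv])
    (div_nonneg (mul_self_nonneg _) (sq_nonneg _))

/-- Cauchy-Schwarz for the metric `1 - x xᵀ`, in a form with a weight `θ`. -/
lemma two_mul_fderiv_le_gammaForm (hκ : IsMultiplicity R κ) (f : Euc d → ℝ) {x : Euc d}
    (hx : x ∈ ball (0 : Euc d) 1) (y : Euc d) (a : ℝ) {θ : ℝ} (hθ : 0 < θ) :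
    2 * a * fderiv ℝ f x (y - (inner ℝ x y : ℝ) • x) ≤
      θ * gammaForm R κ f f x + θ⁻¹ * (a ^ 2 * (‖y‖ ^ 2 - inner ℝ x y ^ 2)) := by
  have h0 := difference_part_nonneg hκ f x
  let g : Euc d := WithLp.toLp 2 fun i => fderiv ℝ f x (EuclideanSpace.single i 1)
  have hg : ∀ w, fderiv ℝ f x w = inner ℝ g w := fun w => by
    rw [clm_apply_eq_sum, inner_eq_sum]
    exact Finset.sum_congr rfl fun i _ => mul_comm _ _
  have hg2 : ∑ i, fderiv ℝ f x (EuclideanSpace.single i 1) *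
      fderiv ℝ f x (EuclideanSpace.single i 1) = ‖g‖ ^ 2 := by
    rw [← real_inner_self_eq_norm_sq, inner_eq_sum]
  -- In the ball, ‖w‖² - ⟨w,x⟩² is a nonnegative quadratic form. Evaluated at w = θ∇f - a y and
  -- divided by θ, it gives the inequality.
  have h1 := sq_inner_le_of_mem_ball hx (θ • g - a • y)
  have h2 : ∑ i, (θ • g - a • y) i ^ 2 = θ ^ 2 * ‖g‖ ^ 2 - 2 * θ * a * inner ℝ g y +
      a ^ 2 * ‖y‖ ^ 2 := by
    have : ∑ i, (θ • g - a • y) i ^ 2 = inner ℝ (θ • g - a • y) (θ • g - a • y) := by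
      rw [inner_eq_sum]
      exact Finset.sum_congr rfl fun i _ => sq _
    rw [this]
    simp only [inner_sub_left, inner_sub_right, inner_smul_left, inner_smul_right,
      real_inner_self_eq_norm_sq, real_inner_comm g y]
    simp
    ring
  rw [h2, inner_sub_left, inner_smul_left, inner_smul_left, real_inner_comm x y] at h1
  simp only [conj_trivial] at h1
  have h3 : θ * (2 * a * fderiv ℝ f x (y - (inner ℝ x y : ℝ) • x)) ≤
      θ * (θ * gammaForm R κ f f x + θ⁻¹ * (a ^ 2 * (‖y‖ ^ 2 - inner ℝ x y ^ 2))) := by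
    rw [mul_add, mul_inv_cancel_left₀ hθ.ne', gammaForm, hg2, hg x, hg, inner_sub_right,
      inner_smul_right]
    nlinarith [mul_nonneg (sq_nonneg θ) h0]
  exact le_of_mul_le_mul_left h3 hθ

lemma gammaForm_self_nonneg (hκ : IsMultiplicity R κ) (f : Euc d → ℝ) {x : Euc d}
    (hx : x ∈ ball (0 : Euc d) 1) : 0 ≤ gammaForm R κ f f x := by
  have := two_mul_fderiv_le_gammaForm (R := R) hκ f hx 0 0 one_pos
  simpa using this

lemma gammaForm_comm (f h : Euc d → ℝ) (x : Euc d) : gammaForm R κ f h x = gammaForm R κ h f x := by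
  rw [gammaForm, gammaForm, mul_comm (fderiv ℝ f x x)]
  congr 1
  · congr 1
    exact Finset.sum_congr rfl fun i _ => mul_comm _ _
  · exact Finset.sum_congr rfl fun v _ => by ring

lemma gammaForm_sub_self {f h : Euc d → ℝ} (hf : IsTame f) (hh : IsTame h) {x : Euc d}
    (hx : x ∈ ball (0 : Euc d) 1) :
    gammaForm R κ (fun x => f x - h x) (fun x => f x - h x) x =
      gammaForm R κ f f x - 2 * gammaForm R κ f h x + gammaForm R κ h h x := by
  simp only [gammaForm]
  rw [fderiv_fun_sub (hf.differentiableAt hx) (hh.differentiableAt hx)]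
  simp only [sub_apply, mul_sub, mul_add, Finset.mul_sum]
  have e1 : ∀ a b : Fin d → ℝ, ∑ i, ((a i - b i) * a i - (a i - b i) * b i) =
      ∑ i, a i * a i - ∑ i, 2 * (a i * b i) + ∑ i, b i * b i := fun a b => by
    rw [← Finset.sum_sub_distrib, ← Finset.sum_add_distrib]
    exact Finset.sum_congr rfl fun i _ => by ring
  rw [e1]
  have e2 : ∑ v ∈ R, κ v / 2 * (((f x - h x - (f (refl v x) - h (refl v x))) * (f x - h x) -
      (f x - h x - (f (refl v x) - h (refl v x))) * (f (refl v x) - h (refl v x))) /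
        inner ℝ x v ^ 2) =
      ∑ v ∈ R, κ v / 2 * (((f x - f (refl v x)) * f x - (f x - f (refl v x)) * f (refl v x)) /
        inner ℝ x v ^ 2) -
      ∑ v ∈ R, 2 * (κ v / 2 * (((f x - f (refl v x)) * h x -
        (f x - f (refl v x)) * h (refl v x)) / inner ℝ x v ^ 2)) +
      ∑ v ∈ R, κ v / 2 * (((h x - h (refl v x)) * h x - (h x - h (refl v x)) * h (refl v x)) /
        inner ℝ x v ^ 2) := by
    rw [← Finset.sum_sub_distrib, ← Finset.sum_add_distrib]
    exact Finset.sum_congr rfl fun i _ => by ring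
  simp only [mul_sub] at e2 ⊢
  rw [e2]
  ring

lemma dirD_sum {ι : Type*} (s : Finset ι) (w : Euc d) (p : ι → MvPolynomial (Fin d) ℝ) :
    dirD w (∑ i ∈ s, p i) = ∑ i ∈ s, dirD w (p i) := by
  simp only [dirD, map_sum, Finset.mul_sum]
  exact Finset.sum_comm

lemma gammaForm_polyFun_sum {ι : Type*} (s : Finset ι) (f : Euc d → ℝ)
    (p : ι → MvPolynomial (Fin d) ℝ) (x : Euc d) :
    gammaForm R κ f (polyFun (∑ i ∈ s, p i)) x = ∑ i ∈ s, gammaForm R κ f (polyFun (p i)) x := by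
  simp only [gammaForm, fderiv_polyFun, dirD_sum, polyFun_sum, Finset.mul_sum,
    Finset.sum_add_distrib, Finset.sum_sub_distrib]
  rw [Finset.sum_comm]
  congr 1
  rw [Finset.sum_comm]
  refine Finset.sum_congr rfl fun j _ => ?_
  rw [← Finset.sum_sub_distrib, Finset.mul_sum, Finset.sum_div, Finset.mul_sum]

lemma IsTame.memLp [IsFiniteMeasure (weightMeasure Rp κ μ)] {f : Euc d → ℝ} (hf : IsTame f) :
    MemLp f 2 (weightMeasure Rp κ μ) := by
  obtain ⟨L, hL0, hL, -, -⟩ := hf.exists_bound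
  refine MemLp.of_bound (hf.aestronglyMeasurable.mono_ac weightMeasure_absolutelyContinuous) L ?_
  exact weightMeasure_absolutelyContinuous.ae_le
    ((ae_restrict_mem measurableSet_ball).mono fun x hx => hL x hx)

lemma integrable_mul_tame [IsFiniteMeasure (weightMeasure Rp κ μ)] {f h : Euc d → ℝ}
    (hf : IsTame f) (hh : IsTame h) : Integrable (fun x => f x * h x) (weightMeasure Rp κ μ) :=
  hf.memLp.integrable_mul hh.memLp

lemma IsEigenpoly.ae_eq (hR : IsRootSystem R) (hRp : IsPositiveSubsystem R Rp) {n : ℕ}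
    {p : MvPolynomial (Fin d) ℝ} (hp : IsEigenpoly Rp κ μ n p) :
    ∀ᵐ x ∂weightMeasure Rp κ μ, ballLaplacian Rp κ μ (polyFun p) x =
      -((n : ℝ) * (n + 2 * lam Rp κ μ)) * polyFun p x :=
  (ae_weightMeasure hR).mono fun x hx => hp x hx.1 ((hRp.mem_regularSet hR).1 hx.2)

lemma IsEigenpoly.integral_gammaForm (hd : 1 ≤ d) (hμ : 0 ≤ μ) (hR : IsRootSystem R)
    (hRp : IsPositiveSubsystem R Rp) (hκ : IsMultiplicity R κ) {n : ℕ}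
    {p : MvPolynomial (Fin d) ℝ} (hp : IsEigenpoly Rp κ μ n p) {f : Euc d → ℝ} (hf : IsTame f) :
    ∫ x, gammaForm R κ f (polyFun p) x ∂weightMeasure Rp κ μ =
      (n : ℝ) * (n + 2 * lam Rp κ μ) * ∫ x, f x * polyFun p x ∂weightMeasure Rp κ μ := by
  have := isFiniteMeasure_weightMeasure hd hμ hR hRp hκ
  have h := integral_gammaForm_add_mul_ballLaplacian hd hμ hR hRp hκ hf p
  have e : ∫ x, (gammaForm R κ f (polyFun p) x + f x * ballLaplacian Rp κ μ (polyFun p) x)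
      ∂weightMeasure Rp κ μ = ∫ x, (gammaForm R κ f (polyFun p) x -
        (n : ℝ) * (n + 2 * lam Rp κ μ) * (f x * polyFun p x)) ∂weightMeasure Rp κ μ := by
    refine integral_congr_ae ((hp.ae_eq hR hRp).mono fun x hx => ?_)
    simp only [hx]
    ring
  rw [e, integral_sub (integrable_gammaForm hR hκ hf (isTame_polyFun p))
    ((integrable_mul_tame hf (isTame_polyFun p)).const_mul _), integral_const_mul] at h
  linarith

/-- Both sides are minus the integral of the symmetric form Γ(p, q). -/
lemma integral_mul_ballLaplacian_comm (hd : 1 ≤ d) (hμ : 0 ≤ μ) (hR : IsRootSystem R)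
    (hRp : IsPositiveSubsystem R Rp) (hκ : IsMultiplicity R κ) {p q p' q' : MvPolynomial (Fin d) ℝ}
    (hp : ∀ x ∈ regularSet R, ballLaplacian Rp κ μ (polyFun p) x = polyFun p' x)
    (hq : ∀ x ∈ regularSet R, ballLaplacian Rp κ μ (polyFun q) x = polyFun q' x) :
    ∫ x, polyFun p' x * polyFun q x ∂weightMeasure Rp κ μ =
      ∫ x, polyFun p x * polyFun q' x ∂weightMeasure Rp κ μ := by
  have := isFiniteMeasure_weightMeasure hd hμ hR hRp hκ
  have key : ∀ p q q' : MvPolynomial (Fin d) ℝ,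
      (∀ x ∈ regularSet R, ballLaplacian Rp κ μ (polyFun q) x = polyFun q' x) →
      ∫ x, polyFun p x * polyFun q' x ∂weightMeasure Rp κ μ =
        -∫ x, gammaForm R κ (polyFun p) (polyFun q) x ∂weightMeasure Rp κ μ := by
    intro p q q' hq
    have h := integral_gammaForm_add_mul_ballLaplacian hd hμ hR hRp hκ (isTame_polyFun p) q
    have e : ∫ x, (gammaForm R κ (polyFun p) (polyFun q) x +
        polyFun p x * ballLaplacian Rp κ μ (polyFun q) x) ∂weightMeasure Rp κ μ =
        ∫ x, (gammaForm R κ (polyFun p) (polyFun q) x + polyFun p x * polyFun q' x)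
          ∂weightMeasure Rp κ μ := by
      refine integral_congr_ae ((ae_weightMeasure hR).mono fun x hx => ?_)
      simp only [hq x hx.2]
    rw [e, integral_add (integrable_gammaForm hR hκ (isTame_polyFun p) (isTame_polyFun q))
      (integrable_mul_tame (isTame_polyFun p) (isTame_polyFun q'))] at h
    linarith
  rw [key p q q' hq]
  simp only [mul_comm (polyFun p' _)]
  rw [key q p p' hp]
  simp only [gammaForm_comm (polyFun q)]

end EnergyIdentities

/-! ### A local uncertainty inequality -/

section LocalUncertainty

open Metric Set Filter Topology

variable {d : ℕ} {R Rp : Finset (Euc d)} {κ : Euc d → ℝ} {μ : ℝ}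

/-- A cutoff to the cap `1 - ⟨x, y⟩ ≤ ρ² / 2`. -/
noncomputable def capCutoff (y : Euc d) (ρ : ℝ) (x : Euc d) : ℝ :=
  cutoff (3 - 4 * (1 - inner ℝ x y) / ρ ^ 2)

lemma contDiff_capCutoff (y : Euc d) (ρ : ℝ) : ContDiff ℝ 1 (capCutoff y ρ) := by
  refine contDiff_cutoff.comp ?_
  have : ContDiff ℝ 1 fun x : Euc d => (inner ℝ x y : ℝ) := contDiff_id.inner ℝ contDiff_const
  fun_prop

lemma capCutoff_eq_zero {y : Euc d} {ρ : ℝ} (hρ : 0 < ρ) {x : Euc d}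
    (h : ρ ^ 2 / 2 ≤ 1 - inner ℝ x y) : capCutoff y ρ x = 0 := by
  refine cutoff_eq_zero ?_
  have : 2 ≤ 4 * (1 - inner ℝ x y) / ρ ^ 2 := by
    rw [le_div_iff₀ (by positivity)]
    linarith
  linarith

lemma capCutoff_eq_one {y : Euc d} {ρ : ℝ} (hρ : 0 < ρ) {x : Euc d}
    (h : 1 - inner ℝ x y ≤ ρ ^ 2 / 4) : capCutoff y ρ x = 1 := by
  refine cutoff_eq_one ?_
  have : 4 * (1 - inner ℝ x y) / ρ ^ 2 ≤ 1 := by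
    rw [div_le_iff₀ (by positivity)]
    linarith
  linarith

lemma fderiv_capCutoff (y : Euc d) (ρ : ℝ) (x w : Euc d) :
    fderiv ℝ (capCutoff y ρ) x w =
      deriv cutoff (3 - 4 * (1 - inner ℝ x y) / ρ ^ 2) * (4 / ρ ^ 2) * inner ℝ w y := by
  have h1 : HasFDerivAt (fun x : Euc d => (inner ℝ x y : ℝ)) (innerSL ℝ y) x := by
    have : (fun x : Euc d => (inner ℝ x y : ℝ)) = innerSL ℝ y := by
      ext z; simp [real_inner_comm]
    rw [this]
    exact (innerSL ℝ y).hasFDerivAt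
  have h2 : HasFDerivAt (fun x : Euc d => 3 - 4 * (1 - inner ℝ x y) / ρ ^ 2)
      ((4 / ρ ^ 2) • innerSL ℝ y) x := by
    refine (((h1.const_sub 1).const_mul (4 / ρ ^ 2)).const_sub 3 |>.congr_of_eventuallyEq ?_
      |>.congr_fderiv ?_)
    · exact Filter.Eventually.of_forall fun x => by ring
    · simp
  have h3 : HasFDerivAt (capCutoff y ρ) _ x := HasDerivAt.comp_hasFDerivAt (h₂ := cutoff) x
    ((contDiff_cutoff.differentiable (by norm_num)) _).hasDerivAt h2
  rw [h3.fderiv]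
  simp [real_inner_comm]
  ring

lemma norm_sub_sq_le {x y : Euc d} (hx : x ∈ ball (0 : Euc d) 1) (hy : ‖y‖ = 1) :
    ‖x - y‖ ^ 2 ≤ 2 * (1 - inner ℝ x y) := by
  rw [mem_ball_zero_iff] at hx
  rw [norm_sub_sq_real, hy]
  nlinarith [norm_nonneg x]

lemma abs_inner_le_one {x y : Euc d} (hx : x ∈ ball (0 : Euc d) 1) (hy : ‖y‖ = 1) :
    |inner ℝ x y| ≤ 1 := by
  rw [mem_ball_zero_iff] at hx
  have := abs_real_inner_le_norm x y
  rw [hy, mul_one] at this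
  linarith

/-- Inside the cap the linear forms `⟨·, v⟩` are comparable to their value at the center. -/
lemma root_comparison (hR : IsRootSystem R) {y : Euc d} (hy : ‖y‖ = 1) {ρ K : ℝ} (hρ : 0 < ρ)
    (hK : 4 ≤ K) (hyR : ∀ v ∈ R, inner ℝ y v = (0 : ℝ) ∨ K * ρ ≤ |inner ℝ y v|) {x : Euc d}
    (hx : x ∈ ball (0 : Euc d) 1) (hxy : 1 - inner ℝ x y < ρ ^ 2 / 2) {v : Euc d} (hv : v ∈ R) :
    |inner ℝ y v| ≤ 2 * |inner ℝ x v| ∧ inner ℝ y v / inner ℝ x v ≤ 1 + 4 / K := by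
  rcases hyR v hv with h0 | h
  · rw [h0]
    simp
    positivity
  · have h1 : ‖x - y‖ ≤ ρ := by
      have := norm_sub_sq_le hx hy
      exact le_of_sq_le_sq (by linarith) hρ.le
    have h2 : |(inner ℝ x v : ℝ) - inner ℝ y v| ≤ 2 * ρ := by
      rw [← inner_sub_left]
      refine (abs_real_inner_le_norm _ _).trans ?_
      rw [hR.norm_root hv]
      have h3 : √2 ≤ 2 := by
        rw [Real.sqrt_le_left (by norm_num)]; norm_num
      nlinarith [norm_nonneg (x - y), Real.sqrt_nonneg 2]
    set t : ℝ := inner ℝ x v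
    set b : ℝ := inner ℝ y v
    have hb : 0 < |b| := lt_of_lt_of_le (by positivity) h
    have h4 : |b| ≤ |t| + 2 * ρ := by
      have := abs_sub_abs_le_abs_sub b t
      rw [abs_sub_comm b t] at this
      linarith
    have h5 : 4 * ρ ≤ |b| := (mul_le_mul_of_nonneg_right hK hρ.le).trans h
    refine ⟨by linarith, ?_⟩
    have ht : 0 < |t| := by linarith
    calc b / t ≤ |b / t| := le_abs_self _
      _ = |b| / |t| := abs_div _ _
      _ ≤ 1 + 4 / K := by
        rw [div_le_iff₀ ht]
        -- From Kρ ≤ |b| and |b| ≤ 2|t|, where b is the value at the center and t the value at x.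
        have h6 : 2 * ρ ≤ 4 / K * |t| := by
          rw [div_mul_eq_mul_div, le_div_iff₀ (by linarith)]
          nlinarith
        linarith

/-- The constant vector field `y` cut off to a cap around `y`. -/
noncomputable def capField (y : Euc d) (ρ : ℝ) (i : Fin d) (x : Euc d) : ℝ := capCutoff y ρ x * y i

lemma contDiff_capField (y : Euc d) (ρ : ℝ) (i : Fin d) : ContDiff ℝ 1 (capField y ρ i) :=
  (contDiff_capCutoff y ρ).mul contDiff_const

lemma vf_capField (y : Euc d) (ρ : ℝ) (x : Euc d) : vf (capField y ρ) x = capCutoff y ρ x • y := by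
  ext i; simp [capField]

lemma tvf_capField (y : Euc d) (ρ : ℝ) (x : Euc d) :
    tvf (capField y ρ) x = capCutoff y ρ x • (y - (inner ℝ x y : ℝ) • x) := by
  rw [tvf, vf_capField, inner_smul_right]
  module

lemma capCutoff_nonneg (y : Euc d) (ρ : ℝ) (x : Euc d) : 0 ≤ capCutoff y ρ x := cutoff_nonneg _

lemma capCutoff_le_one (y : Euc d) (ρ : ℝ) (x : Euc d) : capCutoff y ρ x ≤ 1 := cutoff_le_one _

lemma abs_inner_capField_le (hR : IsRootSystem R) {y : Euc d} (hy : ‖y‖ = 1) {ρ K : ℝ} (hρ : 0 < ρ)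
    (hK : 4 ≤ K) (hyR : ∀ v ∈ R, inner ℝ y v = (0 : ℝ) ∨ K * ρ ≤ |inner ℝ y v|) {v : Euc d}
    (hv : v ∈ R) {x : Euc d} (hx : x ∈ ball (0 : Euc d) 1) :
    |inner ℝ v (vf (capField y ρ) x)| ≤ 2 * |inner ℝ x v| := by
  rw [vf_capField, inner_smul_right, abs_mul, abs_of_nonneg (capCutoff_nonneg y ρ x)]
  rcases le_or_gt (ρ ^ 2 / 2) (1 - inner ℝ x y) with h | h
  · rw [capCutoff_eq_zero hρ h]; simp
  · rw [real_inner_comm]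
    have := (root_comparison hR hy hρ hK hyR hx h hv).1
    nlinarith [capCutoff_nonneg y ρ x, capCutoff_le_one y ρ x, abs_nonneg (inner ℝ y v : ℝ)]

/-- The weighted divergence of `tvf Z`. -/
noncomputable def wdiv (R : Finset (Euc d)) (κ : Euc d → ℝ) (μ : ℝ) (Z : Fin d → Euc d → ℝ)
    (x : Euc d) : ℝ :=
  bdiv μ Z x + ∑ v ∈ R, κ v * (inner ℝ v (vf Z x) / inner ℝ x v - inner ℝ x (vf Z x))

lemma fderiv_capField (y : Euc d) (ρ : ℝ) (i : Fin d) (x w : Euc d) :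
    fderiv ℝ (capField y ρ i) x w =
      deriv cutoff (3 - 4 * (1 - inner ℝ x y) / ρ ^ 2) * (4 / ρ ^ 2) * inner ℝ w y * y i := by
  have h1 := ((contDiff_capCutoff y ρ).differentiable one_ne_zero x).hasFDerivAt.mul_const (y i)
  have h2 : HasFDerivAt (capField y ρ i) _ x := h1
  rw [h2.fderiv]
  simp only [smul_apply, fderiv_capCutoff, smul_eq_mul]
  ring

/-- The two contributions of the roots are kept apart: +κ_v⟨x,y⟩ comes from the projection to the
tangent directions, and -κ_v⟨y,v⟩/⟨x,v⟩ from the derivative of the weight. They have to compensate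
each other near y. -/
lemma wdiv_capField {y : Euc d} (hy : ‖y‖ = 1) (ρ : ℝ) (x : Euc d) :
    -wdiv R κ μ (capField y ρ) x =
      -(deriv cutoff (3 - 4 * (1 - inner ℝ x y) / ρ ^ 2) * (4 / ρ ^ 2) * (1 - inner ℝ x y ^ 2)) +
      capCutoff y ρ x * ((d + 2 * μ + ∑ v ∈ R, κ v) * inner ℝ x y -
        ∑ v ∈ R, κ v * (inner ℝ y v / inner ℝ x v)) := by
  set c : ℝ := inner ℝ x y with hcdef
  set D := deriv cutoff (3 - 4 * (1 - c) / ρ ^ 2) with hD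
  have e1 : ∑ i, fderiv ℝ (capField y ρ i) x (EuclideanSpace.single i 1) = D * (4 / ρ ^ 2) := by
    simp only [fderiv_capField]
    have : ∑ i, y i * y i = 1 := by
      rw [← inner_eq_sum, real_inner_self_eq_norm_sq, hy]; norm_num
    calc _ = D * (4 / ρ ^ 2) * ∑ i, y i * y i := by
          rw [Finset.mul_sum]
          refine Finset.sum_congr rfl fun i _ => ?_
          rw [EuclideanSpace.inner_single_left]
          simp
          ring
      _ = _ := by rw [this, mul_one]
  have e2 : ∑ i, x i * fderiv ℝ (capField y ρ i) x x = D * (4 / ρ ^ 2) * c ^ 2 := by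
    simp only [fderiv_capField]
    calc _ = D * (4 / ρ ^ 2) * c * ∑ i, x i * y i := by
          rw [Finset.mul_sum]
          exact Finset.sum_congr rfl fun i _ => by ring
      _ = _ := by rw [← inner_eq_sum]; ring
  rw [wdiv, bdiv, e1, e2]
  simp only [vf_capField, inner_smul_right]
  rw [← hcdef]
  have : ∑ v ∈ R, κ v * (capCutoff y ρ x * inner ℝ v y / inner ℝ x v - capCutoff y ρ x * c) =
      capCutoff y ρ x * (∑ v ∈ R, κ v * (inner ℝ y v / inner ℝ x v) - (∑ v ∈ R, κ v) * c) := by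
    rw [Finset.sum_mul, ← Finset.sum_sub_distrib, Finset.mul_sum]
    refine Finset.sum_congr rfl fun v _ => ?_
    rw [real_inner_comm]
    ring
  rw [this]
  ring

/-- Where the cutoff equals 1, the field contracts towards y. Elsewhere 1 - ⟨x,y⟩ is at least ρ²/4,
so the term of order (1 - ⟨x,y⟩)/ρ² pays for the missing contraction and for the derivative of the
cutoff. -/
lemma le_neg_wdiv_capField (hd : 1 ≤ d) (hμ : 0 ≤ μ) (hR : IsRootSystem R)
    (hκ : IsMultiplicity R κ) {C₁ : ℝ} (hC₁0 : 0 ≤ C₁) (hC₁ : ∀ τ, |deriv cutoff τ| ≤ C₁)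
    {y : Euc d} (hy : ‖y‖ = 1) {ρ K : ℝ} (hρ : 0 < ρ)
    (hK : 16 * ∑ v ∈ R, κ v + 4 ≤ K) (hρ' : (d + 2 * μ + ∑ v ∈ R, κ v) * ρ ^ 2 ≤ 1 / 2)
    (hyR : ∀ v ∈ R, inner ℝ y v = (0 : ℝ) ∨ K * ρ ≤ |inner ℝ y v|) {x : Euc d}
    (hx : x ∈ ball (0 : Euc d) 1) :
    1 / 2 - (8 * C₁ + 2) / ρ ^ 2 * (1 - inner ℝ x y) ≤ -wdiv R κ μ (capField y ρ) x := by
  have hk : 0 ≤ ∑ v ∈ R, κ v := Finset.sum_nonneg hκ.nonneg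
  have hK4 : 4 ≤ K := by linarith
  have hc := abs_inner_le_one hx hy
  have hDC := hC₁ (3 - 4 * (1 - inner ℝ x y) / ρ ^ 2)
  rw [wdiv_capField hy]
  set k := ∑ v ∈ R, κ v with hkdef
  set c : ℝ := inner ℝ x y with hcdef
  set D := deriv cutoff (3 - 4 * (1 - c) / ρ ^ 2) with hD
  rw [abs_le] at hc hDC
  have hρ2 : 0 < ρ ^ 2 := by positivity
  have f1 : D * (4 / ρ ^ 2) * (1 - c ^ 2) ≤ 8 * C₁ / ρ ^ 2 * (1 - c) := by
    have g1 : 1 - c ^ 2 ≤ 2 * (1 - c) := by nlinarith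
    have g2 : 0 ≤ 1 - c ^ 2 := by nlinarith
    calc D * (4 / ρ ^ 2) * (1 - c ^ 2) ≤ C₁ * (4 / ρ ^ 2) * (2 * (1 - c)) := by
          refine mul_le_mul (mul_le_mul_of_nonneg_right hDC.2 (by positivity)) g1 g2 (by positivity)
      _ = _ := by ring
  have f2 : 1 / 2 - 2 / ρ ^ 2 * (1 - c) ≤ capCutoff y ρ x *
      ((d + 2 * μ + k) * c - ∑ v ∈ R, κ v * (inner ℝ y v / inner ℝ x v)) := by
    rcases le_or_gt (ρ ^ 2 / 2) (1 - c) with h | h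
    · rw [capCutoff_eq_zero hρ h, zero_mul]
      have : 1 ≤ 2 / ρ ^ 2 * (1 - c) := by
        rw [div_mul_eq_mul_div, le_div_iff₀ hρ2]
        linarith
      linarith
    -- With k = ∑ κ_v, the value is at least (d + 2μ + k)(1 - ρ²/2) - k(1 + 4/K). The k's cancel,
    -- the errors (d + 2μ + k)ρ²/2 and 4k/K are at most 1/4 each, and d ≥ 1 leaves 1/2.
    · have g1 : 1 / 2 ≤ (d + 2 * μ + k) * c - ∑ v ∈ R, κ v * (inner ℝ y v / inner ℝ x v) := by
        have g2 : ∑ v ∈ R, κ v * (inner ℝ y v / inner ℝ x v) ≤ k * (1 + 4 / K) := by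
          rw [hkdef, Finset.sum_mul]
          exact Finset.sum_le_sum fun v hv => mul_le_mul_of_nonneg_left
            (root_comparison hR hy hρ hK4 hyR hx h hv).2 (hκ.nonneg v hv)
        have g3 : k * (4 / K) ≤ 1 / 4 := by
          rw [mul_div_assoc', div_le_iff₀ (by linarith)]
          linarith
        have g4 : (1 : ℝ) ≤ d := by exact_mod_cast hd
        have g5 : (d + 2 * μ + k) * (1 - ρ ^ 2 / 2) ≤ (d + 2 * μ + k) * c :=
          mul_le_mul_of_nonneg_left (by linarith) (by linarith)
        linarith
      rcases le_or_gt (1 - c) (ρ ^ 2 / 4) with h' | h'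
      · rw [capCutoff_eq_one hρ h', one_mul]
        have : 0 ≤ 2 / ρ ^ 2 * (1 - c) := mul_nonneg (by positivity) (by linarith)
        linarith
      · have : 1 / 2 ≤ 2 / ρ ^ 2 * (1 - c) := by
          rw [div_mul_eq_mul_div, le_div_iff₀ hρ2]
          linarith
        have := mul_nonneg (capCutoff_nonneg y ρ x) ((by norm_num : (0:ℝ) ≤ 1 / 2).trans g1)
        linarith
  have f3 : (8 * C₁ + 2) / ρ ^ 2 * (1 - c) = 8 * C₁ / ρ ^ 2 * (1 - c) + 2 / ρ ^ 2 * (1 - c) := by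
    ring
  rw [f3]
  linarith

/-- The right side is minus the full divergence of q² times the cap field, which integrates to zero.
The divergence of the field is bounded by `le_neg_wdiv_capField`, and the derivative of q² by
Cauchy-Schwarz for Γ. -/
lemma local_uncertainty_pointwise (hd : 1 ≤ d) (hμ : 0 ≤ μ) (hR : IsRootSystem R)
    (hκ : IsMultiplicity R κ) {C₁ : ℝ} (hC₁0 : 0 ≤ C₁) (hC₁ : ∀ τ, |deriv cutoff τ| ≤ C₁)
    {y : Euc d} (hy : ‖y‖ = 1) {ρ K θ : ℝ} (hρ : 0 < ρ) (hθ : 0 < θ)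
    (hK : 16 * ∑ v ∈ R, κ v + 4 ≤ K) (hρ' : (d + 2 * μ + ∑ v ∈ R, κ v) * ρ ^ 2 ≤ 1 / 2)
    (hyR : ∀ v ∈ R, inner ℝ y v = (0 : ℝ) ∨ K * ρ ≤ |inner ℝ y v|) (q : MvPolynomial (Fin d) ℝ)
    {x : Euc d} (hx : x ∈ ball (0 : Euc d) 1) :
    1 / 2 * polyFun q x ^ 2 - (8 * C₁ + 2) / ρ ^ 2 * ((1 - inner ℝ x y) * polyFun q x ^ 2) -
        (θ * gammaForm R κ (polyFun q) (polyFun q) x +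
          2 * θ⁻¹ * ((1 - inner ℝ x y) * polyFun q x ^ 2)) ≤
      -(fderiv ℝ (polyFun (q * q)) x (tvf (capField y ρ) x) +
        polyFun (q * q) x * wdiv R κ μ (capField y ρ) x) := by
  have h1 := mul_le_mul_of_nonneg_right
    (le_neg_wdiv_capField hd hμ hR hκ hC₁0 hC₁ hy hρ hK hρ' hyR hx) (sq_nonneg (polyFun q x))
  have h2 := two_mul_fderiv_le_gammaForm (R := R) hκ (polyFun q) hx y
    (capCutoff y ρ x * polyFun q x) hθ
  have h3 : fderiv ℝ (polyFun (q * q)) x (tvf (capField y ρ) x) =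
      2 * (capCutoff y ρ x * polyFun q x) *
        fderiv ℝ (polyFun q) x (y - (inner ℝ x y : ℝ) • x) := by
    have a1 := (differentiable_polyFun q x).hasFDerivAt
    have a2 : HasFDerivAt (polyFun (q * q)) (polyFun q x • fderiv ℝ (polyFun q) x +
        polyFun q x • fderiv ℝ (polyFun q) x) x := by
      have e : polyFun (q * q) = fun x => polyFun q x * polyFun q x := by ext x; simp
      rw [e]
      exact a1.mul a1
    rw [a2.fderiv, tvf_capField]
    simp only [add_apply, smul_apply, map_smul, smul_eq_mul]
    ring
  -- The squared length of the field is at most 1 - ⟨x,y⟩² ≤ 2(1 - ⟨x,y⟩), so it is controlled by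
  -- the density of A(y).
  have h4 : θ⁻¹ * ((capCutoff y ρ x * polyFun q x) ^ 2 * (‖y‖ ^ 2 - inner ℝ x y ^ 2)) ≤
      2 * θ⁻¹ * ((1 - inner ℝ x y) * polyFun q x ^ 2) := by
    have hc := abs_inner_le_one hx hy
    rw [abs_le] at hc
    rw [mul_comm 2 θ⁻¹, mul_assoc]
    refine mul_le_mul_of_nonneg_left ?_ (by positivity)
    rw [hy, mul_pow]
    have g1 : 1 ^ 2 - (inner ℝ x y : ℝ) ^ 2 ≤ 2 * (1 - inner ℝ x y) := by nlinarith
    have g2 : 0 ≤ 1 ^ 2 - (inner ℝ x y : ℝ) ^ 2 := by nlinarith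
    have g3 : capCutoff y ρ x ^ 2 ≤ 1 :=
      pow_le_one₀ (capCutoff_nonneg y ρ x) (capCutoff_le_one y ρ x)
    calc _ ≤ 1 * polyFun q x ^ 2 * (2 * (1 - inner ℝ x y)) :=
          mul_le_mul (mul_le_mul_of_nonneg_right g3 (sq_nonneg _)) g1 g2 (by positivity)
      _ = _ := by ring
  have h5 : polyFun (q * q) x = polyFun q x ^ 2 := by simp [sq]
  rw [h3, h5]
  generalize wdiv R κ μ (capField y ρ) x = w at *
  have h6 : 1 / 2 * polyFun q x ^ 2 -
      (8 * C₁ + 2) / ρ ^ 2 * ((1 - inner ℝ x y) * polyFun q x ^ 2) ≤ -(polyFun q x ^ 2 * w) := by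
    calc _ = (1 / 2 - (8 * C₁ + 2) / ρ ^ 2 * (1 - inner ℝ x y)) * polyFun q x ^ 2 := by ring
      _ ≤ -w * polyFun q x ^ 2 := h1
      _ = _ := by ring
  linarith

lemma integrable_one_sub_inner_mul_sq [IsFiniteMeasure (weightMeasure Rp κ μ)] (y : Euc d)
    (q : MvPolynomial (Fin d) ℝ) :
    Integrable (fun x => (1 - inner ℝ x y) * polyFun q x ^ 2) (weightMeasure Rp κ μ) := by
  have hc : Continuous fun x : Euc d => (1 - inner ℝ x y) * polyFun q x ^ 2 := by
    have := continuous_polyFun q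
    fun_prop
  obtain ⟨C, -, hC⟩ := exists_bound_ball hc
  exact integrable_of_bound hc.aestronglyMeasurable hC

/-- Uncertainty inequality for polynomials, localized near a point of the sphere that lies on or
away from each reflecting hyperplane, relative to the scale `ρ`. -/
lemma exists_local_uncertainty (hd : 1 ≤ d) (hμ : 0 ≤ μ) (hR : IsRootSystem R)
    (hRp : IsPositiveSubsystem R Rp) (hκ : IsMultiplicity R κ) :
    ∃ C : ℝ, 0 < C ∧ ∀ (y : Euc d) (ρ K θ : ℝ), ‖y‖ = 1 → 0 < ρ → 0 < θ →
      16 * ∑ v ∈ R, κ v + 4 ≤ K → (d + 2 * μ + ∑ v ∈ R, κ v) * ρ ^ 2 ≤ 1 / 2 →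
      (∀ v ∈ R, inner ℝ y v = (0 : ℝ) ∨ K * ρ ≤ |inner ℝ y v|) →
      ∀ q : MvPolynomial (Fin d) ℝ,
        1 / 2 * ∫ x, polyFun q x ^ 2 ∂weightMeasure Rp κ μ -
          C / ρ ^ 2 * ∫ x, (1 - inner ℝ x y) * polyFun q x ^ 2 ∂weightMeasure Rp κ μ ≤
        θ * ∫ x, gammaForm R κ (polyFun q) (polyFun q) x ∂weightMeasure Rp κ μ +
          2 * θ⁻¹ * ∫ x, (1 - inner ℝ x y) * polyFun q x ^ 2 ∂weightMeasure Rp κ μ := by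
  have := isFiniteMeasure_weightMeasure hd hμ hR hRp hκ
  obtain ⟨C₁, hC₁0, hC₁⟩ := exists_deriv_cutoff_bound
  refine ⟨8 * C₁ + 2, by positivity, fun y ρ K θ hy hρ hθ hK hρ' hyR q => ?_⟩
  have hk : 0 ≤ ∑ v ∈ R, κ v := Finset.sum_nonneg hκ.nonneg
  have key := integral_divergence hd hμ hR hRp hκ (contDiff_capField y ρ) zero_le_two
    (fun v hv x hx => abs_inner_capField_le hR hy hρ (by linarith) hyR hv hx)
    (isTame_polyFun (q * q))
  have i1 : Integrable (fun x => polyFun q x ^ 2) (weightMeasure Rp κ μ) :=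
    (isTame_polyFun q).memLp.integrable_sq
  have i2 := integrable_one_sub_inner_mul_sq (Rp := Rp) (κ := κ) (μ := μ) y q
  have i3 := integrable_gammaForm (Rp := Rp) (μ := μ) hR hκ (isTame_polyFun q) (isTame_polyFun q)
  have := integral_mono_ae (μ := weightMeasure Rp κ μ)
    (((i1.const_mul (1 / 2)).sub (i2.const_mul ((8 * C₁ + 2) / ρ ^ 2))).sub
      ((i3.const_mul θ).add (i2.const_mul (2 * θ⁻¹)))) key.1.neg
    ((ae_weightMeasure hR).mono fun x hx =>
      local_uncertainty_pointwise hd hμ hR hκ hC₁0 hC₁ hy hρ hθ hK hρ' hyR q hx.1)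
  simp only [Pi.sub_apply, Pi.add_apply, Pi.neg_apply] at this
  have j1 : Integrable (fun x => 1 / 2 * polyFun q x ^ 2 - (8 * C₁ + 2) / ρ ^ 2 *
    ((1 - inner ℝ x y) * polyFun q x ^ 2)) (weightMeasure Rp κ μ) :=
    (i1.const_mul _).sub (i2.const_mul _)
  have j2 : Integrable (fun x => θ * gammaForm R κ (polyFun q) (polyFun q) x + 2 * θ⁻¹ *
    ((1 - inner ℝ x y) * polyFun q x ^ 2)) (weightMeasure Rp κ μ) :=
    (i3.const_mul _).add (i2.const_mul _)
  rw [integral_neg, key.2, integral_sub j1 j2, integral_sub (i1.const_mul _) (i2.const_mul _),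
    integral_add (i3.const_mul _) (i2.const_mul _), integral_const_mul, integral_const_mul,
    integral_const_mul, integral_const_mul] at this
  linarith

end LocalUncertainty

end WeightedBall

namespace WeightedBall

/-! ### Filtrations of a Hilbert space by finite dimensional subspaces -/

section HilbertFiltration

open Filter Topology

variable {H : Type*} [NormedAddCommGroup H] [InnerProductSpace ℝ H] {K : ℕ → Submodule ℝ H}

lemma inner_eq_zero_of_mem_layers (hK : Monotone K) {m n : ℕ} (hmn : m ≠ n) {u w : H}
    (hu : u ∈ K (m + 1) ⊓ (K m)ᗮ) (hw : w ∈ K (n + 1) ⊓ (K n)ᗮ) : (inner ℝ u w : ℝ) = 0 := by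
  rcases lt_or_gt_of_ne hmn with h | h
  · exact (Submodule.mem_orthogonal _ _).1 hw.2 _ (hK h hu.1)
  · exact (Submodule.mem_orthogonal' _ _).1 hu.2 _ (hK h hw.1)

variable (K) [∀ n, (K n).HasOrthogonalProjection]

/-- The component of `h` in `K (n + 1) ⊖ K n`. -/
noncomputable def layer (n : ℕ) (h : H) : H :=
  (K (n + 1)).starProjection h - (K n).starProjection h

variable {K}

lemma inner_starProjection_of_mem {n : ℕ} {w : H} (hw : w ∈ K n) (h : H) :
    inner ℝ ((K n).starProjection h) w = (inner ℝ h w : ℝ) := by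
  have := (K n).sub_starProjection_mem_orthogonal h
  have h2 := (Submodule.mem_orthogonal' _ _).1 this w hw
  rw [inner_sub_left] at h2
  linarith

lemma layer_mem (hK : Monotone K) (n : ℕ) (h : H) : layer K n h ∈ K (n + 1) ⊓ (K n)ᗮ := by
  refine ⟨Submodule.sub_mem _ ((K (n + 1)).starProjection_apply_mem h)
    (hK n.le_succ ((K n).starProjection_apply_mem h)), ?_⟩
  refine (Submodule.mem_orthogonal' _ _).2 fun w hw => ?_
  rw [layer, inner_sub_left, inner_starProjection_of_mem hw,
    inner_starProjection_of_mem (hK n.le_succ hw), sub_self]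

lemma inner_layer {n : ℕ} (h : H) {w : H} (hw : w ∈ K (n + 1) ⊓ (K n)ᗮ) :
    inner ℝ (layer K n h) w = (inner ℝ h w : ℝ) := by
  rw [layer, inner_sub_left, inner_starProjection_of_mem hw.1,
    (Submodule.mem_orthogonal _ _).1 hw.2 _ ((K n).starProjection_apply_mem h), sub_zero]

lemma inner_layer_self (hK : Monotone K) (n : ℕ) (h : H) :
    (inner ℝ h (layer K n h) : ℝ) = ‖layer K n h‖ ^ 2 := by
  rw [← inner_layer h (layer_mem hK n h), real_inner_self_eq_norm_sq]

lemma sum_layer (hK0 : K 0 = ⊥) (N : ℕ) (h : H) :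
    ∑ n ∈ Finset.range N, layer K n h = (K N).starProjection h := by
  unfold layer
  rw [Finset.sum_range_sub (fun n => (K n).starProjection h)]
  have : (K 0).starProjection h = 0 := by
    have h1 := (K 0).starProjection_apply_mem h
    have h2 : (K 0).starProjection h ∈ (⊥ : Submodule ℝ H) := hK0 ▸ h1
    exact (Submodule.mem_bot ℝ).1 h2
  rw [this, sub_zero]

lemma norm_sq_sum_smul_layer (hK : Monotone K) (c : ℕ → ℝ) (N : ℕ) (h : H) :
    ‖∑ n ∈ Finset.range N, c n • layer K n h‖ ^ 2 =
      ∑ n ∈ Finset.range N, c n ^ 2 * ‖layer K n h‖ ^ 2 := by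
  rw [← real_inner_self_eq_norm_sq, sum_inner]
  refine Finset.sum_congr rfl fun n hn => ?_
  rw [inner_sum, Finset.sum_eq_single n]
  · rw [inner_smul_left, inner_smul_right, real_inner_self_eq_norm_sq]
    simp
    ring
  · intro m _ hm
    rw [inner_smul_left, inner_smul_right,
      inner_eq_zero_of_mem_layers hK hm.symm (layer_mem hK n h) (layer_mem hK m h)]
    simp
  · exact fun h => absurd hn h

lemma norm_sq_starProjection_eq (hK : Monotone K) (hK0 : K 0 = ⊥) (N : ℕ) (h : H) :
    ‖(K N).starProjection h‖ ^ 2 = ∑ n ∈ Finset.range N, ‖layer K n h‖ ^ 2 := by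
  have := norm_sq_sum_smul_layer hK (fun _ => 1) N h
  simp only [one_smul, one_pow, one_mul] at this
  rw [← sum_layer hK0, this]

lemma tendsto_inner_starProjection [CompleteSpace H] (hK : Monotone K)
    (hd : ⊤ ≤ (⨆ n, K n).topologicalClosure) (h w : H) :
    Tendsto (fun N => (inner ℝ ((K N).starProjection h) w : ℝ)) atTop (𝓝 (inner ℝ h w)) :=
  (Submodule.starProjection_tendsto_self K hK h hd).inner tendsto_const_nhds

/-- Functional calculus: existence of a vector with prescribed components. -/
lemma exists_of_sum_layer_le [CompleteSpace H] (hK : Monotone K) (hK0 : K 0 = ⊥)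
    (hd : ⊤ ≤ (⨆ n, K n).topologicalClosure) {ℓ : ℕ → ℝ} (hℓ : ∀ n, 0 ≤ ℓ n) {B : ℝ} (h : H)
    (hB : ∀ N, ∑ n ∈ Finset.range N, ℓ n * ‖layer K n h‖ ^ 2 ≤ B) :
    ∃ g : H, ∀ n w, (∀ m, m ≠ n → ∀ u ∈ K (m + 1) ⊓ (K m)ᗮ, (inner ℝ u w : ℝ) = 0) →
      (inner ℝ g w : ℝ) = √(ℓ n) * inner ℝ h w := by
  let V : ℕ → Submodule ℝ H := fun n => K (n + 1) ⊓ (K n)ᗮ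
  have hV : OrthogonalFamily ℝ (fun n => V n) fun n => (V n).subtypeₗᵢ := by
    intro m n hmn u w
    exact inner_eq_zero_of_mem_layers hK hmn u.2 w.2
  let f : ∀ n, V n := fun n => √(ℓ n) • ⟨layer K n h, layer_mem hK n h⟩
  have hf : ∀ n, ‖f n‖ ^ 2 = ℓ n * ‖layer K n h‖ ^ 2 := fun n => by
    simp only [f, norm_smul, mul_pow, Submodule.coe_norm, Real.norm_eq_abs, sq_abs,
      Real.sq_sqrt (hℓ n)]
  have hs : Summable fun n => ((V n).subtypeₗᵢ (f n) : H) := by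
    rw [hV.summable_iff_norm_sq_summable f]
    simp only [hf]
    exact summable_of_sum_range_le (fun n => mul_nonneg (hℓ n) (sq_nonneg _)) hB
  -- The test vector w is only required to be orthogonal to the other layers, not to lie in the n-th
  -- one: the definition of an eigenpolynomial does not restrict its degree.
  refine ⟨∑' n, ((V n).subtypeₗᵢ (f n) : H), fun n w hw => ?_⟩
  have h1 : HasSum (fun m => (inner ℝ ((V m).subtypeₗᵢ (f m) : H) w : ℝ))
      (inner ℝ (∑' n, ((V n).subtypeₗᵢ (f n) : H)) w) := by
    have h2 := hs.hasSum.mapL (innerSL ℝ w)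
    simpa [real_inner_comm] using h2
  have h3 : ∀ m, m ≠ n → (inner ℝ (layer K m h) w : ℝ) = 0 := fun m hm =>
    hw m hm _ (layer_mem hK m h)
  have h4 := hasSum_single (f := fun m => (inner ℝ ((V m).subtypeₗᵢ (f m) : H) w : ℝ)) n
    fun m hm => hw m hm _ (f m).2
  rw [h1.unique h4]
  -- By density, h is the limit of the partial sums of its layers, of which only the n-th one pairs
  -- with w.
  have h5 : (inner ℝ (layer K n h) w : ℝ) = inner ℝ h w := by
    refine tendsto_nhds_unique ?_ (tendsto_inner_starProjection hK hd h w)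
    refine tendsto_const_nhds.congr' ?_
    filter_upwards [eventually_gt_atTop n] with N hN
    rw [← sum_layer hK0, sum_inner, Finset.sum_eq_single n (fun m _ hm => h3 m hm)
      (fun hn => absurd (Finset.mem_range.2 hN) hn)]
  rw [← h5]
  simp [f, inner_smul_left]

/-- Pairing g with q, the truncated image of h, gives ‖q‖², so Cauchy-Schwarz yields ‖q‖ ≤ ‖g‖. Only
test vectors in the layers are used. -/
lemma sum_layer_le_of_inner (hK : Monotone K) {ℓ : ℕ → ℝ} (hℓ : ∀ n, 0 ≤ ℓ n) (h g : H)
    (hg : ∀ n, ∀ w ∈ K (n + 1) ⊓ (K n)ᗮ, (inner ℝ g w : ℝ) = √(ℓ n) * inner ℝ h w) (N : ℕ) :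
    ∑ n ∈ Finset.range N, ℓ n * ‖layer K n h‖ ^ 2 ≤ ‖g‖ ^ 2 := by
  set q := ∑ n ∈ Finset.range N, √(ℓ n) • layer K n h with hq
  have h1 : ‖q‖ ^ 2 = ∑ n ∈ Finset.range N, ℓ n * ‖layer K n h‖ ^ 2 := by
    rw [hq, norm_sq_sum_smul_layer hK]
    exact Finset.sum_congr rfl fun n _ => by rw [Real.sq_sqrt (hℓ n)]
  have h2 : (inner ℝ g q : ℝ) = ‖q‖ ^ 2 := by
    rw [h1, hq, inner_sum]
    refine Finset.sum_congr rfl fun n _ => ?_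
    rw [inner_smul_right, hg n _ (layer_mem hK n h), inner_layer_self hK, ← mul_assoc,
      Real.mul_self_sqrt (hℓ n)]
  rw [← h1]
  have h3 := real_inner_le_norm g q
  rw [h2] at h3
  have h4 : ‖q‖ ≤ ‖g‖ := by
    rcases (norm_nonneg q).eq_or_lt with h0 | h0
    · rw [← h0]; exact norm_nonneg g
    · exact le_of_mul_le_mul_right (by rw [← sq]; exact h3) h0
  exact pow_le_pow_left₀ (norm_nonneg _) h4 2

end HilbertFiltration

/-! ### Polynomials in the weighted space -/

section PolynomialLp

open Metric Set Filter Topology MvPolynomial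

variable {d : ℕ} {R Rp : Finset (Euc d)} {κ : Euc d → ℝ} {μ : ℝ}

lemma norm_sq_toLp {f : Euc d → ℝ} (hf : MemLp f 2 (weightMeasure Rp κ μ)) :
    ‖hf.toLp f‖ ^ 2 = ∫ x, f x ^ 2 ∂weightMeasure Rp κ μ := by
  rw [← real_inner_self_eq_norm_sq, L2.inner_def]
  refine integral_congr_ae (hf.coeFn_toLp.mono fun x hx => ?_)
  simp [hx]

lemma memLp_polyFun [IsFiniteMeasure (weightMeasure Rp κ μ)] (p : MvPolynomial (Fin d) ℝ) :
    MemLp (polyFun p) 2 (weightMeasure Rp κ μ) := (isTame_polyFun p).memLp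

/-- Polynomials as elements of the weighted `L²` space. -/
noncomputable def polyLp (Rp : Finset (Euc d)) (κ : Euc d → ℝ) (μ : ℝ)
    [IsFiniteMeasure (weightMeasure Rp κ μ)] :
    MvPolynomial (Fin d) ℝ →ₗ[ℝ] Lp ℝ 2 (weightMeasure Rp κ μ) where
  toFun p := (memLp_polyFun p).toLp (polyFun p)
  map_add' p q := by
    rw [← MemLp.toLp_add]
    congr 1
    ext x
    simp
  map_smul' a p := by
    rw [RingHom.id_apply, ← MemLp.toLp_const_smul]
    congr 1
    ext x
    simp

variable [IsFiniteMeasure (weightMeasure Rp κ μ)]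

lemma coeFn_polyLp (p : MvPolynomial (Fin d) ℝ) :
    polyLp Rp κ μ p =ᵐ[weightMeasure Rp κ μ] polyFun p := (memLp_polyFun p).coeFn_toLp

lemma inner_polyLp (h : Lp ℝ 2 (weightMeasure Rp κ μ)) (p : MvPolynomial (Fin d) ℝ) :
    inner ℝ h (polyLp Rp κ μ p) = ∫ x, h x * polyFun p x ∂weightMeasure Rp κ μ := by
  rw [L2.inner_def]
  refine integral_congr_ae ((coeFn_polyLp p).mono fun x hx => ?_)
  simp [hx, mul_comm]

lemma inner_toLp_polyLp {f : Euc d → ℝ} (hf : MemLp f 2 (weightMeasure Rp κ μ))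
    (p : MvPolynomial (Fin d) ℝ) :
    inner ℝ (hf.toLp f) (polyLp Rp κ μ p) = ∫ x, f x * polyFun p x ∂weightMeasure Rp κ μ := by
  rw [inner_polyLp]
  refine integral_congr_ae (hf.coeFn_toLp.mono fun x hx => ?_)
  simp [hx]

lemma inner_polyLp_polyLp (p q : MvPolynomial (Fin d) ℝ) :
    inner ℝ (polyLp Rp κ μ p) (polyLp Rp κ μ q) =
      ∫ x, polyFun p x * polyFun q x ∂weightMeasure Rp κ μ :=
  inner_toLp_polyLp (memLp_polyFun p) q

/-- The filtration of the weighted `L²` space by polynomials of degree less than `n`. -/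
noncomputable def polyFilt (Rp : Finset (Euc d)) (κ : Euc d → ℝ) (μ : ℝ)
    [IsFiniteMeasure (weightMeasure Rp κ μ)] (n : ℕ) :
    Submodule ℝ (Lp ℝ 2 (weightMeasure Rp κ μ)) := (degLT d n).map (polyLp Rp κ μ)

instance (n : ℕ) : FiniteDimensional ℝ (polyFilt Rp κ μ n) := by
  unfold polyFilt
  infer_instance

lemma polyFilt_mono : Monotone (polyFilt Rp κ μ) := fun _ _ h => Submodule.map_mono (degLT_mono h)

lemma polyFilt_zero : polyFilt Rp κ μ 0 = ⊥ := by
  rw [polyFilt, degLT_zero, Submodule.map_bot]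

/-- Stone-Weierstrass on the compact ball: the coordinate functions separate points. -/
lemma exists_polyFun_near {g : Euc d → ℝ} (hg : Continuous g) {ε : ℝ} (hε : 0 < ε) :
    ∃ p : MvPolynomial (Fin d) ℝ, ∀ x ∈ closedBall (0 : Euc d) 1, |polyFun p x - g x| < ε := by
  let φ : MvPolynomial (Fin d) ℝ →ₐ[ℝ] C(Euc d, ℝ) :=
    aeval fun i => (⟨fun x => x i, by fun_prop⟩ : C(Euc d, ℝ))
  have hφ : ∀ p x, φ p x = polyFun p x := by
    intro p x
    induction p using MvPolynomial.induction_on with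
    | C a => simp [φ, polyFun]
    | add p q hp hq => rw [map_add, ContinuousMap.add_apply, hp, hq, polyFun_add]
    | mul_X p i hp =>
      rw [map_mul, ContinuousMap.mul_apply, hp, polyFun_mul, polyFun_X]
      simp [φ]
  have hsep : φ.range.SeparatesPoints := by
    intro x y hxy
    obtain ⟨i, hi⟩ : ∃ i, x i ≠ y i := by
      by_contra h
      push Not at h
      exact hxy (PiLp.ext h)
    exact ⟨_, ⟨φ (X i), ⟨X i, rfl⟩, rfl⟩, by simpa [hφ] using hi⟩
  obtain ⟨g', ⟨p, rfl⟩, hp⟩ :=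
    ContinuousMap.exists_mem_subalgebra_near_continuous_of_isCompact_of_separatesPoints hsep
      ⟨g, hg⟩ (isCompact_closedBall (0 : Euc d) 1) hε
  refine ⟨p, fun x hx => ?_⟩
  have := hp x hx
  rw [Real.norm_eq_abs] at this
  simpa [hφ] using this

/-- Polynomials are dense in the weighted `L²` space. -/
lemma polyFilt_dense : ⊤ ≤ (⨆ n, polyFilt Rp κ μ n).topologicalClosure := by
  intro h _
  rw [← SetLike.mem_coe, Submodule.topologicalClosure_coe, SeminormedAddCommGroup.mem_closure_iff]
  intro ε hε
  obtain ⟨g, hg, hgm⟩ := (Lp.memLp h).exists_boundedContinuous_eLpNorm_sub_le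
    (by norm_num) (ε := ENNReal.ofReal (ε / 3)) (by simpa using hε)
  -- The square root of the total mass, which converts a uniform bound into an L² bound. Dividing by
  -- M + 1 below avoids a case distinction for M = 0.
  set M : ℝ := (measureUnivNNReal (weightMeasure Rp κ μ) : ℝ) ^ (2 : ENNReal).toReal⁻¹ with hM
  have hM0 : 0 ≤ M := Real.rpow_nonneg NNReal.zero_le_coe _
  obtain ⟨p, hp⟩ := exists_polyFun_near g.continuous (ε := ε / 3 / (M + 1)) (by positivity)
  refine ⟨polyLp Rp κ μ p, ?_, ?_⟩
  · obtain ⟨n, hn⟩ := exists_mem_degLT p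
    exact Submodule.mem_iSup_of_mem n (Submodule.mem_map_of_mem hn)
  · have h1 : ‖h - hgm.toLp g‖ ≤ ε / 3 := by
      have e : h - hgm.toLp g = ((Lp.memLp h).sub hgm).toLp _ := by
        rw [MemLp.toLp_sub (Lp.memLp h) hgm, Lp.toLp_coeFn h (Lp.memLp h)]
      rw [e, Lp.norm_toLp]
      exact ENNReal.toReal_le_of_le_ofReal (by positivity) hg
    have h2 : ‖hgm.toLp g - polyLp Rp κ μ p‖ ≤ M * (ε / 3 / (M + 1)) := by
      refine Lp.norm_le_of_ae_bound (by positivity) ?_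
      have h3 : ∀ᵐ x ∂weightMeasure Rp κ μ, x ∈ ball (0 : Euc d) 1 :=
        weightMeasure_absolutelyContinuous.ae_le (ae_restrict_mem measurableSet_ball)
      filter_upwards [Lp.coeFn_sub (hgm.toLp g) (polyLp Rp κ μ p), hgm.coeFn_toLp, coeFn_polyLp p, h3]
        with x e1 e2 e3 e4
      rw [e1, Pi.sub_apply, e2, e3, Real.norm_eq_abs, abs_sub_comm]
      exact (hp x (ball_subset_closedBall e4)).le
    have h4 : M * (ε / 3 / (M + 1)) ≤ ε / 3 := by
      rw [mul_div_assoc', div_le_iff₀ (by positivity)]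
      nlinarith
    calc ‖h - polyLp Rp κ μ p‖ = ‖(h - hgm.toLp g) + (hgm.toLp g - polyLp Rp κ μ p)‖ := by
          rw [sub_add_sub_cancel]
      _ ≤ ε / 3 + ε / 3 := (norm_add_le _ _).trans (add_le_add h1 (h2.trans h4))
      _ < ε := by linarith

end PolynomialLp

end WeightedBall

namespace WeightedBall

/-! ### The spectral decomposition of the ball operator -/

section Spectral

open Metric Set Filter Topology MvPolynomial

variable {d : ℕ} {R Rp : Finset (Euc d)} {κ : Euc d → ℝ} {μ : ℝ}

lemma lam_nonneg (hd : 1 ≤ d) (hμ : 0 ≤ μ) (hR : IsRootSystem R)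
    (hRp : IsPositiveSubsystem R Rp) (hκ : IsMultiplicity R κ) : 0 ≤ lam Rp κ μ := by
  have h := lam_eq_sum_roots hR hRp hκ μ
  have h1 : (1 : ℝ) ≤ d := by exact_mod_cast hd
  have h2 : 0 ≤ ∑ v ∈ R, κ v := Finset.sum_nonneg hκ.nonneg
  linarith

/-- A continuous function that vanishes almost everywhere for the weighted measure vanishes on the
regular points of the open ball. -/
lemma eq_zero_of_ae_eq_zero (hR : IsRootSystem R) (hRp : IsPositiveSubsystem R Rp)
    (hκ : IsMultiplicity R κ) {f : Euc d → ℝ} (hf : Continuous f)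
    (h : ∀ᵐ x ∂weightMeasure Rp κ μ, f x = 0) {x : Euc d} (hx : x ∈ ball (0 : Euc d) 1)
    (hxR : x ∈ regularSet R) : f x = 0 := by
  rw [weightMeasure_eq, ae_withDensity_iff measurable_weight.ennreal_ofReal] at h
  have h2 : f =ᵐ[volume.restrict (ball 0 1 ∩ regularSet R)] fun _ => (0 : ℝ) := by
    filter_upwards [ae_restrict_of_ae_restrict_of_subset inter_subset_left h,
      ae_restrict_mem (isOpen_ball.inter (isOpen_regularSet R)).measurableSet] with z hz hzm
    refine hz ?_
    rw [ne_eq, ENNReal.ofReal_eq_zero, not_le, weight_eq hR hRp hκ]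
    exact mul_pos (rootWeight_pos hzm.2) (Real.rpow_pos_of_pos (one_sub_sq_pos hzm.1) _)
  exact Measure.eqOn_open_of_ae_eq h2 (isOpen_ball.inter (isOpen_regularSet R)) hf.continuousOn
    continuousOn_const ⟨hx, hxR⟩

/-- Let r = Δ^B p + n(n + 2λ)p, of degree less than n. By symmetry ⟨r,r⟩ = ⟨p, Δ^B r⟩ + n(n +
2λ)⟨p,r⟩, and both terms vanish because Δ^B r and r have degree less than n. Hence r = 0 almost
everywhere, and by continuity at every regular point of the open ball. -/
lemma isEigenpoly_of_orthogonal (hd : 1 ≤ d) (hμ : 0 ≤ μ) (hR : IsRootSystem R)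
    (hRp : IsPositiveSubsystem R Rp) (hκ : IsMultiplicity R κ) {n : ℕ}
    {p : MvPolynomial (Fin d) ℝ} (hp : p ∈ degLT d (n + 1))
    (horth : ∀ s ∈ degLT d n, ∫ x, polyFun p x * polyFun s x ∂weightMeasure Rp κ μ = 0) :
    IsEigenpoly Rp κ μ n p := by
  have := isFiniteMeasure_weightMeasure hd hμ hR hRp hκ
  obtain ⟨q, hq, hqe⟩ := exists_ballLaplacian_polyFun hR hRp hκ μ hp
  set r := q + C ((n : ℝ) * (n + 2 * lam Rp κ μ)) * p with hr
  have key : ∫ x, polyFun r x * polyFun r x ∂weightMeasure Rp κ μ = 0 := by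
    rcases n with _ | k
    · rw [degLT_zero] at hq
      rw [(Submodule.mem_bot ℝ).1 hq]
      simp
    · obtain ⟨s, hs, hse⟩ := exists_ballLaplacian_polyFun hR hRp hκ μ hq
      have hs' : s ∈ degLT d (k + 1) := by
        have := Submodule.sub_mem _ (degLT_mono k.le_succ hs)
          (C_mul_mem ((k : ℝ) * (k + 2 * lam Rp κ μ)) hq)
        simpa using this
      have h1 := integral_mul_ballLaplacian_comm hd hμ hR hRp hκ hqe hse
      rw [horth s hs'] at h1
      have h2 := horth r hq
      have e : ∀ x, polyFun r x * polyFun r x = polyFun q x * polyFun r x +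
          ((k + 1 : ℕ) : ℝ) * ((k + 1 : ℕ) + 2 * lam Rp κ μ) * (polyFun p x * polyFun r x) := by
        intro x
        simp only [hr, polyFun_add, polyFun_mul, polyFun_C]
        ring
      simp only [e]
      rw [integral_add (integrable_mul_tame (isTame_polyFun q) (isTame_polyFun r))
        ((integrable_mul_tame (isTame_polyFun p) (isTame_polyFun r)).const_mul _),
        integral_const_mul, h1, h2]
      simp
  rw [integral_eq_zero_iff_of_nonneg (fun x => mul_self_nonneg _)
    (integrable_mul_tame (isTame_polyFun r) (isTame_polyFun r))] at key
  intro x hx hxR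
  rw [← hRp.mem_regularSet hR] at hxR
  have h0 := eq_zero_of_ae_eq_zero hR hRp hκ (continuous_polyFun r)
    (key.mono fun x hx => by simpa using hx) hx hxR
  rw [hqe x hxR]
  simp only [hr, polyFun_add, polyFun_mul, polyFun_C] at h0
  linarith

lemma IsEigenpoly.integral_mul_eq_zero (hd : 1 ≤ d) (hμ : 0 ≤ μ) (hR : IsRootSystem R)
    (hRp : IsPositiveSubsystem R Rp) (hκ : IsMultiplicity R κ) {m n : ℕ} (hmn : m ≠ n)
    {p q : MvPolynomial (Fin d) ℝ} (hp : IsEigenpoly Rp κ μ m p) (hq : IsEigenpoly Rp κ μ n q) :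
    ∫ x, polyFun p x * polyFun q x ∂weightMeasure Rp κ μ = 0 := by
  have h1 := hq.integral_gammaForm hd hμ hR hRp hκ (isTame_polyFun p)
  have h2 := hp.integral_gammaForm hd hμ hR hRp hκ (isTame_polyFun q)
  simp only [gammaForm_comm (polyFun q), mul_comm (polyFun q _)] at h2
  rw [h1] at h2
  have hl := lam_nonneg hd hμ hR hRp hκ
  have hmn' : (m : ℝ) ≠ n := by exact_mod_cast hmn
  have h3 : 0 < (m : ℝ) + n := by
    have : 0 < m + n := by omega
    exact_mod_cast this
  -- The difference of the two eigenvalues, factored; λ ≥ 0 and m ≠ n make the second factor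
  -- positive.
  have h4 : ((n : ℝ) - m) * (n + m + 2 * lam Rp κ μ) *
      ∫ x, polyFun p x * polyFun q x ∂weightMeasure Rp κ μ = 0 := by linear_combination h2
  refine (mul_eq_zero.1 h4).resolve_left (mul_ne_zero (sub_ne_zero.2 hmn'.symm) ?_)
  linarith

/-- The number `n (n + 2 λ)`. -/
noncomputable def eigval (Rp : Finset (Euc d)) (κ : Euc d → ℝ) (μ : ℝ) (n : ℕ) : ℝ :=
  (n : ℝ) * (n + 2 * lam Rp κ μ)

lemma eigval_nonneg (hd : 1 ≤ d) (hμ : 0 ≤ μ) (hR : IsRootSystem R)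
    (hRp : IsPositiveSubsystem R Rp) (hκ : IsMultiplicity R κ) (n : ℕ) :
    0 ≤ eigval Rp κ μ n := by
  have := lam_nonneg hd hμ hR hRp hκ
  unfold eigval
  positivity

lemma one_le_eigval (hd : 1 ≤ d) (hμ : 0 ≤ μ) (hR : IsRootSystem R)
    (hRp : IsPositiveSubsystem R Rp) (hκ : IsMultiplicity R κ) {n : ℕ} (hn : n ≠ 0) :
    1 ≤ eigval Rp κ μ n := by
  have := lam_nonneg hd hμ hR hRp hκ
  have h1 : (1 : ℝ) ≤ n := by exact_mod_cast Nat.one_le_iff_ne_zero.2 hn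
  unfold eigval
  nlinarith

variable [IsFiniteMeasure (weightMeasure Rp κ μ)]

lemma exists_isEigenpoly_of_mem (hd : 1 ≤ d) (hμ : 0 ≤ μ) (hR : IsRootSystem R)
    (hRp : IsPositiveSubsystem R Rp) (hκ : IsMultiplicity R κ) {n : ℕ}
    {u : Lp ℝ 2 (weightMeasure Rp κ μ)}
    (hu : u ∈ polyFilt Rp κ μ (n + 1) ⊓ (polyFilt Rp κ μ n)ᗮ) :
    ∃ p, IsEigenpoly Rp κ μ n p ∧ polyLp Rp κ μ p = u := by
  obtain ⟨p, hp, rfl⟩ := hu.1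
  refine ⟨p, isEigenpoly_of_orthogonal hd hμ hR hRp hκ hp fun s hs => ?_, rfl⟩
  rw [← inner_polyLp_polyLp]
  exact (Submodule.mem_orthogonal' _ _).1 hu.2 _ (Submodule.mem_map_of_mem hs)

lemma IsEigenpoly.inner_eq_zero (hd : 1 ≤ d) (hμ : 0 ≤ μ) (hR : IsRootSystem R)
    (hRp : IsPositiveSubsystem R Rp) (hκ : IsMultiplicity R κ) {m n : ℕ} (hmn : m ≠ n)
    {p : MvPolynomial (Fin d) ℝ} (hp : IsEigenpoly Rp κ μ n p) {u : Lp ℝ 2 (weightMeasure Rp κ μ)}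
    (hu : u ∈ polyFilt Rp κ μ (m + 1) ⊓ (polyFilt Rp κ μ m)ᗮ) :
    inner ℝ u (polyLp Rp κ μ p) = (0 : ℝ) := by
  obtain ⟨q, hq, rfl⟩ := exists_isEigenpoly_of_mem hd hμ hR hRp hκ hu
  rw [inner_polyLp_polyLp]
  exact hq.integral_mul_eq_zero hd hμ hR hRp hκ hmn hp

/-- The orthogonal projection of `h` to polynomials, with its energy. -/
lemma exists_projection_poly (hd : 1 ≤ d) (hμ : 0 ≤ μ) (hR : IsRootSystem R)
    (hRp : IsPositiveSubsystem R Rp) (hκ : IsMultiplicity R κ)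
    (h : Lp ℝ 2 (weightMeasure Rp κ μ)) (N : ℕ) :
    ∃ q, polyLp Rp κ μ q = (polyFilt Rp κ μ N).starProjection h ∧
      (∀ f : Euc d → ℝ, ∀ hf : IsTame f,
        ∫ x, gammaForm R κ f (polyFun q) x ∂weightMeasure Rp κ μ =
          ∑ n ∈ Finset.range N,
            eigval Rp κ μ n * inner ℝ (hf.memLp.toLp f) (layer (polyFilt Rp κ μ) n h)) ∧
      ∫ x, gammaForm R κ (polyFun q) (polyFun q) x ∂weightMeasure Rp κ μ =
        ∑ n ∈ Finset.range N, eigval Rp κ μ n * ‖layer (polyFilt Rp κ μ) n h‖ ^ 2 := by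
  choose p hp hpu using fun n =>
    exists_isEigenpoly_of_mem hd hμ hR hRp hκ (layer_mem polyFilt_mono n h)
  have h1 : polyLp Rp κ μ (∑ n ∈ Finset.range N, p n) = (polyFilt Rp κ μ N).starProjection h := by
    rw [map_sum, ← sum_layer polyFilt_zero]
    exact Finset.sum_congr rfl fun n _ => hpu n
  have h2 : ∀ f : Euc d → ℝ, ∀ hf : IsTame f,
      ∫ x, gammaForm R κ f (polyFun (∑ n ∈ Finset.range N, p n)) x ∂weightMeasure Rp κ μ =
        ∑ n ∈ Finset.range N,
          eigval Rp κ μ n * inner ℝ (hf.memLp.toLp f) (layer (polyFilt Rp κ μ) n h) := by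
    intro f hf
    simp only [gammaForm_polyFun_sum]
    rw [integral_finsetSum _ fun n _ => integrable_gammaForm hR hκ hf (isTame_polyFun (p n))]
    refine Finset.sum_congr rfl fun n _ => ?_
    rw [(hp n).integral_gammaForm hd hμ hR hRp hκ hf, ← hpu n, inner_toLp_polyLp, eigval]
  refine ⟨_, h1, h2, ?_⟩
  rw [h2 _ (isTame_polyFun _)]
  refine Finset.sum_congr rfl fun n hn => ?_
  have h3 : (isTame_polyFun (∑ n ∈ Finset.range N, p n)).memLp.toLp _ =
    (polyFilt Rp κ μ N).starProjection h := h1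
  rw [h3, inner_starProjection_of_mem
    (polyFilt_mono (Finset.mem_range.1 hn) (layer_mem polyFilt_mono n h).1),
    inner_layer_self polyFilt_mono]

/-- Bessel's inequality for the energy. -/
lemma sum_eigval_layer_le (hd : 1 ≤ d) (hμ : 0 ≤ μ) (hR : IsRootSystem R)
    (hRp : IsPositiveSubsystem R Rp) (hκ : IsMultiplicity R κ) {f : Euc d → ℝ} (hf : IsTame f)
    (N : ℕ) :
    ∑ n ∈ Finset.range N, eigval Rp κ μ n *
        ‖layer (polyFilt Rp κ μ) n (hf.memLp.toLp f : Lp ℝ 2 (weightMeasure Rp κ μ))‖ ^ 2 ≤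
      ∫ x, gammaForm R κ f f x ∂weightMeasure Rp κ μ := by
  obtain ⟨q, -, hq, hqq⟩ := exists_projection_poly hd hμ hR hRp hκ
    (hf.memLp.toLp f : Lp ℝ 2 (weightMeasure Rp κ μ)) N
  have h1 := hq f hf
  simp only [inner_layer_self polyFilt_mono] at h1
  have hb : ∀ᵐ x ∂weightMeasure Rp κ μ, x ∈ ball (0 : Euc d) 1 :=
    (ae_weightMeasure hR).mono fun x hx => hx.1
  -- Bessel's argument: expand the nonnegative energy of f - q. The mixed energy of f and q and the
  -- energy of q are the same sum.
  have h2 : 0 ≤ ∫ x, gammaForm R κ (fun x => f x - polyFun q x) (fun x => f x - polyFun q x) x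
      ∂weightMeasure Rp κ μ :=
    integral_nonneg_of_ae (hb.mono fun x hx => gammaForm_self_nonneg hκ _ hx)
  rw [integral_congr_ae (hb.mono fun x hx => gammaForm_sub_self hf (isTame_polyFun q) hx),
    integral_add (f := fun x => gammaForm R κ f f x - 2 * gammaForm R κ f (polyFun q) x)
      ((integrable_gammaForm hR hκ hf hf).sub
      ((integrable_gammaForm hR hκ hf (isTame_polyFun q)).const_mul 2))
      (integrable_gammaForm hR hκ (isTame_polyFun q) (isTame_polyFun q)),
    integral_sub (integrable_gammaForm hR hκ hf hf)
      ((integrable_gammaForm hR hκ hf (isTame_polyFun q)).const_mul 2), integral_const_mul,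
    h1, hqq] at h2
  linarith

/-- `g` is the image of `h` under the square root of the negative ball operator. -/
def IsSqrtImage (Rp : Finset (Euc d)) (κ : Euc d → ℝ) (μ : ℝ)
    [IsFiniteMeasure (weightMeasure Rp κ μ)] (h g : Lp ℝ 2 (weightMeasure Rp κ μ)) : Prop :=
  ∀ n p, IsEigenpoly Rp κ μ n p →
    (inner ℝ g (polyLp Rp κ μ p) : ℝ) = √(eigval Rp κ μ n) * inner ℝ h (polyLp Rp κ μ p)

lemma exists_isSqrtImage (hd : 1 ≤ d) (hμ : 0 ≤ μ) (hR : IsRootSystem R)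
    (hRp : IsPositiveSubsystem R Rp) (hκ : IsMultiplicity R κ) {f : Euc d → ℝ} (hf : IsTame f) :
    ∃ g : Lp ℝ 2 (weightMeasure Rp κ μ), IsSqrtImage Rp κ μ (hf.memLp.toLp f) g := by
  obtain ⟨g, hg⟩ := exists_of_sum_layer_le polyFilt_mono polyFilt_zero polyFilt_dense
    (eigval_nonneg hd hμ hR hRp hκ) _ (sum_eigval_layer_le hd hμ hR hRp hκ hf)
  exact ⟨g, fun n p hp => hg n _ fun m hm u hu => hp.inner_eq_zero hd hμ hR hRp hκ hm hu⟩

lemma IsSqrtImage.sum_le (hd : 1 ≤ d) (hμ : 0 ≤ μ) (hR : IsRootSystem R)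
    (hRp : IsPositiveSubsystem R Rp) (hκ : IsMultiplicity R κ)
    {h g : Lp ℝ 2 (weightMeasure Rp κ μ)} (hg : IsSqrtImage Rp κ μ h g) (N : ℕ) :
    ∑ n ∈ Finset.range N, eigval Rp κ μ n * ‖layer (polyFilt Rp κ μ) n h‖ ^ 2 ≤ ‖g‖ ^ 2 := by
  refine sum_layer_le_of_inner polyFilt_mono (eigval_nonneg hd hμ hR hRp hκ) h g ?_ N
  intro n w hw
  obtain ⟨p, hp, rfl⟩ := exists_isEigenpoly_of_mem hd hμ hR hRp hκ hw
  exact hg n p hp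

/-- The spectral gap. -/
lemma IsSqrtImage.norm_le (hd : 1 ≤ d) (hμ : 0 ≤ μ) (hR : IsRootSystem R)
    (hRp : IsPositiveSubsystem R Rp) (hκ : IsMultiplicity R κ)
    {h g : Lp ℝ 2 (weightMeasure Rp κ μ)} (hg : IsSqrtImage Rp κ μ h g)
    (h1 : inner ℝ h (polyLp Rp κ μ 1) = (0 : ℝ)) : ‖h‖ ^ 2 ≤ ‖g‖ ^ 2 := by
  -- The zeroth layer consists of constants, so it vanishes for mean zero.
  have h0 : layer (polyFilt Rp κ μ) 0 h = 0 := by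
    have h2 := inner_layer_self polyFilt_mono 0 h
    obtain ⟨p, hp, hpe⟩ := (layer_mem polyFilt_mono 0 h).1
    have hC : p = p.coeff 0 • (1 : MvPolynomial (Fin d) ℝ) := by
      ext s
      by_cases hs : s = 0
      · simp [hs]
      · have h3 : s ∉ p.support := fun h4 => by
          have := hp h4
          exact hs ((Finsupp.degree_eq_zero_iff s).1 (by simpa using this))
        simp [MvPolynomial.notMem_support_iff.1 h3, MvPolynomial.coeff_one, Ne.symm hs]
    rw [← hpe, hC, map_smul, inner_smul_right, h1, mul_zero] at h2
    rw [← hpe, hC, map_smul]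
    exact norm_eq_zero.1 (pow_eq_zero_iff two_ne_zero |>.1 h2.symm)
  refine le_of_tendsto ((Submodule.starProjection_tendsto_self _ polyFilt_mono h
    polyFilt_dense).norm.pow 2) (Eventually.of_forall fun N => ?_)
  refine le_trans ?_ (hg.sum_le hd hμ hR hRp hκ N)
  rw [norm_sq_starProjection_eq polyFilt_mono polyFilt_zero]
  refine Finset.sum_le_sum fun n _ => ?_
  rcases eq_or_ne n 0 with rfl | hn
  · simp [h0]
  · exact le_mul_of_one_le_left (sq_nonneg _) (one_le_eigval hd hμ hR hRp hκ hn)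

end Spectral

end WeightedBall

namespace WeightedBall

/-! ### Moving a point onto the hyperplanes that it is close to -/

section Shift

variable {d : ℕ}

/-- Subtract from y a multiple of w, the component of v orthogonal to the span of the roots already
orthogonal to y. This keeps the existing orthogonality relations and can cancel ⟨y,v⟩, since ⟨y,w⟩ =
⟨y,v⟩ and ⟨w,v⟩ = ‖w‖². -/
lemma exists_orthogonal_shift (R : Finset (Euc d)) : ∃ c : ℝ, 0 ≤ c ∧ ∀ y : Euc d, ∀ v ∈ R,
    ∃ z : Euc d, ‖z - y‖ ≤ c * |inner ℝ y v| ∧ inner ℝ z v = (0 : ℝ) ∧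
      ∀ u ∈ R, inner ℝ y u = (0 : ℝ) → inner ℝ z u = (0 : ℝ) := by
  let w : Finset (Euc d) → Euc d → Euc d := fun S v =>
    v - (Submodule.span ℝ (S : Set (Euc d))).starProjection v
  -- The cost is ‖w‖⁻¹|⟨y,v⟩|. Only finitely many w occur, one for each subset S and root v, so a
  -- sum serves as a uniform constant. For w = 0 the convention 0⁻¹ = 0 is the right one, as then
  -- ⟨y,v⟩ = ⟨y,w⟩ = 0 and no move is needed.
  refine ⟨∑ S ∈ R.powerset, ∑ v ∈ R, ‖w S v‖⁻¹, by positivity, fun y v hv => ?_⟩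
  set S : Finset (Euc d) := {u ∈ R | inner ℝ y u = (0 : ℝ)} with hS
  set U := Submodule.span ℝ (S : Set (Euc d)) with hU
  have hc : ‖w S v‖⁻¹ ≤ ∑ S ∈ R.powerset, ∑ v ∈ R, ‖w S v‖⁻¹ :=
    (Finset.single_le_sum (f := fun v => ‖w S v‖⁻¹) (fun _ _ => by positivity) hv).trans
      (Finset.single_le_sum (f := fun S => ∑ v ∈ R, ‖w S v‖⁻¹) (fun _ _ => by positivity)
        (Finset.mem_powerset.2 (Finset.filter_subset _ _)))
  have hyU : ∀ u ∈ U, inner ℝ y u = (0 : ℝ) := by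
    intro u hu
    induction hu using Submodule.span_induction with
    | mem u hu => exact (Finset.mem_filter.1 hu).2
    | zero => exact inner_zero_right y
    | add u v _ _ h1 h2 => rw [inner_add_right, h1, h2, add_zero]
    | smul a u _ h => rw [inner_smul_right, h, mul_zero]
  have hwU : ∀ u ∈ U, inner ℝ (w S v) u = (0 : ℝ) :=
    (Submodule.mem_orthogonal' _ _).1 (U.sub_starProjection_mem_orthogonal v)
  have hyw : inner ℝ y (w S v) = (inner ℝ y v : ℝ) := by
    rw [inner_sub_right, hyU _ (U.starProjection_apply_mem v), sub_zero]
  have hwv : inner ℝ (w S v) v = ‖w S v‖ ^ 2 := by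
    rw [← real_inner_self_eq_norm_sq]
    conv_rhs => rw [inner_sub_right, hwU _ (U.starProjection_apply_mem v), sub_zero]
  refine ⟨y - (inner ℝ y v / ‖w S v‖ ^ 2 : ℝ) • w S v, ?_, ?_, fun u hu h => ?_⟩
  · rw [sub_sub_cancel_left, norm_neg, norm_smul, Real.norm_eq_abs, abs_div, abs_pow, abs_norm]
    calc |inner ℝ y v| / ‖w S v‖ ^ 2 * ‖w S v‖ = ‖w S v‖⁻¹ * |inner ℝ y v| := by
          rcases eq_or_ne ‖w S v‖ 0 with h | h
          · simp [h]
          · field_simp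
      _ ≤ _ := mul_le_mul_of_nonneg_right hc (abs_nonneg _)
  · rw [inner_sub_left, inner_smul_left, hwv]
    rcases eq_or_ne (w S v) 0 with h | h
    · rw [← hyw, h]; simp
    · have : ‖w S v‖ ≠ 0 := norm_ne_zero_iff.2 h
      simp only [conj_trivial]
      field_simp
      ring
  · rw [inner_sub_left, inner_smul_left, h,
      hwU u (Submodule.subset_span (Finset.mem_filter.2 ⟨hu, h⟩))]
    simp

/-- Induction on the number of roots not orthogonal to z. If some hyperplane is too close to z
without containing it, moving z onto it costs O(a) and lowers this number. The total displacement
stays O(a) because there are finitely many roots. -/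
lemma exists_shift_aux (R : Finset (Euc d)) {L : ℝ} (hL : 0 ≤ L) (n : ℕ) : ∀ B : ℝ, ∃ C : ℝ,
    ∀ (y z : Euc d) (a : ℝ), 0 < a → ‖y - z‖ ≤ B * a →
      ({v ∈ R | inner ℝ z v ≠ (0 : ℝ)} : Finset (Euc d)).card ≤ n →
      ∃ z' : Euc d, ‖y - z'‖ ≤ C * a ∧
        ∀ v ∈ R, inner ℝ z' v = (0 : ℝ) ∨ L * (a + ‖y - z'‖) ≤ |inner ℝ z' v| := by
  obtain ⟨c, hc0, hc⟩ := exists_orthogonal_shift R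
  induction n with
  | zero =>
    refine fun B => ⟨B, fun y z a ha hz hcard => ⟨z, hz, fun v hv => Or.inl ?_⟩⟩
    by_contra h
    have h1 := Finset.card_eq_zero.1 (Nat.le_zero.1 hcard)
    have h2 : v ∈ ({v ∈ R | inner ℝ z v ≠ (0 : ℝ)} : Finset (Euc d)) := Finset.mem_filter.2 ⟨hv, h⟩
    rw [h1] at h2
    simp at h2
  | succ n ih =>
    intro B
    -- The offending root has |⟨z,v⟩| ≤ L(1 + B)a, so the move adds at most cL(1 + B)a to the
    -- distance Ba.
    obtain ⟨C, hC⟩ := ih (B + c * (L * (1 + B)))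
    refine ⟨max B C, fun y z a ha hz hcard => ?_⟩
    by_cases hgood : ∀ v ∈ R, inner ℝ z v = (0 : ℝ) ∨ L * (a + ‖y - z‖) ≤ |inner ℝ z v|
    · exact ⟨z, hz.trans (mul_le_mul_of_nonneg_right (le_max_left _ _) ha.le), hgood⟩
    push Not at hgood
    obtain ⟨v, hv, hv0, hvL⟩ := hgood
    obtain ⟨z₁, h1, h2, h3⟩ := hc z v hv
    have h4 : |(inner ℝ z v : ℝ)| ≤ L * (1 + B) * a := by
      refine hvL.le.trans ?_
      rw [mul_assoc]
      refine mul_le_mul_of_nonneg_left ?_ hL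
      linarith
    have h5 : ‖y - z₁‖ ≤ (B + c * (L * (1 + B))) * a := by
      calc ‖y - z₁‖ = ‖(y - z) - (z₁ - z)‖ := by rw [sub_sub_sub_cancel_right]
        _ ≤ ‖y - z‖ + ‖z₁ - z‖ := norm_sub_le _ _
        _ ≤ B * a + c * (L * (1 + B) * a) :=
          add_le_add hz (h1.trans (mul_le_mul_of_nonneg_left h4 hc0))
        _ = _ := by ring
    have h6 : ({v ∈ R | inner ℝ z₁ v ≠ (0 : ℝ)} : Finset (Euc d)).card ≤ n := by
      refine Nat.lt_succ_iff.1 (lt_of_lt_of_le (Finset.card_lt_card ?_) hcard)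
      refine Finset.ssubset_iff_subset_ne.2 ⟨fun u hu => ?_, fun h => ?_⟩
      · rw [Finset.mem_filter] at hu ⊢
        exact ⟨hu.1, fun h => hu.2 (h3 u hu.1 h)⟩
      · have h7 : v ∈ ({v ∈ R | inner ℝ z v ≠ (0 : ℝ)} : Finset (Euc d)) :=
          Finset.mem_filter.2 ⟨hv, hv0⟩
        rw [← h] at h7
        exact (Finset.mem_filter.1 h7).2 h2
    obtain ⟨z', h7, h8⟩ := hC y z₁ a ha h5 h6
    exact ⟨z', h7.trans (mul_le_mul_of_nonneg_right (le_max_right _ _) ha.le), h8⟩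

/-- A unit vector can be moved, at scale `a`, to a unit vector which is quantitatively far from the
hyperplanes `v^⊥`, `v ∈ R`, that do not contain it. -/
lemma exists_shift (R : Finset (Euc d)) {L : ℝ} (hL : 0 ≤ L) : ∃ C a₀ : ℝ, 0 ≤ C ∧ 0 < a₀ ∧
    ∀ (y : Euc d) (a : ℝ), ‖y‖ = 1 → 0 < a → a ≤ a₀ →
      ∃ z : Euc d, ‖z‖ = 1 ∧ ‖y - z‖ ≤ C * a ∧
        ∀ v ∈ R, inner ℝ z v = (0 : ℝ) ∨ L * (a + ‖y - z‖) ≤ |inner ℝ z v| := by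
  -- The factor 3 pays for normalizing z: the distance to y may double, and division by ‖z‖ ≤ 3/2
  -- may cost a factor 2/3.
  obtain ⟨C', hC'⟩ := exists_shift_aux R (L := 3 * L) (by positivity) R.card 0
  set C := max C' 1 with hCdef
  have hC1 : 1 ≤ C := le_max_right _ _
  -- The bound on a keeps z within 1/2 of y, so that ‖z‖ lies between 1/2 and 3/2.
  refine ⟨2 * C, 1 / (2 * C), by positivity, by positivity, fun y a hy ha ha0 => ?_⟩
  obtain ⟨z, hz, hzR⟩ := hC' y y a ha (by simp) (Finset.card_filter_le _ _)
  have hzC : ‖y - z‖ ≤ C * a := hz.trans (mul_le_mul_of_nonneg_right (le_max_left _ _) ha.le)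
  have hz2 : ‖y - z‖ ≤ 1 / 2 := by
    refine hzC.trans ?_
    calc C * a ≤ C * (1 / (2 * C)) := by gcongr
      _ = 1 / 2 := by field_simp
  have habs : |1 - ‖z‖| ≤ ‖y - z‖ := by
    rw [← hy]; exact abs_norm_sub_norm_le y z
  have h1 : 1 / 2 ≤ ‖z‖ := by linarith [(abs_le.1 habs).2]
  have h2 : ‖z‖ ≤ 3 / 2 := by linarith [(abs_le.1 habs).1]
  have hz0 : 0 < ‖z‖ := by linarith
  have h3 : ‖z - ‖z‖⁻¹ • z‖ = |1 - ‖z‖| := by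
    have e : z - ‖z‖⁻¹ • z = (1 - ‖z‖⁻¹) • z := by rw [sub_smul, one_smul]
    rw [e, norm_smul, Real.norm_eq_abs, ← abs_norm z, ← abs_mul, abs_norm, sub_mul,
      inv_mul_cancel₀ hz0.ne', one_mul, abs_sub_comm]
  have h4 : ‖y - ‖z‖⁻¹ • z‖ ≤ 2 * ‖y - z‖ := by
    calc ‖y - ‖z‖⁻¹ • z‖ = ‖(y - z) + (z - ‖z‖⁻¹ • z)‖ := by rw [sub_add_sub_cancel]
      _ ≤ ‖y - z‖ + ‖y - z‖ := (norm_add_le _ _).trans (by rw [h3]; gcongr)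
      _ = _ := by ring
  refine ⟨‖z‖⁻¹ • z, ?_, by linarith, fun v hv => ?_⟩
  · rw [norm_smul, norm_inv, norm_norm, inv_mul_cancel₀ hz0.ne']
  · rw [inner_smul_left, conj_trivial]
    rcases hzR v hv with h | h
    · exact Or.inl (by rw [h, mul_zero])
    · refine Or.inr ?_
      rw [abs_mul, abs_of_pos (inv_pos.2 hz0)]
      have h5 : 2 / 3 ≤ ‖z‖⁻¹ := by
        rw [le_inv_comm₀ (by norm_num) hz0]
        linarith
      calc L * (a + ‖y - ‖z‖⁻¹ • z‖) ≤ L * (2 * (a + ‖y - z‖)) := by gcongr; linarith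
        _ = 2 / 3 * (3 * L * (a + ‖y - z‖)) := by ring
        _ ≤ ‖z‖⁻¹ * |inner ℝ z v| := by gcongr

end Shift

end WeightedBall

namespace WeightedBall

/-! ### The uncertainty inequality in the weighted `L²` space -/

section Uncertainty

open Metric Set Filter Topology

variable {d : ℕ} {R Rp : Finset (Euc d)} {κ : Euc d → ℝ} {μ : ℝ}

lemma ae_ball_weightMeasure : ∀ᵐ x ∂weightMeasure Rp κ μ, x ∈ ball (0 : Euc d) 1 :=
  weightMeasure_absolutelyContinuous.ae_le (ae_restrict_mem measurableSet_ball)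

lemma one_sub_inner_nonneg {x y : Euc d} (hx : x ∈ ball (0 : Euc d) 1) (hy : ‖y‖ = 1) :
    0 ≤ 1 - inner ℝ x y := by linarith [(abs_le.1 (abs_inner_le_one hx hy)).2]

lemma one_sub_inner_le_two {x y : Euc d} (hx : x ∈ ball (0 : Euc d) 1) (hy : ‖y‖ = 1) :
    1 - inner ℝ x y ≤ 2 := by linarith [(abs_le.1 (abs_inner_le_one hx hy)).1]

/-- For a unit vector y, 2(1 - ⟨x,y⟩) = ‖x - y‖² + (1 - ‖x‖²) with both terms nonnegative. So this
is the inequality ‖x - z‖² ≤ 2‖x - y‖² + 2‖y - z‖², halved. -/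
lemma one_sub_inner_le {x y z : Euc d} (hx : x ∈ ball (0 : Euc d) 1) (hy : ‖y‖ = 1)
    (hz : ‖z‖ = 1) : 1 - inner ℝ x z ≤ 2 * (1 - inner ℝ x y) + ‖y - z‖ ^ 2 := by
  have h0 : ‖x‖ ^ 2 ≤ 1 := by
    rw [mem_ball_zero_iff] at hx
    nlinarith [norm_nonneg x]
  have h1 := norm_sub_sq_real x y
  have h2 := norm_sub_sq_real x z
  have h3 : ‖x - z‖ ≤ ‖x - y‖ + ‖y - z‖ := norm_sub_le_norm_sub_add_norm_sub x y z
  have h4 : ‖x - z‖ ^ 2 ≤ (‖x - y‖ + ‖y - z‖) ^ 2 := pow_le_pow_left₀ (norm_nonneg _) h3 2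
  rw [hy] at h1
  rw [hz] at h2
  nlinarith [sq_nonneg (‖x - y‖ - ‖y - z‖)]

lemma integrable_one_sub_inner_mul {φ : Euc d → ℝ} (hφ : Integrable φ (weightMeasure Rp κ μ))
    {y : Euc d} (hy : ‖y‖ ≤ 1) :
    Integrable (fun x => (1 - inner ℝ x y) * φ x) (weightMeasure Rp κ μ) := by
  refine hφ.bdd_mul (c := 2) (by fun_prop) (ae_ball_weightMeasure.mono fun x hx => ?_)
  have h1 := abs_real_inner_le_norm x y
  have h2 : ‖x‖ ≤ 1 := (mem_ball_zero_iff.1 hx).le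
  rw [Real.norm_eq_abs]
  calc |1 - inner ℝ x y| ≤ |1| + |inner ℝ x y| := abs_sub _ _
    _ ≤ 1 + 1 := by
      rw [abs_one]
      gcongr
      exact h1.trans (mul_le_one₀ h2 (norm_nonneg _) hy)
    _ = 2 := by norm_num

lemma norm_sq_Lp (h : Lp ℝ 2 (weightMeasure Rp κ μ)) :
    ‖h‖ ^ 2 = ∫ x, h x ^ 2 ∂weightMeasure Rp κ μ := by
  have := norm_sq_toLp (Lp.memLp h)
  rwa [Lp.toLp_coeFn h (Lp.memLp h)] at this

/-- From k² ≤ 2h² + 2(k - h)² and 1 - ⟨x,y⟩ ≤ 2. It is used with k a projection of h; the factor 2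
is affordable and spares a proof that the integrals for k converge. -/
lemma integral_one_sub_inner_mul_sq_le (h k : Lp ℝ 2 (weightMeasure Rp κ μ)) {y : Euc d}
    (hy : ‖y‖ = 1) :
    ∫ x, (1 - inner ℝ x y) * k x ^ 2 ∂weightMeasure Rp κ μ ≤
      2 * ∫ x, (1 - inner ℝ x y) * h x ^ 2 ∂weightMeasure Rp κ μ + 4 * ‖k - h‖ ^ 2 := by
  have hi : ∀ h : Lp ℝ 2 (weightMeasure Rp κ μ),
      Integrable (fun x => h x ^ 2) (weightMeasure Rp κ μ) := fun h => (Lp.memLp h).integrable_sq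
  rw [norm_sq_Lp, ← integral_const_mul, ← integral_const_mul, ← integral_add
    ((integrable_one_sub_inner_mul (hi h) hy.le).const_mul 2) ((hi (k - h)).const_mul 4)]
  refine integral_mono_ae (integrable_one_sub_inner_mul (hi k) hy.le)
    (((integrable_one_sub_inner_mul (hi h) hy.le).const_mul 2).add ((hi (k - h)).const_mul 4)) ?_
  filter_upwards [ae_ball_weightMeasure, Lp.coeFn_sub k h] with x hx hs
  have h1 := one_sub_inner_nonneg hx hy
  have h2 := one_sub_inner_le_two hx hy
  simp only [hs, Pi.sub_apply]
  nlinarith [mul_nonneg h1 (sq_nonneg (k x - 2 * h x)),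
    mul_le_mul_of_nonneg_right h2 (sq_nonneg (k x - h x))]

variable [IsFiniteMeasure (weightMeasure Rp κ μ)]

/-- The local uncertainty inequality, extended from polynomials to the domain of the square root
of the ball operator. -/
lemma exists_local_uncertainty_Lp (hd : 1 ≤ d) (hμ : 0 ≤ μ) (hR : IsRootSystem R)
    (hRp : IsPositiveSubsystem R Rp) (hκ : IsMultiplicity R κ) :
    ∃ C : ℝ, 0 < C ∧ ∀ (y : Euc d) (ρ K θ : ℝ), ‖y‖ = 1 → 0 < ρ → 0 < θ →
      16 * ∑ v ∈ R, κ v + 4 ≤ K → (d + 2 * μ + ∑ v ∈ R, κ v) * ρ ^ 2 ≤ 1 / 2 →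
      (∀ v ∈ R, inner ℝ y v = (0 : ℝ) ∨ K * ρ ≤ |inner ℝ y v|) →
      ∀ h g : Lp ℝ 2 (weightMeasure Rp κ μ), IsSqrtImage Rp κ μ h g →
        1 / 2 * ‖h‖ ^ 2 ≤ θ * ‖g‖ ^ 2 +
          (C / ρ ^ 2 + 4 / θ) * ∫ x, (1 - inner ℝ x y) * h x ^ 2 ∂weightMeasure Rp κ μ := by
  obtain ⟨C, hC, H⟩ := exists_local_uncertainty hd hμ hR hRp hκ
  refine ⟨2 * C, by positivity, fun y ρ K θ hy hρ hθ hK hρ' hyR h g hg => ?_⟩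
  set A := ∫ x, (1 - inner ℝ x y) * h x ^ 2 ∂weightMeasure Rp κ μ with hA
  have hlim : Tendsto (fun N => (polyFilt Rp κ μ N).starProjection h) atTop (𝓝 h) :=
    Submodule.starProjection_tendsto_self _ polyFilt_mono h polyFilt_dense
  have hl1 : Tendsto (fun N => 1 / 2 * ‖(polyFilt Rp κ μ N).starProjection h‖ ^ 2) atTop
      (𝓝 (1 / 2 * ‖h‖ ^ 2)) := (hlim.norm.pow 2).const_mul _
  -- The energy of each projection is at most ‖g‖², and the approximation error tends to zero; the
  -- remaining 2A accounts for the constants 2C and 4/θ.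
  have hl2 : Tendsto (fun N => θ * ‖g‖ ^ 2 + (C / ρ ^ 2 + 2 / θ) *
      (2 * A + 4 * ‖(polyFilt Rp κ μ N).starProjection h - h‖ ^ 2)) atTop
      (𝓝 (θ * ‖g‖ ^ 2 + (C / ρ ^ 2 + 2 / θ) * (2 * A + 4 * ‖h - h‖ ^ 2))) :=
    ((((hlim.sub_const h).norm.pow 2).const_mul 4).const_add _ |>.const_mul _).const_add _
  have hle := le_of_tendsto_of_tendsto' hl1 hl2 fun N => ?_
  · refine hle.trans (le_of_eq ?_)
    rw [sub_self, norm_zero]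
    ring
  obtain ⟨q, hq, -, hqq⟩ := exists_projection_poly hd hμ hR hRp hκ h N
  have h1 := H y ρ K θ hy hρ hθ hK hρ' hyR q
  have h2 := hg.sum_le hd hμ hR hRp hκ N
  have e1 : ∫ x, polyFun q x ^ 2 ∂weightMeasure Rp κ μ =
      ‖(polyFilt Rp κ μ N).starProjection h‖ ^ 2 := by
    rw [← hq, norm_sq_Lp]
    exact integral_congr_ae ((coeFn_polyLp q).mono fun x hx => by simp only [hx])
  have e2 : ∫ x, (1 - inner ℝ x y) * polyFun q x ^ 2 ∂weightMeasure Rp κ μ =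
      ∫ x, (1 - inner ℝ x y) * (polyFilt Rp κ μ N).starProjection h x ^ 2
        ∂weightMeasure Rp κ μ := by
    rw [← hq]
    exact integral_congr_ae ((coeFn_polyLp q).mono fun x hx => by simp only [hx])
  have h3 := integral_one_sub_inner_mul_sq_le h ((polyFilt Rp κ μ N).starProjection h) hy
  rw [← hA] at h3
  rw [hqq, e1, e2] at h1
  have h4 : 0 ≤ C / ρ ^ 2 + 2 / θ := by positivity
  have h5 := mul_le_mul_of_nonneg_left h3 h4
  have h6 := mul_le_mul_of_nonneg_left h2 hθ.le
  rw [mul_assoc 2 θ⁻¹] at h1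
  rw [div_eq_mul_inv 2 θ] at h5 ⊢
  linarith

end Uncertainty

end WeightedBall

namespace WeightedBall

/-! ### The inequality uniformly over the points of the sphere -/

section Uniform

open Metric Set Filter Topology

variable {d : ℕ} {R Rp : Finset (Euc d)} {κ : Euc d → ℝ} {μ : ℝ}

lemma integral_one_sub_inner_nonneg {φ : Euc d → ℝ} (hφ : ∀ x, 0 ≤ φ x) {y : Euc d} (hy : ‖y‖ = 1) :
    0 ≤ ∫ x, (1 - inner ℝ x y) * φ x ∂weightMeasure Rp κ μ :=
  integral_nonneg_of_ae (ae_ball_weightMeasure.mono fun x hx =>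
    mul_nonneg (one_sub_inner_nonneg hx hy) (hφ x))

lemma integral_one_sub_inner_mul_sq_le_of_norm_sub (h : Lp ℝ 2 (weightMeasure Rp κ μ)) {y z : Euc d}
    (hy : ‖y‖ = 1) (hz : ‖z‖ = 1) :
    ∫ x, (1 - inner ℝ x z) * h x ^ 2 ∂weightMeasure Rp κ μ ≤
      2 * ∫ x, (1 - inner ℝ x y) * h x ^ 2 ∂weightMeasure Rp κ μ + ‖y - z‖ ^ 2 * ‖h‖ ^ 2 := by
  have hi : Integrable (fun x => h x ^ 2) (weightMeasure Rp κ μ) := (Lp.memLp h).integrable_sq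
  rw [norm_sq_Lp, ← integral_const_mul, ← integral_const_mul, ← integral_add
    ((integrable_one_sub_inner_mul hi hy.le).const_mul 2) (hi.const_mul _)]
  refine integral_mono_ae (integrable_one_sub_inner_mul hi hz.le)
    (((integrable_one_sub_inner_mul hi hy.le).const_mul 2).add (hi.const_mul _)) ?_
  filter_upwards [ae_ball_weightMeasure] with x hx
  have := mul_le_mul_of_nonneg_right (one_sub_inner_le hx hy hz) (sq_nonneg (h x))
  linarith

/-- With θ = 1/(8E) and ρ = Mb, M² = 8C, the energy term is 1/8, the cutoff term is 2Cb²/ρ² = 1/4,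
and the last one is 64Eb². Hence 1/2 ≤ 3/8 + 64Eb², that is Eb² ≥ 1/512, and b² ≤ DB concludes. The
indices 1 and 2 stand for the real and the imaginary part. -/
lemma uncertainty_arith {C M D B E b N₁ N₂ G₁ G₂ A₁ A₂ : ℝ} (hC : 0 < C) (hM : 0 < M)
    (hM2 : M ^ 2 = 8 * C) (hD : 0 < D) (hE : 0 < E) (hb : 0 < b) (hb2 : b ^ 2 ≤ D * B)
    (hN : N₁ + N₂ = 1) (hG : E = G₁ + G₂) (hA : A₁ + A₂ ≤ 2 * b ^ 2)
    (k₁ : 1 / 2 * N₁ ≤ 1 / (8 * E) * G₁ + (C / (M * b) ^ 2 + 4 / (1 / (8 * E))) * A₁)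
    (k₂ : 1 / 2 * N₂ ≤ 1 / (8 * E) * G₂ + (C / (M * b) ^ 2 + 4 / (1 / (8 * E))) * A₂) :
    1 / (512 * D) ≤ B * E := by
  have k₃ : 1 / 2 * (N₁ + N₂) ≤
      1 / (8 * E) * (G₁ + G₂) + (C / (M * b) ^ 2 + 4 / (1 / (8 * E))) * (2 * b ^ 2) := by
    have h0 : 0 ≤ C / (M * b) ^ 2 + 4 / (1 / (8 * E)) := by positivity
    have h1 := mul_le_mul_of_nonneg_left hA h0
    rw [mul_add] at h1 ⊢
    rw [mul_add (1 / (8 * E))]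
    exact (add_le_add k₁ k₂).trans (by linarith only [h1])
  have k₄ : 1 / (8 * E) * E + (C / (M * b) ^ 2 + 4 / (1 / (8 * E))) * (2 * b ^ 2) =
      1 / 8 + (1 / 4 + 64 * E * b ^ 2) := by
    rw [mul_pow, hM2]
    field_simp
    ring
  have k₅ : E * b ^ 2 ≤ E * (D * B) := mul_le_mul_of_nonneg_left hb2 hE.le
  rw [hN, ← hG, k₄] at k₃
  rw [div_le_iff₀ (by positivity)]
  linarith only [k₃, k₅]

/-- The uncertainty inequality for a pair of functions in `L²`. -/
lemma exists_uncertainty_Lp (hd : 1 ≤ d) (hμ : 0 ≤ μ) (hR : IsRootSystem R)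
    (hRp : IsPositiveSubsystem R Rp) (hκ : IsMultiplicity R κ)
    [IsFiniteMeasure (weightMeasure Rp κ μ)] :
    ∃ c : ℝ, 0 < c ∧ ∀ y : Euc d, ‖y‖ = 1 → ∀ h₁ h₂ g₁ g₂ : Lp ℝ 2 (weightMeasure Rp κ μ),
      IsSqrtImage Rp κ μ h₁ g₁ → IsSqrtImage Rp κ μ h₂ g₂ →
      inner ℝ h₁ (polyLp Rp κ μ 1) = (0 : ℝ) → inner ℝ h₂ (polyLp Rp κ μ 1) = (0 : ℝ) →
      ‖h₁‖ ^ 2 + ‖h₂‖ ^ 2 = 1 →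
      c ≤ (∫ x, (1 - inner ℝ x y) * h₁ x ^ 2 ∂weightMeasure Rp κ μ +
        ∫ x, (1 - inner ℝ x y) * h₂ x ^ 2 ∂weightMeasure Rp κ μ) * (‖g₁‖ ^ 2 + ‖g₂‖ ^ 2) := by
  obtain ⟨C, hC, H⟩ := exists_local_uncertainty_Lp hd hμ hR hRp hκ
  have hk : 0 ≤ ∑ v ∈ R, κ v := Finset.sum_nonneg hκ.nonneg
  set Q : ℝ := d + 2 * μ + ∑ v ∈ R, κ v with hQ
  have hQ0 : 0 ≤ Q := by positivity
  set M := √(8 * C) with hM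
  have hM0 : 0 < M := Real.sqrt_pos.2 (by positivity)
  have hM2 : M ^ 2 = 8 * C := Real.sq_sqrt (by positivity)
  obtain ⟨C₁, a₀, hC₁, ha₀, hshift⟩ := exists_shift R
    (L := (16 * ∑ v ∈ R, κ v + 4) * M) (by positivity)
  set D := (1 + C₁) ^ 2 with hD
  have hD0 : 0 < D := by positivity
  -- The inner minimum is the threshold above which the spectral gap suffices: below it the shift is
  -- available at scale √B and the radius ρ satisfies (d + 2μ + ∑κ)ρ² ≤ 1/2. The last entry comes
  -- from `uncertainty_arith`.
  refine ⟨min (min (a₀ ^ 2) (1 / (16 * (Q + 1) * C * D))) (1 / (512 * D)), by positivity, ?_⟩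
  intro y hy h₁ h₂ g₁ g₂ hg₁ hg₂ hm₁ hm₂ hnorm
  have hE₁ := hg₁.norm_le hd hμ hR hRp hκ hm₁
  have hE₂ := hg₂.norm_le hd hμ hR hRp hκ hm₂
  set A := ∫ x, (1 - inner ℝ x y) * h₁ x ^ 2 ∂weightMeasure Rp κ μ +
    ∫ x, (1 - inner ℝ x y) * h₂ x ^ 2 ∂weightMeasure Rp κ μ with hA
  set E := ‖g₁‖ ^ 2 + ‖g₂‖ ^ 2 with hE
  have hA0 : 0 ≤ A := add_nonneg (integral_one_sub_inner_nonneg (fun x => sq_nonneg _) hy)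
    (integral_one_sub_inner_nonneg (fun x => sq_nonneg _) hy)
  have hE1 : 1 ≤ E := by linarith
  -- The scale √B has to be positive, and A is only known to be nonnegative; so A is replaced by
  -- slightly larger B.
  suffices key : ∀ B : ℝ, 0 < B → A ≤ B →
      min (min (a₀ ^ 2) (1 / (16 * (Q + 1) * C * D))) (1 / (512 * D)) ≤ B * E by
    refine le_of_forall_pos_le_add fun ε hε => ?_
    have := key (A + ε / E) (by positivity) (by linarith [show 0 < ε / E by positivity])
    rwa [add_mul, div_mul_cancel₀ _ (by positivity)] at this
  intro B hB hAB
  rcases lt_or_ge (min (a₀ ^ 2) (1 / (16 * (Q + 1) * C * D))) B with hbig | hsmall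
  · refine (min_le_left _ _).trans (hbig.le.trans ?_)
    exact le_mul_of_one_le_right hB.le hE1
  refine (min_le_right _ _).trans ?_
  set a := √B with ha
  have ha0 : 0 < a := Real.sqrt_pos.2 hB
  have ha2 : a ^ 2 = B := Real.sq_sqrt hB.le
  obtain ⟨z, hz, hzC, hzR⟩ := hshift y a hy ha0
    (by rw [← sq_le_sq₀ ha0.le ha₀.le, ha2]; exact hsmall.trans (min_le_left _ _))
  -- The scale includes the displacement: the mass seen from z spreads over b, and `exists_shift`
  -- separates z from the hyperplanes relative to b rather than to a.
  set b := a + ‖y - z‖ with hb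
  have hb0 : 0 < b := by positivity
  have hb2 : b ^ 2 ≤ D * B := by
    rw [← ha2, hD, ← mul_pow]
    exact pow_le_pow_left₀ hb0.le (by rw [hb]; linarith only [hzC]) 2
  have hρ : Q * (M * b) ^ 2 ≤ 1 / 2 := by
    have h1 := hsmall.trans (min_le_right _ _)
    rw [le_div_iff₀ (by positivity)] at h1
    rw [mul_pow, hM2]
    have h2 : Q * (8 * C * b ^ 2) ≤ (Q + 1) * (8 * C * (D * B)) := by gcongr; linarith only
    linarith only [h1, h2]
  have hE0 : 0 < E := by linarith
  -- Here K = 16∑κ + 4 and L = KM, so the separation L·b is the required Kρ with ρ = Mb.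
  have hH : ∀ h g : Lp ℝ 2 (weightMeasure Rp κ μ), IsSqrtImage Rp κ μ h g → _ := H z (M * b) _
    (1 / (8 * E)) hz (by positivity) (by positivity) le_rfl hρ (fun v hv => by
      rw [← mul_assoc]; exact hzR v hv)
  have hz₁ := integral_one_sub_inner_mul_sq_le_of_norm_sub h₁ hy hz
  have hz₂ := integral_one_sub_inner_mul_sq_le_of_norm_sub h₂ hy hz
  have k₁ := hH h₁ g₁ hg₁
  have k₂ := hH h₂ g₂ hg₂
  set A₁ := ∫ x, (1 - inner ℝ x z) * h₁ x ^ 2 ∂weightMeasure Rp κ μ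
  set A₂ := ∫ x, (1 - inner ℝ x z) * h₂ x ^ 2 ∂weightMeasure Rp κ μ
  have hAz : A₁ + A₂ ≤ 2 * b ^ 2 := by
    have h1 : A₁ + A₂ ≤ 2 * A + ‖y - z‖ ^ 2 * (‖h₁‖ ^ 2 + ‖h₂‖ ^ 2) := by
      rw [hA]; linarith only [hz₁, hz₂]
    rw [hnorm, mul_one] at h1
    rw [hb]
    nlinarith only [h1, hAB, ha2, mul_nonneg ha0.le (norm_nonneg (y - z)), sq_nonneg ‖y - z‖]
  exact uncertainty_arith hC hM0 hM2 hD0 hE0 hb0 hb2 hnorm rfl hAz k₁ k₂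

end Uniform

end WeightedBall

namespace WeightedBall

/-! ### Complex valued functions -/

section Complex

open Metric Set Filter Topology

variable {d : ℕ} {R Rp : Finset (Euc d)} {κ : Euc d → ℝ} {μ : ℝ}

lemma memLp_re {F : Euc d → ℂ} (hF : MemLp F 2 (weightMeasure Rp κ μ)) :
    MemLp (fun x => (F x).re) 2 (weightMeasure Rp κ μ) := hF.re

lemma memLp_im {F : Euc d → ℂ} (hF : MemLp F 2 (weightMeasure Rp κ μ)) :
    MemLp (fun x => (F x).im) 2 (weightMeasure Rp κ μ) := hF.im

lemma norm_sq_eq_re_im (z : ℂ) : ‖z‖ ^ 2 = z.re ^ 2 + z.im ^ 2 := by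
  rw [Complex.sq_norm, Complex.normSq_apply]
  ring

lemma integral_norm_sq_eq {F : Euc d → ℂ} (hF : MemLp F 2 (weightMeasure Rp κ μ)) :
    ∫ x, ‖F x‖ ^ 2 ∂weightMeasure Rp κ μ =
      ‖(memLp_re hF).toLp _‖ ^ 2 + ‖(memLp_im hF).toLp _‖ ^ 2 := by
  rw [norm_sq_toLp, norm_sq_toLp,
    ← integral_add (memLp_re hF).integrable_sq (memLp_im hF).integrable_sq]
  simp only [norm_sq_eq_re_im]

lemma integral_one_sub_inner_mul_norm_sq_eq {F : Euc d → ℂ}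
    (hF : MemLp F 2 (weightMeasure Rp κ μ)) {y : Euc d} (hy : ‖y‖ ≤ 1) :
    ∫ x, (1 - inner ℝ x y) * ‖F x‖ ^ 2 ∂weightMeasure Rp κ μ =
      ∫ x, (1 - inner ℝ x y) * ((memLp_re hF).toLp _ : Euc d → ℝ) x ^ 2 ∂weightMeasure Rp κ μ +
      ∫ x, (1 - inner ℝ x y) * ((memLp_im hF).toLp _ : Euc d → ℝ) x ^ 2 ∂weightMeasure Rp κ μ := by
  rw [← integral_add
    (integrable_one_sub_inner_mul (Lp.memLp ((memLp_re hF).toLp _)).integrable_sq hy)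
    (integrable_one_sub_inner_mul (Lp.memLp ((memLp_im hF).toLp _)).integrable_sq hy)]
  refine integral_congr_ae ?_
  filter_upwards [(memLp_re hF).coeFn_toLp, (memLp_im hF).coeFn_toLp] with x h1 h2
  rw [h1, h2, norm_sq_eq_re_im]
  ring

/-- The mean of a density is attained at a unit vector in the direction of its barycenter. -/
lemma exists_isMinOn_one_sub_inner (hd : 1 ≤ d) {φ : Euc d → ℝ}
    (hφ : Integrable φ (weightMeasure Rp κ μ)) :
    ∃ y₀ : Euc d, ‖y₀‖ = 1 ∧ IsMinOn (fun y : Euc d =>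
      ∫ x, (1 - inner ℝ x y) * φ x ∂weightMeasure Rp κ μ) (closedBall 0 1) y₀ := by
  have hi : Integrable (fun x => φ x • x) (weightMeasure Rp κ μ) := by
    refine hφ.smul_bdd 1 (by fun_prop) (ae_ball_weightMeasure.mono fun x hx => ?_)
    exact (mem_ball_zero_iff.1 hx).le
  set τ := ∫ x, φ x • x ∂weightMeasure Rp κ μ with hτ
  have e : ∀ y : Euc d, ∫ x, (1 - inner ℝ x y) * φ x ∂weightMeasure Rp κ μ =
      ∫ x, φ x ∂weightMeasure Rp κ μ - inner ℝ y τ := by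
    intro y
    rw [hτ, ← integral_inner hi, ← integral_sub hφ (hi.const_inner y)]
    refine integral_congr_ae (ae_of_all _ fun x => ?_)
    simp only [inner_smul_right, real_inner_comm x y]
    ring
  obtain ⟨y₀, h1, h2⟩ : ∃ y₀ : Euc d, ‖y₀‖ = 1 ∧ inner ℝ y₀ τ = ‖τ‖ := by
    by_cases h : τ = 0
    · exact ⟨EuclideanSpace.single ⟨0, hd⟩ 1, by simp, by simp [h]⟩
    · have h0 : ‖τ‖ ≠ 0 := norm_ne_zero_iff.2 h
      refine ⟨‖τ‖⁻¹ • τ, ?_, ?_⟩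
      · rw [norm_smul, norm_inv, norm_norm, inv_mul_cancel₀ h0]
      · rw [inner_smul_left, real_inner_self_eq_norm_sq, conj_trivial]
        field_simp
  refine ⟨y₀, h1, isMinOn_iff.2 fun y hy => ?_⟩
  rw [e, e, h2]
  have h3 := real_inner_le_norm y τ
  have h4 : ‖y‖ * ‖τ‖ ≤ 1 * ‖τ‖ :=
    mul_le_mul_of_nonneg_right (mem_closedBall_zero_iff.1 hy) (norm_nonneg _)
  linarith

variable [IsFiniteMeasure (weightMeasure Rp κ μ)]

lemma integral_mul_polyFun_eq {F : Euc d → ℂ} (hF : MemLp F 2 (weightMeasure Rp κ μ))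
    (p : MvPolynomial (Fin d) ℝ) :
    ∫ x, F x * (polyFun p x : ℂ) ∂weightMeasure Rp κ μ =
      (inner ℝ ((memLp_re hF).toLp _) (polyLp Rp κ μ p) : ℝ) +
        (inner ℝ ((memLp_im hF).toLp _) (polyLp Rp κ μ p) : ℝ) * Complex.I := by
  have hi : Integrable (fun x => F x * (polyFun p x : ℂ)) (weightMeasure Rp κ μ) :=
    hF.integrable_mul (memLp_polyFun p).ofReal
  rw [inner_toLp_polyLp, inner_toLp_polyLp, ← integral_re_add_im hi]
  simp

/-- The test polynomials and the factors √(n(n + 2λ)) are real, so the defining identity splits into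
real and imaginary parts. -/
lemma isSqrtNegLaplacian_iff {f g : Euc d → ℂ} (hf : MemLp f 2 (weightMeasure Rp κ μ))
    (hg : MemLp g 2 (weightMeasure Rp κ μ)) :
    IsSqrtNegLaplacian Rp κ μ f g ↔
      IsSqrtImage Rp κ μ ((memLp_re hf).toLp _) ((memLp_re hg).toLp _) ∧
      IsSqrtImage Rp κ μ ((memLp_im hf).toLp _) ((memLp_im hg).toLp _) := by
  have key : ∀ (n : ℕ) p, (∫ x, g x * (polyFun p x : ℂ) ∂(weightMeasure Rp κ μ) =
      (√((n : ℝ) * (n + 2 * lam Rp κ μ)) : ℂ) *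
        ∫ x, f x * (polyFun p x : ℂ) ∂(weightMeasure Rp κ μ)) ↔
      ((inner ℝ ((memLp_re hg).toLp _) (polyLp Rp κ μ p) : ℝ) =
        √(eigval Rp κ μ n) * inner ℝ ((memLp_re hf).toLp _) (polyLp Rp κ μ p) ∧
      (inner ℝ ((memLp_im hg).toLp _) (polyLp Rp κ μ p) : ℝ) =
        √(eigval Rp κ μ n) * inner ℝ ((memLp_im hf).toLp _) (polyLp Rp κ μ p)) := by
    intro n p
    rw [integral_mul_polyFun_eq hf, integral_mul_polyFun_eq hg, Complex.ext_iff, eigval]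
    simp
  constructor
  · intro h
    exact ⟨fun n p hp => ((key n p).1 (h.component n p hp)).1,
      fun n p hp => ((key n p).1 (h.component n p hp)).2⟩
  · rintro ⟨h1, h2⟩
    exact ⟨hg, fun n p hp => (key n p).2 ⟨h1 n p hp, h2 n p hp⟩⟩

lemma isTame_re {f : Euc d → ℂ} (hf : ContDiffOn ℝ 1 f (closedBall 0 1)) :
    IsTame fun x => (f x).re :=
  isTame_of_contDiffOn (Complex.reCLM.contDiff.comp_contDiffOn hf)

lemma isTame_im {f : Euc d → ℂ} (hf : ContDiffOn ℝ 1 f (closedBall 0 1)) :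
    IsTame fun x => (f x).im :=
  isTame_of_contDiffOn (Complex.imCLM.contDiff.comp_contDiffOn hf)

lemma memLp_of_contDiffOn {f : Euc d → ℂ} (hf : ContDiffOn ℝ 1 f (closedBall 0 1)) :
    MemLp f 2 (weightMeasure Rp κ μ) :=
  memLp_re_im_iff.1 ⟨(isTame_re hf).memLp, (isTame_im hf).memLp⟩

lemma exists_isSqrtNegLaplacian (hd : 1 ≤ d) (hμ : 0 ≤ μ) (hR : IsRootSystem R)
    (hRp : IsPositiveSubsystem R Rp) (hκ : IsMultiplicity R κ) {f : Euc d → ℂ}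
    (hf : ContDiffOn ℝ 1 f (closedBall 0 1)) : ∃ g, IsSqrtNegLaplacian Rp κ μ f g := by
  obtain ⟨g₁, hg₁⟩ := exists_isSqrtImage hd hμ hR hRp hκ (isTame_re hf)
  obtain ⟨g₂, hg₂⟩ := exists_isSqrtImage hd hμ hR hRp hκ (isTame_im hf)
  have hg : MemLp (fun x => (⟨g₁ x, g₂ x⟩ : ℂ)) 2 (weightMeasure Rp κ μ) :=
    memLp_re_im_iff.1 ⟨Lp.memLp g₁, Lp.memLp g₂⟩
  refine ⟨_, (isSqrtNegLaplacian_iff (memLp_of_contDiffOn hf) hg).2 ⟨?_, ?_⟩⟩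
  · rw [Lp.toLp_coeFn g₁]
    exact hg₁
  · rw [Lp.toLp_coeFn g₂]
    exact hg₂

end Complex

open Metric in
lemma exists_uncertainty {d : ℕ} {R Rp : Finset (Euc d)} {κ : Euc d → ℝ} {μ : ℝ} (hd : 1 ≤ d)
    (hμ : 0 ≤ μ) (hR : IsRootSystem R) (hRp : IsPositiveSubsystem R Rp) (hκ : IsMultiplicity R κ) :
    ∃ c : ℝ, 0 < c ∧ ∀ f : Euc d → ℂ, ContDiffOn ℝ 1 f (closedBall 0 1) →
      ∫ x, f x ∂weightMeasure Rp κ μ = 0 → ∫ x, ‖f x‖ ^ 2 ∂weightMeasure Rp κ μ = 1 →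
      ∀ g, IsSqrtNegLaplacian Rp κ μ f g → ∀ y : Euc d, ‖y‖ = 1 →
        c ≤ (∫ x, (1 - inner ℝ x y) * ‖f x‖ ^ 2 ∂weightMeasure Rp κ μ) *
          ∫ x, ‖g x‖ ^ 2 ∂weightMeasure Rp κ μ := by
  have := isFiniteMeasure_weightMeasure hd hμ hR hRp hκ
  obtain ⟨c, hc, H⟩ := exists_uncertainty_Lp hd hμ hR hRp hκ
  refine ⟨c, hc, fun f hf hf0 hf1 g hg y hy => ?_⟩
  have hfL : MemLp f 2 (weightMeasure Rp κ μ) := memLp_of_contDiffOn hf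
  have hgL := hg.memLp
  have hs := (isSqrtNegLaplacian_iff hfL hgL).1 hg
  have h1 := integral_mul_polyFun_eq hfL 1
  simp only [polyFun_one, Complex.ofReal_one, mul_one, hf0] at h1
  have hre := congrArg Complex.re h1
  have him := congrArg Complex.im h1
  simp only [Complex.zero_re, Complex.zero_im, Complex.add_re, Complex.add_im, Complex.re_ofReal_mul,
    Complex.im_ofReal_mul, Complex.ofReal_re, Complex.ofReal_im, Complex.I_re, Complex.I_im, mul_zero,
    mul_one, add_zero, zero_add] at hre him
  rw [integral_norm_sq_eq hgL, integral_one_sub_inner_mul_norm_sq_eq hfL hy.le]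
  rw [integral_norm_sq_eq hfL] at hf1
  exact H y hy _ _ _ _ hs.1 hs.2 hre.symm him.symm hf1

end WeightedBall

theorem mainTheorem3 (d : ℕ) (hd : 1 ≤ d)
    (R : Finset (EuclideanSpace ℝ (Fin d))) (hR : WeightedBall.IsRootSystem R)
    (κ : EuclideanSpace ℝ (Fin d) → ℝ) (hκ : WeightedBall.IsMultiplicity R κ)
    (μ : ℝ) (hμ : 0 ≤ μ) :
    ∃ C : ℝ, 0 < C ∧
      ∀ Rp : Finset (EuclideanSpace ℝ (Fin d)), WeightedBall.IsPositiveSubsystem R Rp →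
      ∀ f : EuclideanSpace ℝ (Fin d) → ℂ,
        ContDiffOn ℝ 1 f (Metric.closedBall 0 1) →
        ∫ x, f x ∂(WeightedBall.weightMeasure Rp κ μ) = 0 →
        ∫ x, ‖f x‖ ^ 2 ∂(WeightedBall.weightMeasure Rp κ μ) = 1 →
        (∃ g, WeightedBall.IsSqrtNegLaplacian Rp κ μ f g) ∧
        ∀ g, WeightedBall.IsSqrtNegLaplacian Rp κ μ f g →
          ∃ y₀ ∈ Metric.closedBall (0 : EuclideanSpace ℝ (Fin d)) 1,
            IsMinOn (fun y : EuclideanSpace ℝ (Fin d) =>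
              ∫ x, (1 - inner ℝ x y) * ‖f x‖ ^ 2 ∂(WeightedBall.weightMeasure Rp κ μ))
              (Metric.closedBall 0 1) y₀ ∧
            C ≤ (∫ x, (1 - inner ℝ x y₀) * ‖f x‖ ^ 2 ∂(WeightedBall.weightMeasure Rp κ μ)) *
              ∫ x, ‖g x‖ ^ 2 ∂(WeightedBall.weightMeasure Rp κ μ) := by
  classical
  have hc := fun (Rp : Finset (EuclideanSpace ℝ (Fin d)))
    (hRp : WeightedBall.IsPositiveSubsystem R Rp) =>
      WeightedBall.exists_uncertainty hd hμ hR hRp hκ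
  choose! c hc0 hc using hc
  have hsub : ∀ Rp, WeightedBall.IsPositiveSubsystem R Rp →
      Rp ∈ R.powerset.filter fun Rp => WeightedBall.IsPositiveSubsystem R Rp := fun Rp hRp =>
    Finset.mem_filter.2 ⟨Finset.mem_powerset.2 hRp.subset, hRp⟩
  -- The constant must not depend on the positive subsystem. As a finite R has finitely many, the
  -- smallest of their constants works; the value 1 covers the vacuous case.
  obtain ⟨C, hC0, hC⟩ : ∃ C : ℝ, 0 < C ∧ ∀ Rp, WeightedBall.IsPositiveSubsystem R Rp → C ≤ c Rp := by
    rcases (R.powerset.filter fun Rp => WeightedBall.IsPositiveSubsystem R Rp).eq_empty_or_nonempty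
      with h | h
    · exact ⟨1, one_pos, fun Rp hRp => by simpa [h] using hsub Rp hRp⟩
    · exact ⟨_, (Finset.lt_inf'_iff h).2 fun Rp hRp => hc0 Rp (Finset.mem_filter.1 hRp).2,
        fun Rp hRp => Finset.inf'_le c (hsub Rp hRp)⟩
  refine ⟨C, hC0, fun Rp hRp f hf hf0 hf1 => ?_⟩
  have := WeightedBall.isFiniteMeasure_weightMeasure hd hμ hR hRp hκ
  refine ⟨WeightedBall.exists_isSqrtNegLaplacian hd hμ hR hRp hκ hf, fun g hg => ?_⟩
  obtain ⟨y₀, hy₀, hmin⟩ := WeightedBall.exists_isMinOn_one_sub_inner (Rp := Rp) (κ := κ) (μ := μ) hd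
    (WeightedBall.memLp_of_contDiffOn hf).norm.integrable_sq
  exact ⟨y₀, mem_closedBall_zero_iff.2 hy₀.le, hmin,
    (hC Rp hRp).trans (hc Rp hRp f hf hf0 hf1 g hg y₀ hy₀)⟩
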